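/- Let $G$ be a compact connected semisimple Lie group and $L\subsetneq K\subsetneq G$ connected closed non-trivial subgroups, with Lie algebras $\mathfrak l\subset\mathfrak k\subset\mathfrak g$. Let $\Phi$ be the Killing form of $\mathfrak g$, $B=-\Phi$, let $\mathfrak n$ be the $B$-orthogonal complement of $\mathfrak k$ in $\mathfrak g$ and $\mathfrak p$ the $B$-orthogonal complement of $\mathfrak l$ in $\mathfrak k$, so that $\mathfrak g=\mathfrak l\oplus\mathfrak p\oplus\mathfrak n$ and $\mathfrak m=\mathfrak p\oplus\mathfrak n$ is identified with the tangent space of $M=G/L$ at the base point. Assume that the base $N=G/K$ and the fiber $F=K/L$ of the fibration $M=G/L\to G/K=N$ are (isotropy) irreducible symmetric spaces, i.e. $[\mathfrak n,\mathfrak n]\subset\mathfrak k$, $[\mathfrak p,\mathfrak p]\subset\mathfrak l$, $\mathfrak n$ is an irreducible $\mathrm{Ad}\,K$-module and $\mathfrak p$ is an irreducible $\mathrm{Ad}\,L$-module; that $F$ is simply connected with $\dim F>1$; and that $\mathfrak p$ and $\mathfrak n$ contain no equivalent non-zero $\mathrm{Ad}\,L$-submodules. A $G$-invariant Riemannian metric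 on $M$ is called adapted if, for some Riemannian metric on $N$, the projection $M\to N$ is a Riemannian submersion with totally geodesic fibers; it is Einstein if $\mathrm{Ric}=c\,g$ for a constant $c$. For a subspace $U\subset\mathfrak g$ let $C_U=\sum_i \mathrm{ad}_{u_i}\mathrm{ad}_{u^i}$ be its Casimir operator, where $(u_i)$ is a basis of $U$ and $(u^i)$ the $\Phi$-dual basis of $U$ (equivalently $C_U=-\sum_i(\mathrm{ad}_{e_i})^2$ for a $B$-orthonormal basis $(e_i)$ of $U$). Then $C_{\mathfrak k}$ acts on $\mathfrak p$ as a scalar $\gamma>0$, and $M$ admits an Einstein adapted metric if and only if $C_{\mathfrak p}$ acts on $\mathfrak n$ as a scalar $b$ and $$\Delta=1-2\gamma(1-\gamma+2b)\ge 0 .$$ If these two conditions are satisfied, then the Einstein adapted metrics on $M$ are, up to homothety, exactly the $G$-invariant metrics determined by the inner products $$g_{\mathfrak m}=B_{\mathfrak p}\oplus X B_{\mathfrak n}\quad\text{on }\mathfrak m=\mathfrak p\oplus\mathfrak n,\qquad X=\frac{1\pm\sqrt{\Delta}}{2\gamma},\quad X>0,$$ where $B_{\mathfrak p}$, $B_{\mathfrak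 n}$ are the restrictions of $B$; and each such $X>0$ does occur. -/

import Mathlib

open Bundle
open scoped Manifold ContDiff

noncomputable section

/-! ### Riemannian geometry in charts

`M` is a smooth manifold without boundary, modelled on a finite-dimensional real vector space `V`.
In Mathlib the tangent space at `x` is `V`, a vector being represented by its coordinates in the
preferred chart at `x`; accordingly, every tensor is computed below at `x` in that chart. -/

section Riemannian

variable {V : Type*} [NormedAddCommGroup V] [NormedSpace ℝ V]
  {M : Type*} [TopologicalSpace M] [ChartedSpace V M] [IsManifold 𝓘(ℝ, V) ∞ M]
  {W : Type*} [NormedAddCommGroup W] [NormedSpace ℝ W]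
  {N : Type*} [TopologicalSpace N] [ChartedSpace W N] [IsManifold 𝓘(ℝ, W) ∞ N]

variable (V M) in
/-- Smooth Riemannian metrics on the manifold `M`. -/
abbrev SmoothMetric : Type _ :=
  ContMDiffRiemannianMetric 𝓘(ℝ, V) ∞ V (fun x : M => TangentSpace 𝓘(ℝ, V) x)

/-- The differential at `x` of a map between manifolds. -/
def differential (f : M → N) (x : M) : V →L[ℝ] W :=
  mfderiv 𝓘(ℝ, V) 𝓘(ℝ, W) f x

/-- The metric `g` at the point `x`, as a bilinear form on the model space. -/
def SmoothMetric.at (g : SmoothMetric V M) (x : M) : V →L[ℝ] V →L[ℝ] ℝ :=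
  g.inner x

/-- The coefficients of the metric `g` in the preferred chart at `x`: the pull-back of `g` by the
inverse of that chart, a field of bilinear forms near the point `extChartAt 𝓘(ℝ, V) x x`. -/
def SmoothMetric.coeff (g : SmoothMetric V M) (x : M) (y : V) : V →L[ℝ] V →L[ℝ] ℝ :=
  (g.at ((extChartAt 𝓘(ℝ, V) x).symm y)).bilinearComp
    (differential (extChartAt 𝓘(ℝ, V) x).symm y) (differential (extChartAt 𝓘(ℝ, V) x).symm y)

/-- The Christoffel symbols `Γ(u, v)` of a field `h` of nondegenerate symmetric bilinear forms on
`V`, for constant vector fields `u`, `v`: the vector with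
`h(Γ(u, v), w) = (D_u h(v, w) + D_v h(u, w) - D_w h(u, v)) / 2` for all `w`.
(The inverse is that of the isomorphism of `V` with its dual which `h y` induces.) -/
def christoffel (h : V → V →L[ℝ] V →L[ℝ] ℝ) (y u v : V) : V :=
  (h y).inverse
    ((1 / 2 : ℝ) • (fderiv ℝ h y u v + fderiv ℝ h y v u - ((fderiv ℝ h y).flip u).flip v))

/-- The curvature `R(u, v) w = ∇_u ∇_v w - ∇_v ∇_u w` of the Levi-Civita connection of `h`,
for constant vector fields `u`, `v`, `w` on `V`. -/
def curvatureTensor (h : V → V →L[ℝ] V →L[ℝ] ℝ) (y u v w : V) : V :=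
  fderiv ℝ (fun z => christoffel h z v w) y u - fderiv ℝ (fun z => christoffel h z u w) y v
    + christoffel h y u (christoffel h y v w) - christoffel h y v (christoffel h y u w)

/-- The Ricci curvature of `g` at `x`: `Ric(v, w)` is the trace of `u ↦ R(u, v) w`. -/
def SmoothMetric.ricci [FiniteDimensional ℝ V] (g : SmoothMetric V M) (x : M) (v w : V) : ℝ :=
  ∑ i, (Module.finBasis ℝ V).repr
    (curvatureTensor (g.coeff x) (extChartAt 𝓘(ℝ, V) x x) (Module.finBasis ℝ V i) v w) i

/-- `g` is Einstein: `Ric = c g` for a constant `c`. -/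
def SmoothMetric.IsEinstein [FiniteDimensional ℝ V] (g : SmoothMetric V M) : Prop :=
  ∃ c : ℝ, ∀ (x : M) (v w : V), g.ricci x v w = c * g.at x v w

/-- The covariant acceleration at time `t` of a curve in `(M, g)`, a tangent vector at `c t`. -/
def SmoothMetric.acceleration (g : SmoothMetric V M) (c : ℝ → M) (t : ℝ) : V :=
  deriv (deriv (fun s => extChartAt 𝓘(ℝ, V) (c t) (c s))) t
    + christoffel (g.coeff (c t)) (extChartAt 𝓘(ℝ, V) (c t) (c t))
        (deriv (fun s => extChartAt 𝓘(ℝ, V) (c t) (c s)) t)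
        (deriv (fun s => extChartAt 𝓘(ℝ, V) (c t) (c s)) t)

/-- `f : (M, g) → (N, g')` is a Riemannian submersion: a smooth submersion whose differential
is isometric on the orthogonal complement of its kernel. -/
def IsRiemannianSubmersion (g : SmoothMetric V M) (g' : SmoothMetric W N) (f : M → N) : Prop :=
  ContMDiff 𝓘(ℝ, V) 𝓘(ℝ, W) ∞ f ∧
  (∀ x, Function.Surjective (differential (V := V) (W := W) f x)) ∧
  ∀ (x : M) (u v : V),
    (∀ z : V, differential (V := V) (W := W) f x z = 0 → g.at x u z = 0) →
    (∀ z : V, differential (V := V) (W := W) f x z = 0 → g.at x v z = 0) →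
    g'.at (f x) (differential f x u) (differential f x v) = g.at x u v

variable (W) in
/-- The fibres of the submersion `f` are totally geodesic, that is, their second fundamental form
vanishes: every curve in a fibre has covariant acceleration tangent to the fibre. -/
def HasTotallyGeodesicFibers (g : SmoothMetric V M) (f : M → N) : Prop :=
  ∀ c : ℝ → M, ContMDiff 𝓘(ℝ, ℝ) 𝓘(ℝ, V) ∞ c → (∀ s t, f (c s) = f (c t)) →
    ∀ t, differential (V := V) (W := W) f (c t) (g.acceleration c t) = 0

end Riemannian

/-! ### Lie groups -/

section LieGroups

variable {E : Type*} [NormedAddCommGroup E] [NormedSpace ℝ E]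
  {G : Type*} [TopologicalSpace G] [ChartedSpace E G] [Group G]

instance lieGroup_minSmoothness [LieGroup 𝓘(ℝ, E) ∞ G] :
    LieGroup 𝓘(ℝ, E) (minSmoothness ℝ 3) G :=
  LieGroup.of_le (n := ∞) (by rw [minSmoothness_of_isRCLikeNormedField]; exact ENat.LEInfty.out)

variable (E) in
/-- The adjoint representation `Ad a` of `G` on its Lie algebra: the differential at `1` of
conjugation by `a`. -/
def adjointRep (a : G) (X : GroupLieAlgebra 𝓘(ℝ, E) G) : GroupLieAlgebra 𝓘(ℝ, E) G :=
  differential (V := E) (W := E) (fun x : G => a * x * a⁻¹) 1 X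

variable (E) in
/-- The Lie algebra of a closed subgroup `H` of `G`, as a subspace of the Lie algebra of `G`: the
velocities at `1` of the smooth curves in `H`. (For closed `H` these velocities form a subspace, so
that taking the span adds nothing.) -/
def lieAlgebraOf (H : Subgroup G) : Submodule ℝ (GroupLieAlgebra 𝓘(ℝ, E) G) :=
  Submodule.span ℝ {X | ∃ c : ℝ → G, (∀ t, c t ∈ H) ∧ c 0 = 1 ∧
    ContMDiffAt 𝓘(ℝ, ℝ) 𝓘(ℝ, E) ∞ c 0 ∧ differential (V := ℝ) (W := E) c 0 1 = X}

/-- `U` is an `Ad H`-submodule. -/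
def IsAdInvariant (H : Subgroup G) (U : Submodule ℝ (GroupLieAlgebra 𝓘(ℝ, E) G)) : Prop :=
  ∀ a ∈ H, ∀ X ∈ U, adjointRep E a X ∈ U

/-- `U` is an irreducible `Ad H`-submodule. -/
def IsAdIrreducible (H : Subgroup G) (U : Submodule ℝ (GroupLieAlgebra 𝓘(ℝ, E) G)) : Prop :=
  IsAdInvariant H U ∧ U ≠ ⊥ ∧ ∀ U' ≤ U, IsAdInvariant H U' → U' = ⊥ ∨ U' = U

/-- The `Ad H`-submodules `U` and `U'` are equivalent: some linear map restricts to an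
`Ad H`-equivariant bijection of `U` onto `U'`. -/
def AreAdEquivalent (H : Subgroup G) (U U' : Submodule ℝ (GroupLieAlgebra 𝓘(ℝ, E) G)) : Prop :=
  ∃ f : GroupLieAlgebra 𝓘(ℝ, E) G →ₗ[ℝ] GroupLieAlgebra 𝓘(ℝ, E) G,
    U.map f = U' ∧ Set.InjOn f U ∧
    ∀ a ∈ H, ∀ X ∈ U, f (adjointRep E a X) = adjointRep E a (f X)

/-- `U` and `U'` contain no equivalent (nonzero) `Ad H`-submodules. -/
def NoCommonAdSubmodule (H : Subgroup G) (U U' : Submodule ℝ (GroupLieAlgebra 𝓘(ℝ, E) G)) :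
    Prop :=
  ∀ S ≤ U, ∀ S' ≤ U', IsAdInvariant H S → IsAdInvariant H S' → S ≠ ⊥ → ¬ AreAdEquivalent H S S'

variable [FiniteDimensional ℝ E] [LieGroup 𝓘(ℝ, E) ∞ G]

/-- The form `B = -Φ`, where `Φ` is the Killing form of the Lie algebra of `G`. -/
def negKilling (X Y : GroupLieAlgebra 𝓘(ℝ, E) G) : ℝ :=
  -killingForm ℝ (GroupLieAlgebra 𝓘(ℝ, E) G) X Y

variable (E) in
/-- `𝔫`: the `B`-orthogonal complement of the Lie algebra of `K`. -/
def horizontalSpace (K : Subgroup G) : Submodule ℝ (GroupLieAlgebra 𝓘(ℝ, E) G) :=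
  (killingForm ℝ (GroupLieAlgebra 𝓘(ℝ, E) G)).orthogonal (lieAlgebraOf E K)

variable (E) in
/-- `𝔭`: the `B`-orthogonal complement of the Lie algebra of `L` in the Lie algebra of `K`. -/
def verticalSpace (K L : Subgroup G) : Submodule ℝ (GroupLieAlgebra 𝓘(ℝ, E) G) :=
  lieAlgebraOf E K ⊓ (killingForm ℝ (GroupLieAlgebra 𝓘(ℝ, E) G)).orthogonal (lieAlgebraOf E L)

instance finiteDimensional_lieAlgebra : FiniteDimensional ℝ (GroupLieAlgebra 𝓘(ℝ, E) G) :=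
  inferInstanceAs (FiniteDimensional ℝ E)

/-- The Casimir operator of a subspace `U` with respect to the Killing form `Φ`, that is,
`∑ i, ad uᵢ ∘ ad uⁱ` for a basis `(uᵢ)` of `U` and its `Φ`-dual basis `uⁱ = ∑ j, (Q⁻¹) i j • uⱼ`,
with `Q` the matrix of `Φ` in `(uᵢ)`. It does not depend on the basis; if `U` has a basis `(eᵢ)`
orthonormal for `B = -Φ`, it is `-∑ i, (ad eᵢ)²`. -/
def casimir (U : Submodule ℝ (GroupLieAlgebra 𝓘(ℝ, E) G)) (X : GroupLieAlgebra 𝓘(ℝ, E) G) :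
    GroupLieAlgebra 𝓘(ℝ, E) G :=
  let u := fun i => (Module.finBasis ℝ U i : GroupLieAlgebra 𝓘(ℝ, E) G)
  let Q := Matrix.of fun i j => killingForm ℝ (GroupLieAlgebra 𝓘(ℝ, E) G) (u i) (u j)
  ∑ i, ∑ j, Q⁻¹ i j • ⁅u i, ⁅u j, X⁆⁆

/-- The Casimir operator of `U` is scalar on `U'`, with eigenvalue `b`. -/
def CasimirIsScalarOn (U U' : Submodule ℝ (GroupLieAlgebra 𝓘(ℝ, E) G)) (b : ℝ) : Prop :=
  ∀ X ∈ U', casimir U X = b • X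

end LieGroups

/-! ### Invariant and adapted metrics on `G ⧸ L` -/

section Fibration

variable {E : Type*} [NormedAddCommGroup E] [NormedSpace ℝ E]
  {G : Type*} [TopologicalSpace G] [ChartedSpace E G] [Group G]
  {L K : Subgroup G}
  {V : Type*} [NormedAddCommGroup V] [NormedSpace ℝ V] [ChartedSpace V (G ⧸ L)]
  [IsManifold 𝓘(ℝ, V) ∞ (G ⧸ L)]
  {W : Type*} [NormedAddCommGroup W] [NormedSpace ℝ W] [ChartedSpace W (G ⧸ K)]
  [IsManifold 𝓘(ℝ, W) ∞ (G ⧸ K)]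

/-- `g` is `G`-invariant. -/
def IsInvariantMetric (g : SmoothMetric V (G ⧸ L)) : Prop :=
  ∀ (a : G) (x : G ⧸ L) (u v : V),
    g.at (a • x) (differential (V := V) (W := V) (fun y : G ⧸ L => a • y) x u)
      (differential (V := V) (W := V) (fun y : G ⧸ L => a • y) x v) = g.at x u v

variable (W) in
/-- `g` is a `G`-invariant adapted metric: the projection `G ⧸ L → G ⧸ K` is a Riemannian
submersion with totally geodesic fibres, for some Riemannian metric on `G ⧸ K`. -/
def IsAdaptedMetric (h : L ≤ K) (g : SmoothMetric V (G ⧸ L)) : Prop :=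
  IsInvariantMetric g ∧
  (∃ g' : SmoothMetric W (G ⧸ K), IsRiemannianSubmersion g g' (Subgroup.quotientMapOfLE h)) ∧
  HasTotallyGeodesicFibers W g (Subgroup.quotientMapOfLE h : G ⧸ L → G ⧸ K)

variable [FiniteDimensional ℝ E] [LieGroup 𝓘(ℝ, E) ∞ G]

variable (E) in
/-- `g` is the `G`-invariant metric defined by the Euclidean product `s B_𝔭 ⊕ t B_𝔫` on
`𝔪 = 𝔭 ⊕ 𝔫`, which is identified with the tangent space of `G ⧸ L` at the base point through the
differential of `G → G ⧸ L` at `1`. -/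
def IsBinormalMetric (K : Subgroup G) (g : SmoothMetric V (G ⧸ L)) (s t : ℝ) : Prop :=
  IsInvariantMetric g ∧
  ∀ X ∈ verticalSpace E K L, ∀ X' ∈ verticalSpace E K L,
  ∀ Y ∈ horizontalSpace E K, ∀ Y' ∈ horizontalSpace E K,
    g.at ((1 : G) : G ⧸ L)
      (differential (V := E) (W := V) (QuotientGroup.mk : G → G ⧸ L) 1 (X + Y))
      (differential (V := E) (W := V) (QuotientGroup.mk : G → G ⧸ L) 1 (X' + Y'))
      = s * negKilling X X' + t * negKilling Y Y'

end Fibration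

end

/-! The adapted metrics form a two-parameter family, and on that family the Einstein equation is a
quadratic equation in one ratio.

An invariant metric on `G ⧸ L` is an `Ad L`-invariant inner product on 𝔪. Since 𝔭 and 𝔫 share no
submodule, 𝔭 and 𝔫 are orthogonal for it (`form_eq_zero`), and by Schur's lemma (`exists_form_eq`)
it is a multiple s B on the irreducible module 𝔭. On 𝔫 it is a priori only `Ad L`-invariant; the
Riemannian submersion to `G ⧸ K` makes it `Ad K`-invariant, hence a multiple t B
(`exists_isBinormalMetric_of_isAdapted`). Conversely every s B_𝔭 ⊕ t B_𝔫 with s, t > 0 defines an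
adapted metric. Its fibres are totally geodesic for the following reason: the fundamental fields of
𝔫, taken for the action conjugated to a point of the fibre, are orthogonal to the whole fibre,
because 𝔫 is `Ad K`-invariant. They are Killing fields, so differentiating their product with the
velocity of a curve in the fibre shows that the acceleration is orthogonal to them
(`hasTotallyGeodesicFibers`).

The curvature is computed with Killing fields. The Koszul formula expresses ∇ on them through
brackets and the metric alone, and differentiating it once more does the same for R
(`metric_curvatureTensor`), so that the whole computation takes place in 𝔤. The traces which occur
are Casimir operators. On 𝔤 one has C_𝔤 = 1. The symmetric pair (𝔤, 𝔨) gives C_𝔨 = C_𝔫 = 1/2 on 𝔫;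
the symmetric pair (𝔨, 𝔩) gives C_𝔩 = C_𝔭 = γ/2 on 𝔭, hence C_𝔫 = 1 - γ there. The result
(`ricci_eq`) is that Ric has no mixed part, equals (γ/2 + (1 - γ)s²/(4t²)) B on 𝔭, and is B/2 minus
s/(2t) times the form of C_𝔭 on 𝔫.

Therefore an Einstein metric forces C_𝔭 to be a scalar b on 𝔫, and eliminating the Einstein constant
leaves 2γX² - 2X + (1 - γ + 2b) = 0 for X = t/s (`isEinstein_iff`). A quarter of its discriminant is
Δ. As γ > 0, the root with the plus sign is positive, so that Δ ≥ 0 is also sufficient for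
existence.

Two facts on the group are needed beforehand. B is positive definite: averaging over the compact
group gives an invariant inner product for which every ad X is skew (`negForm_pos_of_compact`). And
γ > 0: otherwise 𝔨 would centralise 𝔭 and the connected group L would act trivially on it, against
irreducibility in dimension greater than 1 (`exists_casimir_vertical`). -/

noncomputable section

set_option maxSynthPendingDepth 3

open Filter Topology

/-! ### Levi-Civita connection and curvature in a vector space -/

section FlatRiemannian

variable {V : Type*} [NormedAddCommGroup V] [NormedSpace ℝ V]

set_option synthInstance.maxHeartbeats 200000 in
/-- The trilinear form `(D_u h(v, w) + D_v h(u, w) - D_w h(u, v)) / 2` built from the derivative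
`d` of a field of bilinear forms. -/
def koszulMap : (V →L[ℝ] V →L[ℝ] V →L[ℝ] ℝ) →L[ℝ] (V →L[ℝ] V →L[ℝ] V →L[ℝ] ℝ) :=
  (1 / 2 : ℝ) • (ContinuousLinearMap.id ℝ _ +
    ((ContinuousLinearMap.flipₗᵢ ℝ V V (V →L[ℝ] ℝ)).toContinuousLinearEquiv : _ →L[ℝ] _) -
    (ContinuousLinearMap.compL ℝ V (V →L[ℝ] V →L[ℝ] ℝ) (V →L[ℝ] V →L[ℝ] ℝ)
      ((ContinuousLinearMap.flipₗᵢ ℝ V V ℝ).toContinuousLinearEquiv : _ →L[ℝ] _)) ∘L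
      ((ContinuousLinearMap.flipₗᵢ ℝ V V (V →L[ℝ] ℝ)).toContinuousLinearEquiv : _ →L[ℝ] _))

set_option synthInstance.maxHeartbeats 200000 in
lemma koszulMap_apply (d : V →L[ℝ] V →L[ℝ] V →L[ℝ] ℝ) (u v w : V) :
    koszulMap d u v w = (1 / 2 : ℝ) * (d u v w + d v u w - d w u v) :=
  rfl

/-- The Christoffel symbols as a continuous bilinear map. -/
def christoffelMap (h : V → V →L[ℝ] V →L[ℝ] ℝ) (y : V) : V →L[ℝ] V →L[ℝ] V :=
  (ContinuousLinearMap.compL ℝ V (V →L[ℝ] ℝ) V (h y).inverse) ∘L koszulMap (fderiv ℝ h y)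

lemma christoffelMap_apply (h : V → V →L[ℝ] V →L[ℝ] ℝ) (y u v : V) :
    christoffelMap h y u v = christoffel h y u v := by
  simp only [christoffelMap, christoffel, ContinuousLinearMap.coe_comp, Function.comp_apply,
    ContinuousLinearMap.compL_apply]
  congr 1

/-- A positive definite form on a finite-dimensional space is an isomorphism onto the dual. -/
lemma isInvertible_of_pos [FiniteDimensional ℝ V] (b : V →L[ℝ] V →L[ℝ] ℝ)
    (hb : ∀ u, u ≠ 0 → 0 < b u u) : b.IsInvertible := by
  have hinj : Function.Injective (b : V →ₗ[ℝ] (V →L[ℝ] ℝ)) := by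
    rw [← LinearMap.ker_eq_bot, LinearMap.ker_eq_bot']
    intro u hu
    by_contra hne
    have h1 := hb u hne
    have h2 : b u = 0 := hu
    simp [h2] at h1
  have hfd : FiniteDimensional ℝ (V →L[ℝ] ℝ) := inferInstance
  have hdim : Module.finrank ℝ V = Module.finrank ℝ (V →L[ℝ] ℝ) := by
    rw [← (LinearMap.toContinuousLinearMap : (V →ₗ[ℝ] ℝ) ≃ₗ[ℝ] _).finrank_eq]
    exact (Subspace.dual_finrank_eq).symm
  refine ⟨(LinearEquiv.ofInjectiveOfFinrankEq (b : V →ₗ[ℝ] (V →L[ℝ] ℝ)) hinj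
    hdim).toContinuousLinearEquiv, ?_⟩
  ext u v
  rfl

/-- A smooth field of positive definite symmetric bilinear forms near `y`, together with a Lie
algebra of Killing fields `ξ X` near `y`. -/
structure IsKillingAlgebra {𝔤 : Type*} [LieRing 𝔤] [LieAlgebra ℝ 𝔤]
    (h : V → V →L[ℝ] V →L[ℝ] ℝ) (ξ : 𝔤 → V → V) (y : V) : Prop where
  contDiffAt_metric : ContDiffAt ℝ 2 h y
  symm : ∀ᶠ z in 𝓝 y, ∀ u v, h z u v = h z v u
  pos : ∀ u, u ≠ 0 → 0 < h y u u
  contDiffAt_field : ∀ X, ContDiffAt ℝ 2 (ξ X) y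
  bracket : ∀ X Y, ∀ᶠ z in 𝓝 y,
    ξ ⁅X, Y⁆ z = fderiv ℝ (ξ X) z (ξ Y z) - fderiv ℝ (ξ Y) z (ξ X z)
  killing : ∀ X, ∀ᶠ z in 𝓝 y, ∀ u v,
    fderiv ℝ h z (ξ X z) u v + h z (fderiv ℝ (ξ X) z u) v + h z u (fderiv ℝ (ξ X) z v) = 0

variable {h : V → V →L[ℝ] V →L[ℝ] ℝ} {y : V}

lemma metric_christoffelMap (hinv : (h y).IsInvertible) (u v w : V) :
    h y (christoffelMap h y u v) w = koszulMap (fderiv ℝ h y) u v w := by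
  simp only [christoffelMap, ContinuousLinearMap.coe_comp, Function.comp_apply,
    ContinuousLinearMap.compL_apply]
  rw [hinv.self_apply_inverse]

lemma fderiv_metric_symm (hd : DifferentiableAt ℝ h y)
    (hs : ∀ᶠ z in 𝓝 y, ∀ u v, h z u v = h z v u) (a u v : V) :
    fderiv ℝ h y a u v = fderiv ℝ h y a v u := by
  have key : ∀ u v, fderiv ℝ (fun z => h z u v) y a = fderiv ℝ h y a u v := by
    intro u v
    have := ((hd.hasFDerivAt.clm_apply (hasFDerivAt_const u y)).clm_apply
      (hasFDerivAt_const v y)).fderiv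
    rw [this]; simp
  rw [← key, ← key]
  have : (fun z => h z u v) =ᶠ[𝓝 y] fun z => h z v u := hs.mono fun z hz => hz u v
  rw [this.fderiv_eq]

lemma contDiffAt_christoffelMap [FiniteDimensional ℝ V] (hh : ContDiffAt ℝ 2 h y)
    (hinv : (h y).IsInvertible) : ContDiffAt ℝ 1 (christoffelMap h) y := by
  obtain ⟨e, he⟩ := hinv
  have h1 : ContDiffAt ℝ 1 (fun z => (h z).inverse) y := by
    have : ContDiffAt ℝ 1 ContinuousLinearMap.inverse (h y) := by
      rw [← he]; exact contDiffAt_map_inverse e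
    exact this.comp y (hh.of_le (by norm_num))
  have h2 : ContDiffAt ℝ 1 (fderiv ℝ h) y := hh.fderiv_right (by norm_num)
  have h3 : ContDiffAt ℝ 1 (fun z => koszulMap (fderiv ℝ h z)) y :=
    (koszulMap (V := V)).contDiff.contDiffAt.comp y h2
  have h4 : ContDiffAt ℝ 1
      (fun z => ContinuousLinearMap.compL ℝ V (V →L[ℝ] ℝ) V (h z).inverse) y :=
    (ContinuousLinearMap.compL ℝ V (V →L[ℝ] ℝ) V).contDiff.contDiffAt.comp y h1
  exact h4.clm_comp h3

lemma fderiv_christoffel (hG : DifferentiableAt ℝ (christoffelMap h) y) (u v w : V) :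
    fderiv ℝ (fun z => christoffel h z v w) y u = fderiv ℝ (christoffelMap h) y u v w := by
  have : (fun z => christoffel h z v w) = fun z => christoffelMap h z v w := by
    ext z; rw [christoffelMap_apply]
  rw [this, ((hG.hasFDerivAt.clm_apply (hasFDerivAt_const v y)).clm_apply
      (hasFDerivAt_const w y)).fderiv]
  simp

lemma curvatureTensor_eq (hG : DifferentiableAt ℝ (christoffelMap h) y) (u v w : V) :
    curvatureTensor h y u v w =
      fderiv ℝ (christoffelMap h) y u v w - fderiv ℝ (christoffelMap h) y v u w
      + christoffelMap h y u (christoffelMap h y v w)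
      - christoffelMap h y v (christoffelMap h y u w) := by
  simp only [curvatureTensor, fderiv_christoffel hG, christoffelMap_apply]

/-- The covariant derivative `∇_η ζ` of a vector field along another one. -/
def covDeriv (h : V → V →L[ℝ] V →L[ℝ] ℝ) (η ζ : V → V) (z : V) : V :=
  fderiv ℝ ζ z (η z) + christoffelMap h z (η z) (ζ z)

variable {ζ η : V → V}

lemma hasFDerivAt_covDeriv (hG : DifferentiableAt ℝ (christoffelMap h) y)
    (hη : DifferentiableAt ℝ η y) (hζ : ContDiffAt ℝ 2 ζ y) :
    DifferentiableAt ℝ (covDeriv h η ζ) y ∧ ∀ u, fderiv ℝ (covDeriv h η ζ) y u =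
      fderiv ℝ (fderiv ℝ ζ) y u (η y) + fderiv ℝ ζ y (fderiv ℝ η y u)
      + fderiv ℝ (christoffelMap h) y u (η y) (ζ y)
      + christoffelMap h y (fderiv ℝ η y u) (ζ y)
      + christoffelMap h y (η y) (fderiv ℝ ζ y u) := by
  have hd : DifferentiableAt ℝ ζ y := hζ.differentiableAt (by norm_num)
  have hd2 : DifferentiableAt ℝ (fderiv ℝ ζ) y :=
    (hζ.fderiv_right (m := 1) (by norm_num)).differentiableAt (by norm_num)
  have h1 := hd2.hasFDerivAt.clm_apply hη.hasFDerivAt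
  have h2 := (hG.hasFDerivAt.clm_apply hη.hasFDerivAt).clm_apply hd.hasFDerivAt
  have h3 := h1.add h2
  refine ⟨h3.differentiableAt, fun u => ?_⟩
  have h4 : fderiv ℝ (covDeriv h η ζ) y = _ := h3.fderiv
  rw [h4]
  simp
  abel

/-- The Ricci identity: `R(X, Y)ζ = ∇_X ∇_Y ζ - ∇_Y ∇_X ζ - ∇_[X, Y] ζ`. -/
lemma curvatureTensor_eq_covDeriv {X Y : V → V} (hG : DifferentiableAt ℝ (christoffelMap h) y)
    (hX : DifferentiableAt ℝ X y) (hY : DifferentiableAt ℝ Y y) (hζ : ContDiffAt ℝ 2 ζ y) :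
    curvatureTensor h y (X y) (Y y) (ζ y) =
      covDeriv h X (covDeriv h Y ζ) y - covDeriv h Y (covDeriv h X ζ) y
      - covDeriv h (fun z => fderiv ℝ Y z (X z) - fderiv ℝ X z (Y z)) ζ y := by
  -- The second derivatives of ζ in the two iterated covariant derivatives cancel by symmetry.
  have hsymm := hζ.isSymmSndFDerivAt (by simp) (X y) (Y y)
  have e1 := (hasFDerivAt_covDeriv hG hX hζ).2 (Y y)
  have e2 := (hasFDerivAt_covDeriv hG hY hζ).2 (X y)
  rw [curvatureTensor_eq hG]
  rw [covDeriv, covDeriv.eq_1 h Y (covDeriv h X ζ), e1, e2, hsymm]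
  simp only [covDeriv, map_add, map_sub, sub_apply]
  abel

/-- The Levi-Civita connection is metric. -/
lemma fderiv_metric_apply [FiniteDimensional ℝ V] (hh : ContDiffAt ℝ 2 h y)
    (hinv : (h y).IsInvertible)
    (hs : ∀ᶠ z in 𝓝 y, ∀ u v, h z u v = h z v u) {X : V → V}
    (hη : DifferentiableAt ℝ η y) (hζ : DifferentiableAt ℝ ζ y) :
    fderiv ℝ (fun z => h z (η z) (ζ z)) y (X y) =
      h y (covDeriv h X η y) (ζ y) + h y (η y) (covDeriv h X ζ y) := by
  have hd : DifferentiableAt ℝ h y := hh.differentiableAt (by norm_num)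
  have e := ((hd.hasFDerivAt.clm_apply hη.hasFDerivAt).clm_apply hζ.hasFDerivAt).fderiv
  have hsy := hs.self_of_nhds
  rw [e]
  simp only [covDeriv, map_add, add_apply]
  rw [hsy (η y) (christoffelMap h y _ _), metric_christoffelMap hinv, metric_christoffelMap hinv,
    koszulMap_apply, koszulMap_apply]
  have e1 := fderiv_metric_symm hd hs (X y) (ζ y) (η y)
  have e2 := fderiv_metric_symm hd hs (η y) (ζ y) (X y)
  have e3 := fderiv_metric_symm hd hs (ζ y) (η y) (X y)
  simp
  linarith

end FlatRiemannian

/-! ### Connection and curvature on Killing fields -/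

section KillingAlgebra

variable {V : Type*} [NormedAddCommGroup V] [NormedSpace ℝ V] [FiniteDimensional ℝ V]
  {𝔤 : Type*} [LieRing 𝔤] [LieAlgebra ℝ 𝔤]
  {h : V → V →L[ℝ] V →L[ℝ] ℝ} {ξ : 𝔤 → V → V} {y : V}

namespace IsKillingAlgebra

lemma eventually_isInvertible (H : IsKillingAlgebra h ξ y) : ∀ᶠ z in 𝓝 y, (h z).IsInvertible := by
  obtain ⟨e, he⟩ := isInvertible_of_pos (h y) H.pos
  have h1 : ∀ᶠ b in 𝓝 (h y), b.IsInvertible := by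
    rw [← he]
    filter_upwards [e.nhds] with b hb
    exact hb
  exact H.contDiffAt_metric.continuousAt.eventually h1

lemma isInvertible (H : IsKillingAlgebra h ξ y) : (h y).IsInvertible :=
  H.eventually_isInvertible.self_of_nhds

lemma differentiableAt_field (H : IsKillingAlgebra h ξ y) (X : 𝔤) :
    ∀ᶠ z in 𝓝 y, DifferentiableAt ℝ (ξ X) z :=
  ((H.contDiffAt_field X).eventually (by simp)).mono fun z hz => hz.differentiableAt (by norm_num)

lemma differentiableAt_metric (H : IsKillingAlgebra h ξ y) :
    ∀ᶠ z in 𝓝 y, DifferentiableAt ℝ h z :=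
  (H.contDiffAt_metric.eventually (by simp)).mono fun z hz => hz.differentiableAt (by norm_num)

/-- The Koszul formula for Killing fields. -/
lemma metric_covDeriv (H : IsKillingAlgebra h ξ y) (Y Z W : 𝔤) :
    ∀ᶠ z in 𝓝 y, h z (covDeriv h (ξ Y) (ξ Z) z) (ξ W z) =
      -(1 / 2 : ℝ) * (h z (ξ ⁅Y, Z⁆ z) (ξ W z) + h z (ξ ⁅Y, W⁆ z) (ξ Z z)
        + h z (ξ Y z) (ξ ⁅Z, W⁆ z)) := by
  filter_upwards [H.bracket Y Z, H.bracket Y W, H.bracket Z W, H.killing Y, H.killing Z,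
    H.killing W, H.eventually_isInvertible, H.symm.eventually_nhds, H.differentiableAt_metric]
    with z b1 b2 b3 k1 k2 k3 hi hs hd
  have hs' := hs.self_of_nhds
  rw [b1, b2, b3, covDeriv, map_add, add_apply, metric_christoffelMap hi,
    koszulMap_apply]
  -- The Killing equations of the three fields trade each derivative of `h` in the Koszul formula
  -- for derivatives of the fields, which pair up to brackets. As for any left action, ξ sends the
  -- bracket of 𝔤 to minus the bracket of vector fields, hence the overall sign.
  have k1' := k1 (ξ Z z) (ξ W z)
  have k2' := k2 (ξ Y z) (ξ W z)
  have k3' := k3 (ξ Y z) (ξ Z z)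
  simp only [map_sub, sub_apply]
  rw [hs' (ξ Z z)] at k1'
  rw [hs' (fderiv ℝ (ξ W) z (ξ Y z))] at *
  rw [hs' (fderiv ℝ (ξ Y) z (ξ W z)) (ξ Z z)] at *
  linarith

/-- The derivative of the scalar product of two Killing fields along a Killing field. -/
lemma fderiv_metric_field (H : IsKillingAlgebra h ξ y) (X U W : 𝔤) :
    fderiv ℝ (fun z => h z (ξ U z) (ξ W z)) y (ξ X y) =
      -(h y (ξ ⁅X, U⁆ y) (ξ W y) + h y (ξ U y) (ξ ⁅X, W⁆ y)) := by
  have hd := H.differentiableAt_metric.self_of_nhds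
  have hU := (H.differentiableAt_field U).self_of_nhds
  have hW := (H.differentiableAt_field W).self_of_nhds
  rw [((hd.hasFDerivAt.clm_apply hU.hasFDerivAt).clm_apply hW.hasFDerivAt).fderiv,
    (H.bracket X U).self_of_nhds, (H.bracket X W).self_of_nhds]
  have k := (H.killing X).self_of_nhds (ξ U y) (ξ W y)
  simp
  linarith

/-- The curvature of a metric, evaluated on Killing fields. -/
theorem metric_curvatureTensor (H : IsKillingAlgebra h ξ y) (X Y Z W : 𝔤) :
    h y (curvatureTensor h y (ξ X y) (ξ Y y) (ξ Z y)) (ξ W y) =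
      (1 / 2 : ℝ) * (h y (ξ ⁅X, ⁅Y, Z⁆⁆ y) (ξ W y) + h y (ξ ⁅Y, Z⁆ y) (ξ ⁅X, W⁆ y)
        + h y (ξ ⁅X, ⁅Y, W⁆⁆ y) (ξ Z y) + h y (ξ ⁅Y, W⁆ y) (ξ ⁅X, Z⁆ y)
        + h y (ξ ⁅X, Y⁆ y) (ξ ⁅Z, W⁆ y) + h y (ξ Y y) (ξ ⁅X, ⁅Z, W⁆⁆ y))
      - (1 / 2 : ℝ) * (h y (ξ ⁅Y, ⁅X, Z⁆⁆ y) (ξ W y) + h y (ξ ⁅X, Z⁆ y) (ξ ⁅Y, W⁆ y)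
        + h y (ξ ⁅Y, ⁅X, W⁆⁆ y) (ξ Z y) + h y (ξ ⁅X, W⁆ y) (ξ ⁅Y, Z⁆ y)
        + h y (ξ ⁅Y, X⁆ y) (ξ ⁅Z, W⁆ y) + h y (ξ X y) (ξ ⁅Y, ⁅Z, W⁆⁆ y))
      - h y (covDeriv h (ξ Y) (ξ Z) y) (covDeriv h (ξ X) (ξ W) y)
      + h y (covDeriv h (ξ X) (ξ Z) y) (covDeriv h (ξ Y) (ξ W) y)
      - (1 / 2 : ℝ) * (h y (ξ ⁅⁅X, Y⁆, Z⁆ y) (ξ W y) + h y (ξ ⁅⁅X, Y⁆, W⁆ y) (ξ Z y)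
        + h y (ξ ⁅X, Y⁆ y) (ξ ⁅Z, W⁆ y)) := by
  have hG : DifferentiableAt ℝ (christoffelMap h) y :=
    (contDiffAt_christoffelMap H.contDiffAt_metric H.isInvertible).differentiableAt (by norm_num)
  have hdf := fun U => (H.differentiableAt_field U).self_of_nhds
  have hd := H.differentiableAt_metric.self_of_nhds
  have hdiff : ∀ U U', DifferentiableAt ℝ (fun z => h z (ξ U z) (ξ U' z)) y := fun U U' =>
    (hd.clm_apply (hdf U)).clm_apply (hdf U')
  -- The connection is metric: h(∇_X ∇_Y Z, W) = X·h(∇_Y Z, W) - h(∇_Y Z, ∇_X W). The Koszul formula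
  -- holds in a whole neighbourhood, so the first term may be differentiated, and by
  -- `fderiv_metric_field` this produces only iterated brackets.
  have deriv_cov : ∀ X Y, h y (covDeriv h (ξ X) (covDeriv h (ξ Y) (ξ Z)) y) (ξ W y) =
      (1 / 2 : ℝ) * (h y (ξ ⁅X, ⁅Y, Z⁆⁆ y) (ξ W y) + h y (ξ ⁅Y, Z⁆ y) (ξ ⁅X, W⁆ y)
        + h y (ξ ⁅X, ⁅Y, W⁆⁆ y) (ξ Z y) + h y (ξ ⁅Y, W⁆ y) (ξ ⁅X, Z⁆ y)
        + h y (ξ ⁅X, Y⁆ y) (ξ ⁅Z, W⁆ y) + h y (ξ Y y) (ξ ⁅X, ⁅Z, W⁆⁆ y))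
      - h y (covDeriv h (ξ Y) (ξ Z) y) (covDeriv h (ξ X) (ξ W) y) := by
    intro X Y
    have m := fderiv_metric_apply H.contDiffAt_metric H.isInvertible H.symm (X := ξ X)
      (hasFDerivAt_covDeriv hG (hdf Y) (H.contDiffAt_field Z)).1 (hdf W)
    have e : (fun z => h z (covDeriv h (ξ Y) (ξ Z) z) (ξ W z)) =ᶠ[𝓝 y] _ :=
      H.metric_covDeriv Y Z W
    rw [e.fderiv_eq, (((((hdiff _ _).hasFDerivAt.fun_add (hdiff _ _).hasFDerivAt).fun_add
      (hdiff _ _).hasFDerivAt)).const_mul _).fderiv] at m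
    simp only [smul_apply, add_apply, smul_eq_mul,
      H.fderiv_metric_field] at m
    linarith
  rw [curvatureTensor_eq_covDeriv hG (hdf X) (hdf Y) (H.contDiffAt_field Z)]
  -- The vector field bracket in the Ricci identity is the field of `⁅X, Y⁆` with the opposite sign.
  have e3 : covDeriv h (fun z => fderiv ℝ (ξ Y) z (ξ X z) - fderiv ℝ (ξ X) z (ξ Y z)) (ξ Z) y =
      - covDeriv h (ξ ⁅X, Y⁆) (ξ Z) y := by
    simp only [covDeriv]
    rw [(H.bracket X Y).self_of_nhds, ← neg_sub (fderiv ℝ (ξ X) y (ξ Y y))]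
    simp only [map_neg, neg_apply, neg_add]
  rw [e3]
  have e4 := (H.metric_covDeriv ⁅X, Y⁆ Z W).self_of_nhds
  simp only [map_sub, map_neg, sub_apply, neg_apply]
  rw [deriv_cov X Y, deriv_cov Y X, e4]
  ring

/-- Along a curve with velocity `c'` and acceleration `c''`, the scalar product of the velocity
with a Killing field changes by the scalar product with the covariant acceleration. -/
lemma hasDerivAt_metric_velocity (H : IsKillingAlgebra h ξ y) {c : ℝ → V} {t : ℝ} (hc : c t = y)
    (hd1 : DifferentiableAt ℝ c t) (hd2 : DifferentiableAt ℝ (deriv c) t) (Z : 𝔤) :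
    HasDerivAt (fun s => h (c s) (deriv c s) (ξ Z (c s)))
      (h y (deriv (deriv c) t + christoffel h y (deriv c t) (deriv c t)) (ξ Z y)) t := by
  subst hc
  have hd := H.differentiableAt_metric.self_of_nhds
  have hZ := (H.differentiableAt_field Z).self_of_nhds
  have hh := hd.hasFDerivAt.comp_hasDerivAt t hd1.hasDerivAt
  have hz := hZ.hasFDerivAt.comp_hasDerivAt t hd1.hasDerivAt
  have e := (hh.clm_apply hd2.hasDerivAt).clm_apply hz
  refine e.congr_deriv ?_
  -- ∇ξ is skew for a Killing field ξ, so the product of the velocity with the derivative of ξ along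
  -- it vanishes; only the acceleration term survives.
  have k := (H.killing Z).self_of_nhds (deriv c t) (deriv c t)
  have hs := H.symm.self_of_nhds
  rw [← christoffelMap_apply, map_add, add_apply, add_apply,
    metric_christoffelMap H.isInvertible, koszulMap_apply]
  rw [hs (fderiv ℝ (ξ Z) (c t) (deriv c t))] at k
  simp
  linarith

end IsKillingAlgebra

end KillingAlgebra

/-! ### Traces, orthonormal bases and eigenvectors for a definite form -/

section LinearAlgebra

/-- The duality relations make `w` independent, so that the functionals `d` are its coordinates.
Functionals are used because the frames below come with duals given by a form. -/
lemma trace_eq_sum_dual {V ι : Type*} [AddCommGroup V] [Module ℝ V] [Fintype ι] [DecidableEq ι]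
    (w : ι → V) (d : ι → V →ₗ[ℝ] ℝ) (hd : ∀ a c, d a (w c) = if a = c then 1 else 0)
    (hspan : ∀ v, v ∈ Submodule.span ℝ (Set.range w)) (T : V →ₗ[ℝ] V) :
    LinearMap.trace ℝ V T = ∑ a, d a (T (w a)) := by
  have hli : LinearIndependent ℝ w := by
    rw [Fintype.linearIndependent_iff]
    intro g hg i
    have := congrArg (d i) hg
    simpa [hd] using this
  let b := Module.Basis.mk hli fun v _ => hspan v
  have hb : ∀ i, b i = w i := fun i => Module.Basis.mk_apply _ _ i
  have hrepr : ∀ i v, b.repr v i = d i v := by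
    intro i v
    conv_rhs => rw [← b.sum_repr v]
    simp [hb, hd]
  rw [LinearMap.trace_eq_matrix_trace ℝ b]
  simp [Matrix.trace, LinearMap.toMatrix_apply, hrepr, hb]

lemma exists_orthonormal_basis_of_pos {W : Type*} [AddCommGroup W] [Module ℝ W]
    [FiniteDimensional ℝ W] (B : LinearMap.BilinForm ℝ W) (hs : ∀ x y, B x y = B y x)
    (hp : ∀ x, x ≠ 0 → 0 < B x x) :
    ∃ b : Module.Basis (Fin (Module.finrank ℝ W)) ℝ W,
      ∀ i j, B (b i) (b j) = if i = j then 1 else 0 := by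
  let core : InnerProductSpace.Core ℝ W :=
    { inner := fun x y => B x y
      conj_inner_symm := fun x y => by simp [hs x y]
      re_inner_nonneg := fun x => by
        by_cases hx : x = 0
        · simp [hx]
        · simpa using (hp x hx).le
      add_left := fun x y z => by simp
      smul_left := fun x y r => by simp
      definite := fun x hx => by
        by_contra hne
        exact (hp x hne).ne' hx }
  let _ := core.toNormedAddCommGroup
  let _ := InnerProductSpace.ofCore core.toCore
  refine ⟨(stdOrthonormalBasis ℝ W).toBasis, fun i j => ?_⟩
  rw [OrthonormalBasis.coe_toBasis]
  exact (orthonormal_iff_ite.mp (stdOrthonormalBasis ℝ W).orthonormal) i j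

/-- With `B` as inner product, `T` is a symmetric operator and has a real eigenvalue. This is what
makes Schur's lemma work over ℝ for symmetric forms. -/
lemma exists_eigenvector_of_pos {W : Type*} [AddCommGroup W] [Module ℝ W]
    [FiniteDimensional ℝ W] [Nontrivial W] (B : LinearMap.BilinForm ℝ W)
    (hs : ∀ x y, B x y = B y x) (hp : ∀ x, x ≠ 0 → 0 < B x x) (T : W →ₗ[ℝ] W)
    (hT : ∀ x y, B (T x) y = B x (T y)) :
    ∃ (c : ℝ) (x : W), x ≠ 0 ∧ T x = c • x := by
  let core : InnerProductSpace.Core ℝ W :=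
    { inner := fun x y => B x y
      conj_inner_symm := fun x y => by simp [hs x y]
      re_inner_nonneg := fun x => by
        by_cases hx : x = 0
        · simp [hx]
        · simpa using (hp x hx).le
      add_left := fun x y z => by simp
      smul_left := fun x y r => by simp
      definite := fun x hx => by
        by_contra hne
        exact (hp x hne).ne' hx }
  let _ := core.toNormedAddCommGroup
  let _ := InnerProductSpace.ofCore core.toCore
  have hsym : T.IsSymmetric := fun x y => hT x y
  obtain ⟨x, hx⟩ := hsym.hasEigenvalue_iSup_of_finiteDimensional.exists_hasEigenvector
  exact ⟨_, x, hx.2, hx.apply_eq_smul⟩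

end LinearAlgebra

/-! ### Orthonormal frames and Casimir forms -/

section KillingForm

variable {𝔤 : Type*} [LieRing 𝔤] [LieAlgebra ℝ 𝔤]

variable (𝔤) in
/-- The form `B = -Φ`. -/
def negForm : LinearMap.BilinForm ℝ 𝔤 := -killingForm ℝ 𝔤

lemma negForm_symm (X Y : 𝔤) : negForm 𝔤 X Y = negForm 𝔤 Y X := by
  simp only [negForm, LinearMap.neg_apply]
  rw [LieModule.traceForm_comm]

lemma negForm_lie (X Y Z : 𝔤) : negForm 𝔤 ⁅X, Y⁆ Z = negForm 𝔤 X ⁅Y, Z⁆ := by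
  simp only [negForm, LinearMap.neg_apply]
  rw [LieModule.traceForm_apply_lie_apply]

lemma negForm_lie_right (X Y Z : 𝔤) : negForm 𝔤 Y ⁅X, Z⁆ = -negForm 𝔤 ⁅X, Y⁆ Z := by
  rw [← negForm_lie, ← lie_skew, map_neg, LinearMap.neg_apply]

/-- `e` is a `B`-orthonormal basis of `U`. -/
structure IsFrame {ι : Type*} [Fintype ι] [DecidableEq ι] (U : Submodule ℝ 𝔤) (e : ι → 𝔤) :
    Prop where
  mem : ∀ i, e i ∈ U
  orthonormal : ∀ i j, negForm 𝔤 (e i) (e j) = if i = j then 1 else 0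
  expand : ∀ X ∈ U, X = ∑ i, negForm 𝔤 X (e i) • e i

lemma exists_isFrame [FiniteDimensional ℝ 𝔤] (hpos : ∀ X : 𝔤, X ≠ 0 → 0 < negForm 𝔤 X X)
    (U : Submodule ℝ 𝔤) :
    ∃ e : Fin (Module.finrank ℝ U) → 𝔤, IsFrame U e := by
  obtain ⟨b, hb⟩ := exists_orthonormal_basis_of_pos (W := U)
    ((negForm 𝔤).compl₁₂ U.subtype U.subtype) (fun x y => negForm_symm _ _)
    (fun x hx => hpos _ (by simpa using hx))
  refine ⟨fun i => b i, fun i => (b i).2, hb, fun X hX => ?_⟩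
  have h1 : ∀ i, negForm 𝔤 X (b i) = b.repr ⟨X, hX⟩ i := by
    intro i
    have h2 : X = ∑ j, b.repr ⟨X, hX⟩ j • (b j : 𝔤) := by
      have := congrArg U.subtype (b.sum_repr ⟨X, hX⟩)
      rw [map_sum] at this
      exact this.symm
    conv_lhs => rw [h2]
    have h3 : ∀ j, negForm 𝔤 (b j) (b i) = if j = i then 1 else 0 := fun j => hb j i
    simp [h3]
  simp only [h1]
  have := congrArg U.subtype (b.sum_repr ⟨X, hX⟩)
  rw [map_sum] at this
  exact this.symm

section

variable {ι : Type*} [Fintype ι] [DecidableEq ι] {U : Submodule ℝ 𝔤} {e : ι → 𝔤}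

lemma IsFrame.parseval (he : IsFrame U e) {X : 𝔤} (hX : X ∈ U) (Y : 𝔤) :
    negForm 𝔤 X Y = ∑ i, negForm 𝔤 X (e i) * negForm 𝔤 Y (e i) := by
  conv_lhs => rw [he.expand X hX]
  simp [negForm_symm Y]

/-- The form `B(C_U Y, Z)`. -/
def casimirForm (e : ι → 𝔤) (Y Z : 𝔤) : ℝ := ∑ i, negForm 𝔤 ⁅e i, Y⁆ ⁅e i, Z⁆

/-- Expand `⁅e i, Y⁆` in the frame `f` and use ad-invariance in the form B(⁅e i, Y⁆, f j) = -B(⁅f j,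
Y⁆, e i): the sum over one frame becomes a sum over the other. -/
lemma IsFrame.casimirForm_comm {κ : Type*} [Fintype κ] [DecidableEq κ] {U' : Submodule ℝ 𝔤}
    {f : κ → 𝔤} (he : IsFrame U e) (hf : IsFrame U' f) {Y Z : 𝔤}
    (h1 : ∀ X ∈ U, ⁅X, Y⁆ ∈ U') :
    casimirForm e Y Z = ∑ j, ∑ i, negForm 𝔤 ⁅f j, Y⁆ (e i) * negForm 𝔤 ⁅f j, Z⁆ (e i) := by
  rw [casimirForm, Finset.sum_comm]
  refine Finset.sum_congr rfl fun i _ => ?_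
  rw [hf.parseval (h1 _ (he.mem i))]
  refine Finset.sum_congr rfl fun j _ => ?_
  have : ∀ Y, negForm 𝔤 ⁅e i, Y⁆ (f j) = - negForm 𝔤 ⁅f j, Y⁆ (e i) := by
    intro Y
    rw [negForm_lie, ← lie_skew, map_neg, negForm_symm]
  rw [this, this]; ring

/-- When ad Y exchanges two subspaces, the double sum of `casimirForm_comm` can be read with either
frame outside. This is how a symmetric pair splits a Casimir operator into equal halves. -/
lemma IsFrame.casimirForm_eq {κ : Type*} [Fintype κ] [DecidableEq κ] {U' : Submodule ℝ 𝔤}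
    {f : κ → 𝔤} (he : IsFrame U e) (hf : IsFrame U' f) {Y Z : 𝔤}
    (h1 : ∀ X ∈ U, ⁅X, Y⁆ ∈ U') (h2 : ∀ X ∈ U', ⁅X, Y⁆ ∈ U) :
    casimirForm e Y Z = casimirForm f Y Z := by
  rw [he.casimirForm_comm hf h1, casimirForm]
  refine Finset.sum_congr rfl fun j _ => ?_
  rw [he.parseval (h2 _ (hf.mem j))]

lemma IsFrame.sum {κ : Type*} [Fintype κ] [DecidableEq κ] {U' : Submodule ℝ 𝔤}
    {f : κ → 𝔤} (he : IsFrame U e) (hf : IsFrame U' f)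
    (hUU' : ∀ X ∈ U, ∀ Y ∈ U', negForm 𝔤 X Y = 0) : IsFrame (U ⊔ U') (Sum.elim e f) := by
  refine ⟨?_, ?_, ?_⟩
  · rintro (i | j)
    · exact Submodule.mem_sup_left (he.mem i)
    · exact Submodule.mem_sup_right (hf.mem j)
  · rintro (i | i) (j | j)
    · simpa using he.orthonormal i j
    · simpa using hUU' _ (he.mem i) _ (hf.mem j)
    · simpa [negForm_symm (f i)] using hUU' _ (he.mem j) _ (hf.mem i)
    · simpa using hf.orthonormal i j
  · intro X hX
    obtain ⟨a, ha, b, hb, rfl⟩ := Submodule.mem_sup.mp hX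
    have h1 : ∀ i, negForm 𝔤 b (e i) = 0 := fun i => by
      rw [negForm_symm]; exact hUU' _ (he.mem i) _ hb
    have h2 : ∀ i, negForm 𝔤 a (f i) = 0 := fun i => hUU' _ ha _ (hf.mem i)
    simp [h1, h2, ← he.expand a ha, ← hf.expand b hb]

/-- The trace of ad Y ad Z which defines the Killing form, taken in an orthonormal frame, is the
Casimir sum after ad-invariance moves one factor across. -/
lemma casimirForm_top [FiniteDimensional ℝ 𝔤] (he : IsFrame ⊤ e) (Y Z : 𝔤) :
    casimirForm e Y Z = negForm 𝔤 Y Z := by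
  have h1 := trace_eq_sum_dual e (fun i => (negForm 𝔤).flip (e i))
    (fun a c => by simp [he.orthonormal, eq_comm]) (fun v => by
      rw [he.expand v trivial]
      exact Submodule.sum_mem _ fun i _ => Submodule.smul_mem _ _
        (Submodule.subset_span (Set.mem_range_self i)))
    (LieAlgebra.ad ℝ 𝔤 Y ∘ₗ LieAlgebra.ad ℝ 𝔤 Z)
  simp only [negForm, LinearMap.neg_apply]
  rw [killingForm, LieModule.traceForm_apply_apply]
  erw [h1]
  rw [casimirForm, ← Finset.sum_neg_distrib]
  refine Finset.sum_congr rfl fun i _ => ?_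
  have h2 : negForm 𝔤 ⁅Y, ⁅Z, e i⁆⁆ (e i) = -negForm 𝔤 ⁅e i, Y⁆ ⁅e i, Z⁆ := by
    rw [← neg_eq_iff_eq_neg, ← negForm_lie_right, negForm_symm, ← lie_skew Y, ← lie_skew Z]
    simp only [map_neg, LinearMap.neg_apply, neg_neg]
  exact (neg_eq_iff_eq_neg.mpr h2).symm

end

end KillingForm

/-! ### Casimir scalars of the two symmetric pairs -/

section Splitting

variable {𝔤 : Type*} [LieRing 𝔤] [LieAlgebra ℝ 𝔤]

/-- The infinitesimal data of the fibration `G ⧸ L → G ⧸ K` with symmetric base and fibre: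
`𝔤 = 𝔩 ⊕ 𝔭 ⊕ 𝔫` with `𝔨 = 𝔩 ⊕ 𝔭`. -/
structure IsSymmetricSplitting (l p n : Submodule ℝ 𝔤) : Prop where
  pos : ∀ X : 𝔤, X ≠ 0 → 0 < negForm 𝔤 X X
  orth_lp : ∀ X ∈ l, ∀ Y ∈ p, negForm 𝔤 X Y = 0
  orth_ln : ∀ X ∈ l, ∀ Y ∈ n, negForm 𝔤 X Y = 0
  orth_pn : ∀ X ∈ p, ∀ Y ∈ n, negForm 𝔤 X Y = 0
  sup : l ⊔ p ⊔ n = ⊤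
  lie_lp : ∀ X ∈ l, ∀ Y ∈ p, ⁅X, Y⁆ ∈ p
  lie_ln : ∀ X ∈ l, ∀ Y ∈ n, ⁅X, Y⁆ ∈ n
  lie_pp : ∀ X ∈ p, ∀ Y ∈ p, ⁅X, Y⁆ ∈ l
  lie_pn : ∀ X ∈ p, ∀ Y ∈ n, ⁅X, Y⁆ ∈ n
  lie_nn : ∀ X ∈ n, ∀ Y ∈ n, ⁅X, Y⁆ ∈ l ⊔ p

namespace IsSymmetricSplitting

variable {l p n : Submodule ℝ 𝔤}

lemma lie_pl (S : IsSymmetricSplitting l p n) {X Y : 𝔤} (hX : X ∈ p) (hY : Y ∈ l) : ⁅X, Y⁆ ∈ p := by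
  rw [← lie_skew]; exact neg_mem (S.lie_lp _ hY _ hX)

lemma lie_np (S : IsSymmetricSplitting l p n) {X Y : 𝔤} (hX : X ∈ n) (hY : Y ∈ p) : ⁅X, Y⁆ ∈ n := by
  rw [← lie_skew]; exact neg_mem (S.lie_pn _ hY _ hX)

lemma lie_kn (S : IsSymmetricSplitting l p n) {X Y : 𝔤} (hX : X ∈ l ⊔ p) (hY : Y ∈ n) :
    ⁅X, Y⁆ ∈ n := by
  obtain ⟨a, ha, b, hb, rfl⟩ := Submodule.mem_sup.mp hX
  rw [add_lie]
  exact add_mem (S.lie_ln _ ha _ hY) (S.lie_pn _ hb _ hY)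

lemma orth_kn (S : IsSymmetricSplitting l p n) {X Y : 𝔤} (hX : X ∈ l ⊔ p) (hY : Y ∈ n) :
    negForm 𝔤 X Y = 0 := by
  obtain ⟨a, ha, b, hb, rfl⟩ := Submodule.mem_sup.mp hX
  simp [S.orth_ln _ ha _ hY, S.orth_pn _ hb _ hY]

lemma orth_nk (S : IsSymmetricSplitting l p n) {X Y : 𝔤} (hX : X ∈ n) (hY : Y ∈ l ⊔ p) :
    negForm 𝔤 X Y = 0 := by
  rw [negForm_symm]; exact S.orth_kn hY hX

variable {ι κ μ : Type*} [Fintype ι] [DecidableEq ι] [Fintype κ] [DecidableEq κ] [Fintype μ]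
  [DecidableEq μ] {el : μ → 𝔤} {ep : ι → 𝔤} {en : κ → 𝔤}

lemma casimirForm_add [FiniteDimensional ℝ 𝔤] (S : IsSymmetricSplitting l p n)
    (hl : IsFrame l el) (hp : IsFrame p ep) (hn : IsFrame n en) (Y Z : 𝔤) :
    casimirForm el Y Z + casimirForm ep Y Z + casimirForm en Y Z = negForm 𝔤 Y Z := by
  have h := (hl.sum hp S.orth_lp).sum hn (fun X hX Y hY => S.orth_kn hX hY)
  rw [S.sup] at h
  rw [← casimirForm_top h]
  simp [casimirForm]

/-- For Y in 𝔫, ad Y exchanges 𝔨 and 𝔫, so that C_𝔨 and C_𝔫 agree at Y; they add up to C_𝔤 = 1. -/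
lemma casimirForm_n [FiniteDimensional ℝ 𝔤] (S : IsSymmetricSplitting l p n)
    (hl : IsFrame l el) (hp : IsFrame p ep) (hn : IsFrame n en) {Y : 𝔤} (hY : Y ∈ n) (Z : 𝔤) :
    casimirForm en Y Z = (1 / 2 : ℝ) * negForm 𝔤 Y Z := by
  have h1 := S.casimirForm_add hl hp hn Y Z
  have h2 := (hl.sum hp S.orth_lp).casimirForm_eq hn (Y := Y) (Z := Z)
    (fun X hX => S.lie_kn hX hY) (fun X hX => S.lie_nn _ hX _ hY)
  have h3 : casimirForm (Sum.elim el ep) Y Z = casimirForm el Y Z + casimirForm ep Y Z := by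
    simp [casimirForm]
  linarith

/-- The scalar `γ` by which the Casimir operator of `𝔨` acts on `𝔭`. -/
lemma casimirForm_p [FiniteDimensional ℝ 𝔤] (S : IsSymmetricSplitting l p n)
    (hl : IsFrame l el) (hp : IsFrame p ep) (hn : IsFrame n en) {γ : ℝ}
    (hγ : ∀ Y ∈ p, ∀ Z ∈ p, casimirForm (Sum.elim el ep) Y Z = γ * negForm 𝔤 Y Z)
    {Y Z : 𝔤} (hY : Y ∈ p) (hZ : Z ∈ p) :
    casimirForm ep Y Z = γ / 2 * negForm 𝔤 Y Z ∧
      casimirForm en Y Z = (1 - γ) * negForm 𝔤 Y Z := by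
  have h1 := S.casimirForm_add hl hp hn Y Z
  -- For Y in 𝔭, ad Y exchanges 𝔩 and 𝔭, so that C_𝔩 and C_𝔭 agree at Y and share γ equally. What is
  -- missing from C_𝔤 = 1 is C_𝔫.
  have h2 := hl.casimirForm_eq hp (Y := Y) (Z := Z)
    (fun X hX => S.lie_lp _ hX _ hY) (fun X hX => S.lie_pp _ hX _ hY)
  have h3 : casimirForm (Sum.elim el ep) Y Z = casimirForm el Y Z + casimirForm ep Y Z := by
    simp [casimirForm]
  have h4 := hγ Y hY Z hZ
  constructor <;> linarith

end IsSymmetricSplitting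

end Splitting

/-! ### Ricci curvature of the metrics s B on 𝔭 plus t B on 𝔫 -/

section Ricci

variable {V : Type*} [NormedAddCommGroup V] [NormedSpace ℝ V] [FiniteDimensional ℝ V]
  {𝔤 : Type*} [LieRing 𝔤] [LieAlgebra ℝ 𝔤]
  {h : V → V →L[ℝ] V →L[ℝ] ℝ} {ξ : 𝔤 → V → V} {y : V}

/-- The linear map `u ↦ R(u, v)w`. -/
def curvatureMap (hG : DifferentiableAt ℝ (christoffelMap h) y) (v w : V) : V →ₗ[ℝ] V where
  toFun u := curvatureTensor h y u v w
  map_add' a b := by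
    simp only [curvatureTensor_eq hG, map_add, add_apply]
    abel
  map_smul' c a := by
    simp only [curvatureTensor_eq hG, map_smul, smul_apply, RingHom.id_apply]
    module

lemma sum_repr_curvatureTensor (hG : DifferentiableAt ℝ (christoffelMap h) y) (v w : V) :
    ∑ i, (Module.finBasis ℝ V).repr (curvatureTensor h y (Module.finBasis ℝ V i) v w) i =
      LinearMap.trace ℝ V (curvatureMap hG v w) := by
  rw [LinearMap.trace_eq_matrix_trace ℝ (Module.finBasis ℝ V)]
  simp [Matrix.trace, LinearMap.toMatrix_apply, curvatureMap]

/-- A Killing algebra in which the metric at `y` is given by `s B_𝔭 ⊕ t B_𝔫`. -/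
structure IsBinormalKillingAlgebra (h : V → V →L[ℝ] V →L[ℝ] ℝ) (ξ : 𝔤 → V → V) (y : V)
    (l p n : Submodule ℝ 𝔤) (s t : ℝ) : Prop where
  killing : IsKillingAlgebra h ξ y
  map_add : ∀ X Y, ξ (X + Y) y = ξ X y + ξ Y y
  map_smul : ∀ (c : ℝ) X, ξ (c • X) y = c • ξ X y
  surj : ∀ v, ∃ X, ξ X y = v
  metric_l : ∀ U, ∀ X ∈ l, h y (ξ U y) (ξ X y) = 0
  metric_p : ∀ U, ∀ X ∈ p, h y (ξ U y) (ξ X y) = s * negForm 𝔤 U X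
  metric_n : ∀ U, ∀ X ∈ n, h y (ξ U y) (ξ X y) = t * negForm 𝔤 U X

namespace IsBinormalKillingAlgebra

variable {l p n : Submodule ℝ 𝔤} {s t : ℝ}

lemma symm (H : IsBinormalKillingAlgebra h ξ y l p n s t) (U X : 𝔤) :
    h y (ξ U y) (ξ X y) = h y (ξ X y) (ξ U y) := H.killing.symm.self_of_nhds _ _

lemma metric_l' (H : IsBinormalKillingAlgebra h ξ y l p n s t) (U X : 𝔤) (hX : X ∈ l) :
    h y (ξ X y) (ξ U y) = 0 := by rw [H.symm, H.metric_l _ _ hX]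

lemma metric_p' (H : IsBinormalKillingAlgebra h ξ y l p n s t) (U X : 𝔤) (hX : X ∈ p) :
    h y (ξ X y) (ξ U y) = s * negForm 𝔤 X U := by
  rw [H.symm, H.metric_p _ _ hX, negForm_symm]

lemma metric_n' (H : IsBinormalKillingAlgebra h ξ y l p n s t) (U X : 𝔤) (hX : X ∈ n) :
    h y (ξ X y) (ξ U y) = t * negForm 𝔤 X U := by
  rw [H.symm, H.metric_n _ _ hX, negForm_symm]

/-- Identification of `∇_X Z` from its Koszul formula. -/
lemma covDeriv_eq (H : IsBinormalKillingAlgebra h ξ y l p n s t) (X Z N : 𝔤) (c : ℝ)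
    (hN : ∀ W, -(1 / 2 : ℝ) * (h y (ξ ⁅X, Z⁆ y) (ξ W y) + h y (ξ ⁅X, W⁆ y) (ξ Z y)
        + h y (ξ X y) (ξ ⁅Z, W⁆ y)) = c * h y (ξ N y) (ξ W y)) :
    covDeriv h (ξ X) (ξ Z) y = c • ξ N y := by
  have key : ∀ W, h y (covDeriv h (ξ X) (ξ Z) y - c • ξ N y) (ξ W y) = 0 := by
    intro W
    have := (H.killing.metric_covDeriv X Z W).self_of_nhds
    rw [map_sub, sub_apply, this, hN, _root_.map_smul]
    simp
  by_contra hne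
  have h1 := H.killing.pos _ (sub_ne_zero.mpr hne)
  obtain ⟨W, hW⟩ := H.surj (covDeriv h (ξ X) (ξ Z) y - c • ξ N y)
  have h2 := key W
  rw [hW] at h2
  exact h1.ne' h2

variable (H : IsBinormalKillingAlgebra h ξ y l p n s t) (S : IsSymmetricSplitting l p n)
include H S

/-- This and the next three lemmas share one computation. If the metric is r B against X and q B
against Z, ad-invariance turns the last two Koszul terms into (r - q) B(⁅X, Z⁆, W), to be added to
h(⁅X, Z⁆, W). For X, Z in 𝔭 both vanish, as ⁅X, Z⁆ lies in 𝔩. In the mixed cases ⁅X, Z⁆ lies in 𝔫,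
and the sum is s or 2t - s times B; on 𝔫 only the bracket term is left. -/
lemma covDeriv_pp {X Z : 𝔤} (hX : X ∈ p) (hZ : Z ∈ p) : covDeriv h (ξ X) (ξ Z) y = 0 := by
  have := H.covDeriv_eq X Z 0 0 fun W => by
    rw [H.metric_l' _ _ (S.lie_pp _ hX _ hZ), H.metric_p _ _ hZ, H.metric_p' _ _ hX,
      negForm_symm _ Z, negForm_lie_right X Z W, ← negForm_lie X Z W, ← lie_skew X Z]
    simp only [map_neg, LinearMap.neg_apply]
    ring
  simpa using this

lemma covDeriv_pn (ht : t ≠ 0) {X Z : 𝔤} (hX : X ∈ p) (hZ : Z ∈ n) :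
    covDeriv h (ξ X) (ξ Z) y = (-(s / (2 * t))) • ξ ⁅X, Z⁆ y := by
  refine H.covDeriv_eq X Z ⁅X, Z⁆ _ fun W => ?_
  rw [H.metric_n' _ _ (S.lie_pn _ hX _ hZ), H.metric_n _ _ hZ, H.metric_p' _ _ hX,
    negForm_symm _ Z, negForm_lie_right X Z W, ← negForm_lie X Z W, ← lie_skew X Z]
  simp only [map_neg, LinearMap.neg_apply]
  field_simp
  ring

lemma covDeriv_np (ht : t ≠ 0) {X Z : 𝔤} (hX : X ∈ n) (hZ : Z ∈ p) :
    covDeriv h (ξ X) (ξ Z) y = (-((2 * t - s) / (2 * t))) • ξ ⁅X, Z⁆ y := by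
  refine H.covDeriv_eq X Z ⁅X, Z⁆ _ fun W => ?_
  rw [H.metric_n' _ _ (S.lie_np hX hZ), H.metric_p _ _ hZ, H.metric_n' _ _ hX,
    negForm_symm _ Z, negForm_lie_right X Z W, ← negForm_lie X Z W, ← lie_skew X Z]
  simp only [map_neg, LinearMap.neg_apply]
  field_simp
  ring

lemma covDeriv_nn {X Z : 𝔤} (hX : X ∈ n) (hZ : Z ∈ n) :
    covDeriv h (ξ X) (ξ Z) y = (-(1 / 2 : ℝ)) • ξ ⁅X, Z⁆ y := by
  refine H.covDeriv_eq X Z ⁅X, Z⁆ _ fun W => ?_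
  rw [H.metric_n _ _ hZ, H.metric_n' _ _ hX,
    negForm_symm _ Z, negForm_lie_right X Z W, ← negForm_lie X Z W, ← lie_skew X Z]
  simp only [map_neg, LinearMap.neg_apply]
  ring

omit S in
-- Ricci is a sum of such terms over frame vectors X in 𝔭 or 𝔫. For these ∇_X X = 0, and the metric
-- against X and Y is a multiple of B, so that ad-invariance reduces every iterated bracket to the
-- pair `⁅X, Y⁆`, `⁅X, Z⁆`.
lemma metric_curvatureTensor_diag {X Y : 𝔤} (Z : 𝔤) {r q : ℝ}
    (hXX : covDeriv h (ξ X) (ξ X) y = 0)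
    (hX : ∀ U, h y (ξ U y) (ξ X y) = r * negForm 𝔤 U X)
    (hY : ∀ U, h y (ξ Y y) (ξ U y) = q * negForm 𝔤 Y U) :
    h y (curvatureTensor h y (ξ X y) (ξ Y y) (ξ Z y)) (ξ X y) =
      (1 / 2 : ℝ) * (r + q) * negForm 𝔤 ⁅X, Y⁆ ⁅X, Z⁆
      - (1 / 2 : ℝ) * h y (ξ ⁅X, Y⁆ y) (ξ ⁅X, Z⁆ y)
      + h y (covDeriv h (ξ X) (ξ Z) y) (covDeriv h (ξ Y) (ξ X) y) := by
  have h0 : ξ 0 y = 0 := by simpa using H.map_smul 0 0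
  have hneg : ∀ U, ξ (-U) y = - ξ U y := fun U => by simpa using H.map_smul (-1) U
  have hX' : ∀ U, h y (ξ X y) (ξ U y) = r * negForm 𝔤 U X := fun U => by rw [H.symm, hX]
  have e1 : ⁅Y, X⁆ = -⁅X, Y⁆ := (lie_skew _ _).symm
  have e2 : ⁅Z, X⁆ = -⁅X, Z⁆ := (lie_skew _ _).symm
  have e3 : ⁅⁅X, Y⁆, X⁆ = -⁅X, ⁅X, Y⁆⁆ := (lie_skew _ _).symm
  have b1 : negForm 𝔤 ⁅X, ⁅Y, Z⁆⁆ X = 0 := by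
    rw [negForm_symm, negForm_lie_right]; simp
  have b2 : negForm 𝔤 ⁅⁅X, Y⁆, Z⁆ X = - negForm 𝔤 ⁅X, Y⁆ ⁅X, Z⁆ := by
    rw [negForm_lie, e2, map_neg]
  have b3 : negForm 𝔤 Y ⁅X, ⁅X, Z⁆⁆ = - negForm 𝔤 ⁅X, Y⁆ ⁅X, Z⁆ := negForm_lie_right _ _ _
  rw [H.killing.metric_curvatureTensor, hXX]
  simp only [e1, e2, e3, lie_self, lie_zero, lie_neg, h0, hneg, map_neg, map_zero, neg_apply,
    zero_apply, hX, hX', hY, b1, b2, b3, neg_neg]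
  rw [H.symm ⁅X, Z⁆ ⁅X, Y⁆]
  ring

lemma metric_curvatureTensor_ppp {X Y Z : 𝔤} (hX : X ∈ p) (hY : Y ∈ p) (hZ : Z ∈ p) :
    h y (curvatureTensor h y (ξ X y) (ξ Y y) (ξ Z y)) (ξ X y) =
      s * negForm 𝔤 ⁅X, Y⁆ ⁅X, Z⁆ := by
  rw [H.metric_curvatureTensor_diag Z (H.covDeriv_pp S hX hX) (fun U => H.metric_p U X hX)
    (fun U => H.metric_p' U Y hY), H.covDeriv_pp S hX hZ, H.metric_l' _ _ (S.lie_pp _ hX _ hY)]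
  simp only [map_zero, zero_apply]
  ring

lemma covDeriv_nn_self {X : 𝔤} (hX : X ∈ n) : covDeriv h (ξ X) (ξ X) y = 0 := by
  rw [H.covDeriv_nn S hX hX, lie_self]
  simpa using H.map_smul 0 0

lemma metric_curvatureTensor_npp (ht : t ≠ 0) {X Y Z : 𝔤} (hX : X ∈ n) (hY : Y ∈ p)
    (hZ : Z ∈ p) :
    h y (curvatureTensor h y (ξ X y) (ξ Y y) (ξ Z y)) (ξ X y) =
      s ^ 2 / (4 * t) * negForm 𝔤 ⁅X, Y⁆ ⁅X, Z⁆ := by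
  rw [H.metric_curvatureTensor_diag Z (H.covDeriv_nn_self S hX) (fun U => H.metric_n U X hX)
    (fun U => H.metric_p' U Y hY), H.covDeriv_np S ht hX hZ, H.covDeriv_pn S ht hY hX,
    H.metric_n' _ _ (S.lie_np hX hY)]
  simp only [_root_.map_smul, smul_apply, smul_eq_mul, H.metric_n' _ _ (S.lie_np hX hZ)]
  rw [← lie_skew Y X, map_neg, negForm_symm ⁅X, Z⁆]
  field_simp
  ring

lemma metric_curvatureTensor_pnn (ht : t ≠ 0) {X Y Z : 𝔤} (hX : X ∈ p) (hY : Y ∈ n)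
    (hZ : Z ∈ n) :
    h y (curvatureTensor h y (ξ X y) (ξ Y y) (ξ Z y)) (ξ X y) =
      s ^ 2 / (4 * t) * negForm 𝔤 ⁅X, Y⁆ ⁅X, Z⁆ := by
  rw [H.metric_curvatureTensor_diag Z (H.covDeriv_pp S hX hX) (fun U => H.metric_p U X hX)
    (fun U => H.metric_n' U Y hY), H.covDeriv_pn S ht hX hZ, H.covDeriv_np S ht hY hX,
    H.metric_n' _ _ (S.lie_pn _ hX _ hY)]
  simp only [_root_.map_smul, smul_apply, smul_eq_mul, H.metric_n' _ _ (S.lie_pn _ hX _ hZ)]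
  rw [← lie_skew Y X, map_neg, negForm_symm ⁅X, Z⁆]
  field_simp
  ring

/-- This has the shape of O'Neill's formula: the curvature of the symmetric base, corrected by -3/4
of the vertical part of the brackets. The coefficient collects -1/2 from the brackets and -1/4 from
the product of the two covariant derivatives. -/
lemma metric_curvatureTensor_nnn {X Y Z : 𝔤} (hX : X ∈ n) (hY : Y ∈ n) (hZ : Z ∈ n) :
    h y (curvatureTensor h y (ξ X y) (ξ Y y) (ξ Z y)) (ξ X y) =
      t * negForm 𝔤 ⁅X, Y⁆ ⁅X, Z⁆ - 3 / 4 * h y (ξ ⁅X, Y⁆ y) (ξ ⁅X, Z⁆ y) := by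
  have hneg : ∀ U, ξ (-U) y = - ξ U y := fun U => by simpa using H.map_smul (-1) U
  rw [H.metric_curvatureTensor_diag Z (H.covDeriv_nn_self S hX) (fun U => H.metric_n U X hX)
    (fun U => H.metric_n' U Y hY), H.covDeriv_nn S hX hZ, H.covDeriv_nn S hY hX,
    ← lie_skew Y X, hneg]
  simp only [_root_.map_smul, smul_apply, smul_eq_mul, map_neg, H.symm ⁅X, Z⁆]
  ring

lemma metric_kn {X Z : 𝔤} (hX : X ∈ l ⊔ p) (hZ : Z ∈ n) : h y (ξ X y) (ξ Z y) = 0 := by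
  rw [H.metric_n _ _ hZ, S.orth_kn hX hZ, mul_zero]

lemma metric_nk {X Z : 𝔤} (hX : X ∈ n) (hZ : Z ∈ l ⊔ p) : h y (ξ X y) (ξ Z y) = 0 := by
  rw [H.symm, H.metric_kn S hZ hX]

/-- Of the brackets of X with Y and with Z, one lies in 𝔨 and the other in 𝔫, which are orthogonal
for B and for the metric. The term with covariant derivatives vanishes for the same reason, or
because a factor is zero. -/
lemma metric_curvatureTensor_pn (ht : t ≠ 0) {X Y Z : 𝔤} (hX : X ∈ p ∨ X ∈ n)
    (hY : Y ∈ p) (hZ : Z ∈ n) :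
    h y (curvatureTensor h y (ξ X y) (ξ Y y) (ξ Z y)) (ξ X y) = 0 := by
  rcases hX with hX | hX
  · have h1 : ⁅X, Y⁆ ∈ l ⊔ p := Submodule.mem_sup_left (S.lie_pp _ hX _ hY)
    have h2 := S.lie_pn _ hX _ hZ
    rw [H.metric_curvatureTensor_diag Z (H.covDeriv_pp S hX hX) (fun U => H.metric_p U X hX)
      (fun U => H.metric_p' U Y hY), H.covDeriv_pp S hY hX, S.orth_kn h1 h2,
      H.metric_kn S h1 h2]
    simp
  · have h1 := S.lie_np hX hY
    have h2 := S.lie_nn _ hX _ hZ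
    rw [H.metric_curvatureTensor_diag Z (H.covDeriv_nn_self S hX) (fun U => H.metric_n U X hX)
      (fun U => H.metric_p' U Y hY), H.covDeriv_nn S hX hZ, H.covDeriv_pn S ht hY hX,
      S.orth_nk h1 h2, H.metric_nk S h1 h2]
    simp [H.metric_kn S h2 (S.lie_pn _ hY _ hX)]

lemma metric_curvatureTensor_np (ht : t ≠ 0) {X Y Z : 𝔤} (hX : X ∈ p ∨ X ∈ n)
    (hY : Y ∈ n) (hZ : Z ∈ p) :
    h y (curvatureTensor h y (ξ X y) (ξ Y y) (ξ Z y)) (ξ X y) = 0 := by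
  rcases hX with hX | hX
  · have h1 : ⁅X, Z⁆ ∈ l ⊔ p := Submodule.mem_sup_left (S.lie_pp _ hX _ hZ)
    have h2 := S.lie_pn _ hX _ hY
    rw [H.metric_curvatureTensor_diag Z (H.covDeriv_pp S hX hX) (fun U => H.metric_p U X hX)
      (fun U => H.metric_n' U Y hY), H.covDeriv_pp S hX hZ, S.orth_nk h2 h1,
      H.metric_nk S h2 h1]
    simp
  · have h1 := S.lie_np hX hZ
    have h2 := S.lie_nn _ hX _ hY
    rw [H.metric_curvatureTensor_diag Z (H.covDeriv_nn_self S hX) (fun U => H.metric_n U X hX)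
      (fun U => H.metric_n' U Y hY), H.covDeriv_np S ht hX hZ, H.covDeriv_nn S hY hX,
      S.orth_kn h2 h1, H.metric_kn S h2 h1]
    simp [H.metric_nk S h1 (S.lie_nn _ hY _ hX)]

variable {ι κ : Type*} [Fintype ι] [DecidableEq ι] [Fintype κ] [DecidableEq κ]
  {ep : ι → 𝔤} {en : κ → 𝔤}

omit S in
lemma differentiableAt_christoffelMap : DifferentiableAt ℝ (christoffelMap h) y :=
  (contDiffAt_christoffelMap H.killing.contDiffAt_metric
    H.killing.isInvertible).differentiableAt (by norm_num)

omit S in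
lemma map_sum {σ : Type*} [Fintype σ] (c : σ → ℝ) (e : σ → 𝔤) :
    ξ (∑ i, c i • e i) y = ∑ i, c i • ξ (e i) y := by
  let φ : 𝔤 →ₗ[ℝ] V := ⟨⟨fun X => ξ X y, H.map_add⟩, H.map_smul⟩
  change φ _ = ∑ i, c i • φ (e i)
  simp

lemma trace_eq_sum (hs : s ≠ 0) (ht : t ≠ 0) (hp : IsFrame p ep) (hn : IsFrame n en)
    (T : V →ₗ[ℝ] V) :
    LinearMap.trace ℝ V T = ∑ i, s⁻¹ * h y (T (ξ (ep i) y)) (ξ (ep i) y) +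
      ∑ j, t⁻¹ * h y (T (ξ (en j) y)) (ξ (en j) y) := by
  have h1 := trace_eq_sum_dual (Sum.elim (fun i => ξ (ep i) y) (fun j => ξ (en j) y))
    (Sum.elim (fun i => s⁻¹ • ((h y).flip (ξ (ep i) y) : V →ₗ[ℝ] ℝ))
      (fun j => t⁻¹ • ((h y).flip (ξ (en j) y) : V →ₗ[ℝ] ℝ))) ?_ ?_ T
  · rw [h1]; simp
  · rintro (i | i) (j | j)
    · simp [H.metric_p _ _ (hp.mem i), hp.orthonormal, hs, eq_comm]
    · simp [H.metric_p _ _ (hp.mem i), S.orth_nk (hn.mem j) (Submodule.mem_sup_right (hp.mem i))]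
    · simp [H.metric_n _ _ (hn.mem i), S.orth_pn _ (hp.mem j) _ (hn.mem i)]
    · simp [H.metric_n _ _ (hn.mem i), hn.orthonormal, ht, eq_comm]
  · intro v
    obtain ⟨X, rfl⟩ := H.surj v
    have hX : X ∈ l ⊔ p ⊔ n := by rw [S.sup]; trivial
    obtain ⟨k, hk, c, hc, rfl⟩ := Submodule.mem_sup.mp hX
    obtain ⟨a, ha, b, hb, rfl⟩ := Submodule.mem_sup.mp hk
    -- Fields of 𝔩 have length zero at `y`, hence vanish there; the frames of 𝔭 and 𝔫 already span
    -- the tangent space.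
    have ha0 : ξ a y = 0 := by
      by_contra hne
      exact (H.killing.pos _ hne).ne' (H.metric_l _ _ ha)
    rw [H.map_add, H.map_add, ha0, zero_add, hp.expand b hb, hn.expand c hc, H.map_sum, H.map_sum]
    refine add_mem (Submodule.sum_mem _ fun i _ => Submodule.smul_mem _ _ ?_)
      (Submodule.sum_mem _ fun i _ => Submodule.smul_mem _ _ ?_)
    · exact Submodule.subset_span ⟨Sum.inl i, rfl⟩
    · exact Submodule.subset_span ⟨Sum.inr i, rfl⟩

/-- The Ricci curvature of a binormal metric. -/
theorem ricci_eq [FiniteDimensional ℝ 𝔤] (hs : s ≠ 0) (ht : t ≠ 0)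
    {μ : Type*} [Fintype μ] [DecidableEq μ] {el : μ → 𝔤} (hl : IsFrame l el)
    (hp : IsFrame p ep) (hn : IsFrame n en) {γ : ℝ}
    (hγ : ∀ Y ∈ p, ∀ Z ∈ p, casimirForm (Sum.elim el ep) Y Z = γ * negForm 𝔤 Y Z)
    {Y Z Y' Z' : 𝔤} (hY : Y ∈ p) (hZ : Z ∈ p) (hY' : Y' ∈ n) (hZ' : Z' ∈ n) :
    ∑ i, (Module.finBasis ℝ V).repr (curvatureTensor h y (Module.finBasis ℝ V i)
      (ξ (Y + Y') y) (ξ (Z + Z') y)) i =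
      (γ / 2 + (1 - γ) * s ^ 2 / (4 * t ^ 2)) * negForm 𝔤 Y Z
      + ((1 / 2 : ℝ) * negForm 𝔤 Y' Z' - s / (2 * t) * casimirForm ep Y' Z') := by
  have hG := H.differentiableAt_christoffelMap
  rw [sum_repr_curvatureTensor hG, H.trace_eq_sum S hs ht hp hn]
  have hadd : ∀ X, h y (curvatureMap hG (ξ (Y + Y') y) (ξ (Z + Z') y) (ξ X y)) (ξ X y) =
      h y (curvatureTensor h y (ξ X y) (ξ Y y) (ξ Z y)) (ξ X y)
      + h y (curvatureTensor h y (ξ X y) (ξ Y y) (ξ Z' y)) (ξ X y)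
      + h y (curvatureTensor h y (ξ X y) (ξ Y' y) (ξ Z y)) (ξ X y)
      + h y (curvatureTensor h y (ξ X y) (ξ Y' y) (ξ Z' y)) (ξ X y) := by
    intro X
    simp only [curvatureMap, LinearMap.coe_mk, AddHom.coe_mk, curvatureTensor_eq hG, H.map_add,
      _root_.map_add, add_apply, map_sub, sub_apply]
    ring
  -- The bracket of two vectors of 𝔫 lies in 𝔨, and the metric sees only its component in 𝔭.
  have hψ : ∀ j, h y (ξ ⁅en j, Y'⁆ y) (ξ ⁅en j, Z'⁆ y) =
      s * ∑ i, negForm 𝔤 ⁅en j, Y'⁆ (ep i) * negForm 𝔤 ⁅en j, Z'⁆ (ep i) := by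
    intro j
    obtain ⟨a, ha, b, hb, hab⟩ := Submodule.mem_sup.mp (S.lie_nn _ (hn.mem j) _ hY')
    rw [← hab, H.map_add, _root_.map_add, add_apply, H.metric_l' _ _ ha, H.metric_p' _ _ hb,
      hp.parseval hb, zero_add]
    congr 1
    refine Finset.sum_congr rfl fun i _ => ?_
    simp [S.orth_lp _ ha _ (hp.mem i)]
  -- Summed over a frame of 𝔫, the squares of these components rearrange to the Casimir operator of
  -- 𝔭.
  have hcas : ∑ j, h y (ξ ⁅en j, Y'⁆ y) (ξ ⁅en j, Z'⁆ y) = s * casimirForm ep Y' Z' := by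
    rw [hp.casimirForm_comm hn (fun X hX => S.lie_pn _ hX _ hY'), Finset.mul_sum]
    exact Finset.sum_congr rfl fun j _ => hψ j
  have e1 : ∀ i, h y (curvatureMap hG (ξ (Y + Y') y) (ξ (Z + Z') y) (ξ (ep i) y)) (ξ (ep i) y) =
      s * negForm 𝔤 ⁅ep i, Y⁆ ⁅ep i, Z⁆ + s ^ 2 / (4 * t) * negForm 𝔤 ⁅ep i, Y'⁆ ⁅ep i, Z'⁆ := by
    intro i
    rw [hadd, H.metric_curvatureTensor_ppp S (hp.mem i) hY hZ,
      H.metric_curvatureTensor_pn S ht (Or.inl (hp.mem i)) hY hZ',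
      H.metric_curvatureTensor_np S ht (Or.inl (hp.mem i)) hY' hZ,
      H.metric_curvatureTensor_pnn S ht (hp.mem i) hY' hZ']
    ring
  have e2 : ∀ j, h y (curvatureMap hG (ξ (Y + Y') y) (ξ (Z + Z') y) (ξ (en j) y)) (ξ (en j) y) =
      s ^ 2 / (4 * t) * negForm 𝔤 ⁅en j, Y⁆ ⁅en j, Z⁆ + (t * negForm 𝔤 ⁅en j, Y'⁆ ⁅en j, Z'⁆
        - 3 / 4 * h y (ξ ⁅en j, Y'⁆ y) (ξ ⁅en j, Z'⁆ y)) := by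
    intro j
    rw [hadd, H.metric_curvatureTensor_npp S ht (hn.mem j) hY hZ,
      H.metric_curvatureTensor_pn S ht (Or.inr (hn.mem j)) hY hZ',
      H.metric_curvatureTensor_np S ht (Or.inr (hn.mem j)) hY' hZ,
      H.metric_curvatureTensor_nnn S (hn.mem j) hY' hZ']
    ring
  simp only [e1, e2, ← Finset.mul_sum, Finset.sum_add_distrib, Finset.sum_sub_distrib, hcas]
  obtain ⟨c1, c2⟩ := S.casimirForm_p hl hp hn hγ hY hZ
  have c3 := S.casimirForm_n hl hp hn hY' Z'
  have d1 : ∑ i, negForm 𝔤 ⁅ep i, Y⁆ ⁅ep i, Z⁆ = casimirForm ep Y Z := rfl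
  have d2 : ∑ i, negForm 𝔤 ⁅ep i, Y'⁆ ⁅ep i, Z'⁆ = casimirForm ep Y' Z' := rfl
  have d3 : ∑ i, negForm 𝔤 ⁅en i, Y⁆ ⁅en i, Z⁆ = casimirForm en Y Z := rfl
  have d4 : ∑ i, negForm 𝔤 ⁅en i, Y'⁆ ⁅en i, Z'⁆ = casimirForm en Y' Z' := rfl
  -- On 𝔫 the coefficient of C_𝔭 is s/(4t) from the frame of 𝔭 and -3s/(4t) from that of 𝔫, together
  -- -s/(2t).
  rw [d1, d2, d3, d4, c1, c2, c3]
  field_simp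
  ring

end IsBinormalKillingAlgebra

end Ricci

/-! ### Fundamental fields of a local action are Killing -/

section LocalAction

variable {E : Type*} [NormedAddCommGroup E] [NormedSpace ℝ E]
  {V : Type*} [NormedAddCommGroup V] [NormedSpace ℝ V]

/-- A local action `F` near `(e₀, v₀)` of a local group with multiplication `m` and neutral
element `e₀`. -/
structure IsLocalAction (m : E × E → E) (e₀ : E) (F : E × V → V) (v₀ : V) : Prop where
  contDiffAt_mul : ContDiffAt ℝ 3 m (e₀, e₀)
  contDiffAt_act : ContDiffAt ℝ 3 F (e₀, v₀)
  mul_one : ∀ᶠ e in 𝓝 e₀, m (e, e₀) = e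
  one_mul : ∀ᶠ e in 𝓝 e₀, m (e₀, e) = e
  one_act : ∀ᶠ v in 𝓝 v₀, F (e₀, v) = v
  mul_act : ∀ᶠ q : E × E × V in 𝓝 (e₀, e₀, v₀),
    F (m (q.1, q.2.1), q.2.2) = F (q.1, F (q.2.1, q.2.2))

/-- The fundamental vector field of a local action. -/
def fundField (F : E × V → V) (e₀ : E) (X : E) (v : V) : V := fderiv ℝ F (e₀, v) (X, 0)

/-- The left-invariant vector field of a local group. -/
def leftField (m : E × E → E) (e₀ : E) (X : E) (e : E) : E := fderiv ℝ m (e, e₀) (0, X)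

variable {m : E × E → E} {e₀ : E} {F : E × V → V} {v₀ : V}

namespace IsLocalAction

lemma eventually_mul (H : IsLocalAction m e₀ F v₀) :
    ∀ᶠ e in 𝓝 e₀, ContDiffAt ℝ 3 m (e, e₀) := by
  have h1 : Tendsto (fun e : E => (e, e₀)) (𝓝 e₀) (𝓝 (e₀, e₀)) :=
    (Continuous.prodMk_left e₀).tendsto e₀
  exact h1.eventually (H.contDiffAt_mul.eventually (by simp))

lemma eventually_act (H : IsLocalAction m e₀ F v₀) :
    ∀ᶠ p in 𝓝 (e₀, v₀), ContDiffAt ℝ 3 F p := H.contDiffAt_act.eventually (by simp)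

lemma tendsto_right (e₀ : E) (v₀ : V) : Tendsto (fun v : V => (e₀, v)) (𝓝 v₀) (𝓝 (e₀, v₀)) :=
  (Continuous.prodMk_right e₀).tendsto v₀

lemma tendsto_left (e₀ : E) (v : V) : Tendsto (fun e : E => (e, v)) (𝓝 e₀) (𝓝 (e₀, v)) :=
  (Continuous.prodMk_left v).tendsto e₀

lemma fderiv_act_right (H : IsLocalAction m e₀ F v₀) :
    ∀ᶠ v in 𝓝 v₀, ∀ u, fderiv ℝ F (e₀, v) (0, u) = u := by
  filter_upwards [H.one_act.eventually_nhds, (tendsto_right e₀ v₀).eventually H.eventually_act]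
    with v h1 h2 u
  have h3 := (h2.differentiableAt (by norm_num)).hasFDerivAt.comp v
    (hasFDerivAt_prodMk_right (𝕜 := ℝ) e₀ v)
  have h4 : (F ∘ fun v => (e₀, v)) =ᶠ[𝓝 v] id := h1
  have h5 := h3.fderiv
  rw [h4.fderiv_eq, fderiv_id] at h5
  simpa using (congrArg (fun A => A u) h5).symm

lemma leftField_one (H : IsLocalAction m e₀ F v₀) (X : E) : leftField m e₀ X e₀ = X := by
  have h3 := (H.contDiffAt_mul.differentiableAt (by norm_num)).hasFDerivAt.comp e₀
    (hasFDerivAt_prodMk_right (𝕜 := ℝ) e₀ e₀)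
  have h4 : (m ∘ fun v => (e₀, v)) =ᶠ[𝓝 e₀] id := H.one_mul
  have h5 := h3.fderiv
  rw [h4.fderiv_eq, fderiv_id] at h5
  simpa [leftField] using (congrArg (fun A => A X) h5).symm

/-- The derivative of F(m(e, e'), v) = F(e, F(e', v)) in e' at the neutral element: moving e along a
left-invariant field has the same effect as moving v along the fundamental field. -/
lemma fderiv_act_leftField (H : IsLocalAction m e₀ F v₀) (Y : E) :
    ∀ᶠ p : E × V in 𝓝 (e₀, v₀),
      fderiv ℝ F p (leftField m e₀ Y p.1, 0) = fderiv ℝ F p (0, fundField F e₀ Y p.2) := by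
  have t1 : Tendsto (fun p : E × V => p.1) (𝓝 (e₀, v₀)) (𝓝 e₀) := continuous_fst.tendsto _
  have t2 : Tendsto (fun p : E × V => p.2) (𝓝 (e₀, v₀)) (𝓝 v₀) := continuous_snd.tendsto _
  have t3 : Tendsto (fun p : E × V => (p.1, e₀, p.2)) (𝓝 (e₀, v₀)) (𝓝 (e₀, e₀, v₀)) := by
    have : Continuous (fun p : E × V => (p.1, e₀, p.2)) := by fun_prop
    exact this.tendsto _
  filter_upwards [t1.eventually H.mul_one, t2.eventually H.one_act, H.eventually_act,
    t1.eventually H.eventually_mul, t3.eventually H.mul_act.eventually_nhds,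
    t2.eventually ((tendsto_right e₀ v₀).eventually H.eventually_act)] with p h1 h2 h3 h4 h5 h6
  obtain ⟨e, v⟩ := p
  simp only at h1 h2 h3 h4 h5 h6 ⊢
  have t4 : Tendsto (fun e' : E => (e, e', v)) (𝓝 e₀) (𝓝 (e, e₀, v)) := by
    have : Continuous (fun e' : E => (e, e', v)) := by fun_prop
    exact this.tendsto _
  have heq : (fun e' => F (m (e, e'), v)) =ᶠ[𝓝 e₀] fun e' => F (e, F (e', v)) := t4.eventually h5
  have d1 : HasFDerivAt (fun e' => F (m (e, e'), v))
      ((fderiv ℝ F (e, v)).comp ((ContinuousLinearMap.inl ℝ E V).comp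
        ((fderiv ℝ m (e, e₀)).comp (ContinuousLinearMap.inr ℝ E E)))) e₀ := by
    have a1 := (h4.differentiableAt (by norm_num)).hasFDerivAt.comp e₀
      (hasFDerivAt_prodMk_right (𝕜 := ℝ) e e₀)
    have a2 : HasFDerivAt F (fderiv ℝ F (e, v)) ((fun e' => (e', v)) (m (e, e₀))) := by
      rw [h1]; exact (h3.differentiableAt (by norm_num)).hasFDerivAt
    exact a2.comp e₀ ((hasFDerivAt_prodMk_left (𝕜 := ℝ) (m (e, e₀)) v).comp e₀ a1)
  have d2 : HasFDerivAt (fun e' => F (e, F (e', v)))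
      ((fderiv ℝ F (e, v)).comp ((ContinuousLinearMap.inr ℝ E V).comp
        ((fderiv ℝ F (e₀, v)).comp (ContinuousLinearMap.inl ℝ E V)))) e₀ := by
    have a1 := (h6.differentiableAt (by norm_num)).hasFDerivAt.comp e₀
      (hasFDerivAt_prodMk_left (𝕜 := ℝ) e₀ v)
    have a2 : HasFDerivAt F (fderiv ℝ F (e, v)) ((fun v' => (e, v')) (F (e₀, v))) := by
      rw [h2]; exact (h3.differentiableAt (by norm_num)).hasFDerivAt
    exact a2.comp e₀ ((hasFDerivAt_prodMk_right (𝕜 := ℝ) e (F (e₀, v))).comp e₀ a1)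
  have h7 := heq.fderiv_eq (𝕜 := ℝ)
  rw [d1.fderiv, d2.fderiv] at h7
  simpa [leftField, fundField] using DFunLike.congr_fun h7 Y

/-- Facts about the second derivative of the action at a point `(e₀, v)`. -/
lemma contDiffAt_fderiv (H : IsLocalAction m e₀ F v₀) :
    ∀ᶠ v in 𝓝 v₀, ContDiffAt ℝ 2 (fderiv ℝ F) (e₀, v) := by
  filter_upwards [(tendsto_right e₀ v₀).eventually H.eventually_act] with v hv
  exact hv.fderiv_right (by norm_num)

lemma contDiffAt_fundField (H : IsLocalAction m e₀ F v₀) (X : E) :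
    ContDiffAt ℝ 2 (fundField F e₀ X) v₀ := by
  have h1 : ContDiffAt ℝ 2 (fun v => fderiv ℝ F (e₀, v)) v₀ :=
    (H.contDiffAt_act.fderiv_right (m := 2) (by norm_num)).comp v₀
      (contDiffAt_const.prodMk contDiffAt_id)
  exact h1.clm_apply contDiffAt_const

lemma hasFDerivAt_fundField (H : IsLocalAction m e₀ F v₀) :
    ∀ᶠ v in 𝓝 v₀, ∀ X w, fderiv ℝ (fundField F e₀ X) v w =
      fderiv ℝ (fderiv ℝ F) (e₀, v) (0, w) (X, 0) := by
  filter_upwards [H.contDiffAt_fderiv] with v hv X w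
  have h1 := (hv.differentiableAt (by norm_num)).hasFDerivAt.comp v
    (hasFDerivAt_prodMk_right (𝕜 := ℝ) e₀ v)
  have h2 := (h1.clm_apply (hasFDerivAt_const (X, (0 : V)) v)).fderiv
  have h3 : fderiv ℝ (fundField F e₀ X) v = _ := h2
  rw [h3]; simp

lemma second_symm (H : IsLocalAction m e₀ F v₀) :
    ∀ᶠ v in 𝓝 v₀, ∀ a b, fderiv ℝ (fderiv ℝ F) (e₀, v) a b =
      fderiv ℝ (fderiv ℝ F) (e₀, v) b a := by
  filter_upwards [(tendsto_right e₀ v₀).eventually H.eventually_act] with v hv a b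
  exact hv.isSymmSndFDerivAt (by simp; norm_num) a b

lemma differentiableAt_leftField (H : IsLocalAction m e₀ F v₀) (Y : E) :
    DifferentiableAt ℝ (leftField m e₀ Y) e₀ := by
  have h0 : HasFDerivAt (fderiv ℝ m) _ ((fun e => (e, e₀)) e₀) :=
    ((H.contDiffAt_mul.fderiv_right (m := 2) (by norm_num)).differentiableAt
      (by norm_num)).hasFDerivAt
  have h1 := HasFDerivAt.comp (f := fun e => (e, e₀)) e₀ h0
    (hasFDerivAt_prodMk_left (𝕜 := ℝ) e₀ e₀)
  exact (h1.clm_apply (hasFDerivAt_const ((0 : E), Y) e₀)).differentiableAt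

/-- The derivative of `fderiv_act_leftField` in the group variable at the neutral element. The
second derivative on the right is symmetric in X and Y, so antisymmetrising leaves the bracket of
the left-invariant fields. -/
lemma fderiv_fundField_fundField (H : IsLocalAction m e₀ F v₀) (X Y : E) :
    ∀ᶠ v in 𝓝 v₀, fderiv ℝ (fundField F e₀ X) v (fundField F e₀ Y v) =
      fderiv ℝ (fderiv ℝ F) (e₀, v) (X, 0) (Y, 0)
      + fundField F e₀ (fderiv ℝ (leftField m e₀ Y) e₀ X) v := by
  filter_upwards [H.hasFDerivAt_fundField, H.second_symm, H.contDiffAt_fderiv,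
    (tendsto_right e₀ v₀).eventually (H.fderiv_act_leftField Y).eventually_nhds]
    with v h1 h2 h3 h4
  rw [h1, h2]
  have heq : (fun e => fderiv ℝ F (e, v) (leftField m e₀ Y e, 0)) =ᶠ[𝓝 e₀]
      fun e => fderiv ℝ F (e, v) (0, fundField F e₀ Y v) := (tendsto_left e₀ v).eventually h4
  have a1 := (h3.differentiableAt (by norm_num)).hasFDerivAt.comp e₀
      (hasFDerivAt_prodMk_left (𝕜 := ℝ) e₀ v)
  have a2 := a1.clm_apply (((ContinuousLinearMap.inl ℝ E V).hasFDerivAt).comp e₀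
    (H.differentiableAt_leftField Y).hasFDerivAt)
  have a3 := a1.clm_apply (hasFDerivAt_const ((0 : E), fundField F e₀ Y v) e₀)
  have a2' : fderiv ℝ (fun e => fderiv ℝ F (e, v) (leftField m e₀ Y e, 0)) e₀ = _ := a2.fderiv
  have a3' : fderiv ℝ (fun e => fderiv ℝ F (e, v) (0, fundField F e₀ Y v)) e₀ = _ := a3.fderiv
  have h7 := heq.fderiv_eq (𝕜 := ℝ)
  rw [a2', a3'] at h7
  have h8 := DFunLike.congr_fun h7 X
  simp [H.leftField_one] at h8
  rw [← h8, fundField, add_comm]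

/-- An isometric local action yields a Lie algebra of Killing fields. -/
theorem isKillingAlgebra {𝔤 : Type*} [LieRing 𝔤] [LieAlgebra ℝ 𝔤]
    (H : IsLocalAction m e₀ F v₀) (j : 𝔤 → E)
    (hj : ∀ X Y, j ⁅X, Y⁆ = fderiv ℝ (leftField m e₀ (j Y)) e₀ (j X)
      - fderiv ℝ (leftField m e₀ (j X)) e₀ (j Y))
    {h : V → V →L[ℝ] V →L[ℝ] ℝ} (hh : ContDiffAt ℝ 2 h v₀)
    (hsymm : ∀ᶠ z in 𝓝 v₀, ∀ u v, h z u v = h z v u) (hpos : ∀ u, u ≠ 0 → 0 < h v₀ u u)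
    (hinv : ∀ᶠ p : E × V in 𝓝 (e₀, v₀), ∀ u w,
      h (F p) (fderiv ℝ F p (0, u)) (fderiv ℝ F p (0, w)) = h p.2 u w) :
    IsKillingAlgebra h (fun X : 𝔤 => fundField F e₀ (j X)) v₀ where
  contDiffAt_metric := hh
  symm := hsymm
  pos := hpos
  contDiffAt_field X := H.contDiffAt_fundField _
  bracket X Y := by
    filter_upwards [H.fderiv_fundField_fundField (j X) (j Y),
      H.fderiv_fundField_fundField (j Y) (j X), H.second_symm] with v h1 h2 h3
    rw [h1, h2, h3 (j Y, 0), hj]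
    simp only [fundField]
    rw [add_sub_add_left_eq_sub, ← map_sub]
    simp
  killing X := by
    filter_upwards [H.hasFDerivAt_fundField, H.second_symm, H.contDiffAt_fderiv,
      H.fderiv_act_right, (tendsto_right e₀ v₀).eventually hinv.eventually_nhds, H.one_act,
      hh.eventually (by simp), (tendsto_right e₀ v₀).eventually H.eventually_act]
      with v h1 h2 h3 h4 h5 h6 h7 h8 u w
    rw [h1, h1, h2 (0, u), h2 (0, w)]
    -- The Killing equation is the derivative at the neutral element of the condition that the
    -- action be isometric.
    have heq : (fun e => h (F (e, v)) (fderiv ℝ F (e, v) (0, u)) (fderiv ℝ F (e, v) (0, w)))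
        =ᶠ[𝓝 e₀] fun _ => h v u w :=
      ((tendsto_left e₀ v).eventually h5).mono fun e he => he u w
    have a1 := (h3.differentiableAt (by norm_num)).hasFDerivAt.comp e₀
      (hasFDerivAt_prodMk_left (𝕜 := ℝ) e₀ v)
    have a2 := a1.clm_apply (hasFDerivAt_const ((0 : E), u) e₀)
    have a3 := a1.clm_apply (hasFDerivAt_const ((0 : E), w) e₀)
    have b1 : HasFDerivAt h (fderiv ℝ h v) (F ((fun e => (e, v)) e₀)) := by
      simp only [h6]; exact (h7.differentiableAt (by norm_num)).hasFDerivAt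
    have b2 := b1.comp e₀ ((h8.differentiableAt (by norm_num)).hasFDerivAt.comp e₀
      (hasFDerivAt_prodMk_left (𝕜 := ℝ) e₀ v))
    have c1 := ((b2.clm_apply a2).clm_apply a3).fderiv
    have h9 := heq.fderiv_eq (𝕜 := ℝ)
    rw [fderiv_const_apply] at h9
    have c2 : fderiv ℝ (fun e => h (F (e, v)) (fderiv ℝ F (e, v) (0, u))
      (fderiv ℝ F (e, v) (0, w))) e₀ = _ := c1
    rw [c2] at h9
    have h10 := DFunLike.congr_fun h9 (j X)
    simp [h4, h6] at h10
    simp only [fundField]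
    linarith

end IsLocalAction

end LocalAction

/-! ### Differentials of maps and preferred charts -/

section Differential

variable {V : Type*} [NormedAddCommGroup V] [NormedSpace ℝ V]
  {M : Type*} [TopologicalSpace M] [ChartedSpace V M]
  {W : Type*} [NormedAddCommGroup W] [NormedSpace ℝ W]
  {N : Type*} [TopologicalSpace N] [ChartedSpace W N]
  {U : Type*} [NormedAddCommGroup U] [NormedSpace ℝ U]
  {P : Type*} [TopologicalSpace P] [ChartedSpace U P]

lemma differential_comp {g : N → P} {f : M → N} {x : M}
    (hg : MDifferentiableAt 𝓘(ℝ, W) 𝓘(ℝ, U) g (f x))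
    (hf : MDifferentiableAt 𝓘(ℝ, V) 𝓘(ℝ, W) f x) :
    differential (V := V) (W := U) (g ∘ f) x =
      (differential (V := W) (W := U) g (f x)).comp (differential (V := V) (W := W) f x) :=
  mfderiv_comp x hg hf

lemma differential_comp_apply {g : N → P} {f : M → N} {x : M}
    (hg : MDifferentiableAt 𝓘(ℝ, W) 𝓘(ℝ, U) g (f x))
    (hf : MDifferentiableAt 𝓘(ℝ, V) 𝓘(ℝ, W) f x) (v : V) :
    differential (V := V) (W := U) (fun y => g (f y)) x v =
      differential (V := W) (W := U) g (f x) (differential (V := V) (W := W) f x v) :=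
  DFunLike.congr_fun (differential_comp hg hf) v

lemma differential_congr {f g : M → N} {x : M} (h : f =ᶠ[𝓝 x] g) :
    differential (V := V) (W := W) f x = differential (V := V) (W := W) g x :=
  h.mfderiv_eq

lemma differential_id (x : M) :
    differential (V := V) (W := V) (fun y : M => y) x = ContinuousLinearMap.id ℝ V :=
  mfderiv_id

lemma differential_const (c : N) (x : M) :
    differential (V := V) (W := W) (fun _ : M => c) x = 0 :=
  mfderiv_const

lemma differential_eq_fderiv (f : V → W) (x : V) :
    differential (V := V) (W := W) f x = fderiv ℝ f x :=
  mfderiv_eq_fderiv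

lemma ContMDiffAt.mdiff {f : M → N} {x : M}
    (hf : ContMDiffAt 𝓘(ℝ, V) 𝓘(ℝ, W) ∞ f x) : MDifferentiableAt 𝓘(ℝ, V) 𝓘(ℝ, W) f x :=
  hf.mdifferentiableAt (by simp)

lemma ContMDiff.mdiff {f : M → N}
    (hf : ContMDiff 𝓘(ℝ, V) 𝓘(ℝ, W) ∞ f) (x : M) : MDifferentiableAt 𝓘(ℝ, V) 𝓘(ℝ, W) f x :=
  hf.mdifferentiableAt (by simp)

variable [IsManifold 𝓘(ℝ, V) ∞ M] [IsManifold 𝓘(ℝ, W) ∞ N]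

lemma contMDiffAt_extChart (x : M) {y : M} (hy : y ∈ (extChartAt 𝓘(ℝ, V) x).source) :
    ContMDiffAt 𝓘(ℝ, V) 𝓘(ℝ, V) ∞ (extChartAt 𝓘(ℝ, V) x) y :=
  contMDiffAt_extChartAt' (by simpa using hy)

lemma contMDiffAt_extChart_symm (x : M) {v : V} (hv : v ∈ (extChartAt 𝓘(ℝ, V) x).target) :
    ContMDiffAt 𝓘(ℝ, V) 𝓘(ℝ, V) ∞ (extChartAt 𝓘(ℝ, V) x).symm v :=
  (contMDiffOn_extChartAt_symm x).contMDiffAt ((isOpen_extChartAt_target x).mem_nhds hv)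

/-- Tangent vectors at `x` are by convention their coordinates in the preferred chart at `x`. -/
lemma differential_extChartAt_self (x : M) :
    differential (V := V) (W := V) (extChartAt 𝓘(ℝ, V) x) x = ContinuousLinearMap.id ℝ V :=
  mfderiv_extChartAt_self

lemma differential_extChartAt_comp_symm (x : M) {v : V}
    (hv : v ∈ (extChartAt 𝓘(ℝ, V) x).target) (u : V) :
    differential (V := V) (W := V) (extChartAt 𝓘(ℝ, V) x) ((extChartAt 𝓘(ℝ, V) x).symm v)
      (differential (V := V) (W := V) (extChartAt 𝓘(ℝ, V) x).symm v u) = u := by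
  have h := mfderiv_extChartAt_comp_mfderivWithin_extChartAt_symm (I := 𝓘(ℝ, V)) (x := x) hv
  simp only [modelWithCornersSelf_coe, Set.range_id, mfderivWithin_univ] at h
  exact DFunLike.congr_fun h u

lemma differential_symm_comp_extChartAt (x : M) {v : V}
    (hv : v ∈ (extChartAt 𝓘(ℝ, V) x).target) (u : V) :
    differential (V := V) (W := V) (extChartAt 𝓘(ℝ, V) x).symm v
      (differential (V := V) (W := V) (extChartAt 𝓘(ℝ, V) x)
        ((extChartAt 𝓘(ℝ, V) x).symm v) u) = u := by
  have h := mfderivWithin_extChartAt_symm_comp_mfderiv_extChartAt (I := 𝓘(ℝ, V)) (x := x) hv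
  simp only [modelWithCornersSelf_coe, Set.range_id, mfderivWithin_univ] at h
  exact DFunLike.congr_fun h u

lemma differential_extChartAt_symm_self (x : M) :
    differential (V := V) (W := V) (extChartAt 𝓘(ℝ, V) x).symm (extChartAt 𝓘(ℝ, V) x x) =
      ContinuousLinearMap.id ℝ V := by
  ext u
  have h := differential_symm_comp_extChartAt x (mem_extChartAt_target (I := 𝓘(ℝ, V)) x) u
  rwa [extChartAt_to_inv, differential_extChartAt_self] at h

/-- The differential at `x` in terms of the preferred charts at `x` and `f x`. -/
lemma fderiv_chart_eq_differential {f : M → N} {x : M} {y : N} (hy : f x = y)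
    (hf : MDifferentiableAt 𝓘(ℝ, V) 𝓘(ℝ, W) f x) :
    fderiv ℝ (fun v => extChartAt 𝓘(ℝ, W) y (f ((extChartAt 𝓘(ℝ, V) x).symm v)))
      (extChartAt 𝓘(ℝ, V) x x) = differential (V := V) (W := W) f x := by
  subst hy
  rw [← differential_eq_fderiv]
  ext u
  have h1 := (contMDiffAt_extChart_symm x (mem_extChartAt_target (I := 𝓘(ℝ, V)) x)).mdiff
  have h0 : (extChartAt 𝓘(ℝ, V) x).symm (extChartAt 𝓘(ℝ, V) x x) = x := extChartAt_to_inv x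
  rw [differential_comp_apply (V := V) (W := W) (U := W) (g := extChartAt 𝓘(ℝ, W) (f x))
      (f := fun v => f ((extChartAt 𝓘(ℝ, V) x).symm v)),
      differential_comp_apply (V := V) (W := V) (U := W) (g := f) _ h1]
  · rw [h0, differential_extChartAt_self, differential_extChartAt_symm_self]; rfl
  · rwa [h0]
  · simp only [h0]
    exact (contMDiffAt_extChart (f x) (mem_extChartAt_source (f x))).mdiff
  · exact MDifferentiableAt.comp _ (by rwa [h0]) h1

end Differential

/-! ### The group law and the Lie bracket in the chart at 1 -/

section GroupChart

variable {E : Type*} [NormedAddCommGroup E] [NormedSpace ℝ E]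
  {G : Type*} [TopologicalSpace G] [ChartedSpace E G] [Group G] [LieGroup 𝓘(ℝ, E) ∞ G]

variable (E G) in
/-- The multiplication of `G` in the preferred chart at `1`. -/
def chartMul (p : E × E) : E :=
  extChartAt 𝓘(ℝ, E) (1 : G) ((extChartAt 𝓘(ℝ, E) (1 : G)).symm p.1 *
    (extChartAt 𝓘(ℝ, E) (1 : G)).symm p.2)

lemma chart_symm_one : (extChartAt 𝓘(ℝ, E) (1 : G)).symm (extChartAt 𝓘(ℝ, E) (1 : G) 1) = 1 :=
  extChartAt_to_inv 1

lemma contMDiffAt_mul_of {M : Type*} {V : Type*} [NormedAddCommGroup V] [NormedSpace ℝ V]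
    [TopologicalSpace M] [ChartedSpace V M] {f g : M → G} {x : M}
    (hf : ContMDiffAt 𝓘(ℝ, V) 𝓘(ℝ, E) ∞ f x) (hg : ContMDiffAt 𝓘(ℝ, V) 𝓘(ℝ, E) ∞ g x) :
    ContMDiffAt 𝓘(ℝ, V) 𝓘(ℝ, E) ∞ (fun y => f y * g y) x := hf.mul hg

lemma contMDiffAt_inv_of {M : Type*} {V : Type*} [NormedAddCommGroup V] [NormedSpace ℝ V]
    [TopologicalSpace M] [ChartedSpace V M] {f : M → G} {x : M}
    (hf : ContMDiffAt 𝓘(ℝ, V) 𝓘(ℝ, E) ∞ f x) :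
    ContMDiffAt 𝓘(ℝ, V) 𝓘(ℝ, E) ∞ (fun y => (f y)⁻¹) x := hf.inv

lemma contMDiffAt_chart_symm_fst {V : Type*} [NormedAddCommGroup V] [NormedSpace ℝ V]
    {p : E × V} (hp : p.1 ∈ (extChartAt 𝓘(ℝ, E) (1 : G)).target) :
    ContMDiffAt 𝓘(ℝ, E × V) 𝓘(ℝ, E) ∞
      (fun q : E × V => (extChartAt 𝓘(ℝ, E) (1 : G)).symm q.1) p :=
  ContMDiffAt.comp (x := p) (f := Prod.fst) (contMDiffAt_extChart_symm (1 : G) hp)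
    contDiff_fst.contMDiff.contMDiffAt

lemma contMDiffAt_chart_symm_snd {V : Type*} [NormedAddCommGroup V] [NormedSpace ℝ V]
    {M : Type*} [TopologicalSpace M] [ChartedSpace V M] [IsManifold 𝓘(ℝ, V) ∞ M] (x : M)
    {p : E × V} (hp : p.2 ∈ (extChartAt 𝓘(ℝ, V) x).target) :
    ContMDiffAt 𝓘(ℝ, E × V) 𝓘(ℝ, V) ∞
      (fun q : E × V => (extChartAt 𝓘(ℝ, V) x).symm q.2) p :=
  ContMDiffAt.comp (x := p) (f := Prod.snd) (contMDiffAt_extChart_symm x hp)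
    contDiff_snd.contMDiff.contMDiffAt

lemma contDiffAt_chartMul {p : E × E} (h1 : p.1 ∈ (extChartAt 𝓘(ℝ, E) (1 : G)).target)
    (h2 : p.2 ∈ (extChartAt 𝓘(ℝ, E) (1 : G)).target)
    (h3 : (extChartAt 𝓘(ℝ, E) (1 : G)).symm p.1 * (extChartAt 𝓘(ℝ, E) (1 : G)).symm p.2 ∈
      (extChartAt 𝓘(ℝ, E) (1 : G)).source) :
    ContDiffAt ℝ ∞ (chartMul E G) p := by
  rw [← contMDiffAt_iff_contDiffAt]
  exact ContMDiffAt.comp (x := p) (contMDiffAt_extChart (1 : G) h3)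
    (contMDiffAt_mul_of (contMDiffAt_chart_symm_fst h1) (contMDiffAt_chart_symm_snd 1 h2))

lemma eventually_mem_target : ∀ᶠ e in 𝓝 (extChartAt 𝓘(ℝ, E) (1 : G) 1),
    e ∈ (extChartAt 𝓘(ℝ, E) (1 : G)).target := extChartAt_target_mem_nhds 1

/-- Left-invariant fields in the preferred chart at `1`. -/
lemma leftField_chartMul {e : E} (he : e ∈ (extChartAt 𝓘(ℝ, E) (1 : G)).target) (X : E) :
    leftField (chartMul E G) (extChartAt 𝓘(ℝ, E) (1 : G) 1) X e =
      differential (V := E) (W := E) (extChartAt 𝓘(ℝ, E) (1 : G))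
        ((extChartAt 𝓘(ℝ, E) (1 : G)).symm e)
        (differential (V := E) (W := E)
          (fun b : G => (extChartAt 𝓘(ℝ, E) (1 : G)).symm e * b) 1 X) := by
  set κ := extChartAt 𝓘(ℝ, E) (1 : G)
  have h3 : κ.symm e * κ.symm (κ 1) = κ.symm e := by rw [chart_symm_one, mul_one]
  have hs : κ.symm e ∈ κ.source := κ.map_target he
  have hd := ((contDiffAt_chartMul (p := (e, κ 1)) he (mem_extChartAt_target 1)
    (by simp only; rw [h3]; exact hs)).differentiableAt (by simp)).hasFDerivAt.comp (κ 1)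
    (hasFDerivAt_prodMk_right (𝕜 := ℝ) e (κ 1))
  have h4 : leftField (chartMul E G) (κ 1) X e =
      fderiv ℝ (fun e' => κ (κ.symm e * κ.symm e')) (κ 1) X := by
    have h5 : fderiv ℝ (fun e' => κ (κ.symm e * κ.symm e')) (κ 1) = _ := hd.fderiv
    rw [h5]; simp [leftField]
  have hmul : ContMDiffAt 𝓘(ℝ, E) 𝓘(ℝ, E) ∞ (fun b : G => κ.symm e * b) (κ.symm (κ 1)) :=
    contMDiffAt_mul_of contMDiffAt_const contMDiffAt_id
  have hsy := contMDiffAt_extChart_symm (1 : G) (mem_extChartAt_target (I := 𝓘(ℝ, E)) (1 : G))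
  rw [h4, ← differential_eq_fderiv,
    differential_comp_apply (V := E) (W := E) (U := E) (g := κ)
      (f := fun e' => κ.symm e * κ.symm e'),
    differential_comp_apply (V := E) (W := E) (U := E) (g := fun b => κ.symm e * b)
      (f := κ.symm) hmul.mdiff hsy.mdiff]
  · rw [h3, differential_extChartAt_symm_self, chart_symm_one]; rfl
  · simp only [h3]; exact (contMDiffAt_extChart 1 hs).mdiff
  · exact MDifferentiableAt.comp (κ 1) hmul.mdiff hsy.mdiff

/-- The Lie bracket of `𝔤` in the preferred chart at `1`. -/
lemma lie_eq_fderiv_leftField (X Y : GroupLieAlgebra 𝓘(ℝ, E) G) :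
    (⁅X, Y⁆ : GroupLieAlgebra 𝓘(ℝ, E) G) =
      fderiv ℝ (leftField (chartMul E G) (extChartAt 𝓘(ℝ, E) (1 : G) 1) Y)
        (extChartAt 𝓘(ℝ, E) (1 : G) 1) X
      - fderiv ℝ (leftField (chartMul E G) (extChartAt 𝓘(ℝ, E) (1 : G) 1) X)
        (extChartAt 𝓘(ℝ, E) (1 : G) 1) Y := by
  set κ := extChartAt 𝓘(ℝ, E) (1 : G) with hκ
  -- The bracket of 𝔤 is that of left-invariant fields, computed by pulling them back through the
  -- chart; there they coincide with the fields `leftField` of the local group.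
  have key : ∀ X : E, VectorField.mpullbackWithin 𝓘(ℝ, E) 𝓘(ℝ, E) κ.symm
      (mulInvariantVectorField (X : GroupLieAlgebra 𝓘(ℝ, E) G)) Set.univ =ᶠ[𝓝 (κ 1)]
      leftField (chartMul E G) (κ 1) X := by
    intro X
    filter_upwards [eventually_mem_target (E := E) (G := G)] with e he
    rw [leftField_chartMul he, VectorField.mpullbackWithin_apply, mfderivWithin_univ]
    have h1 : (differential (V := E) (W := E) κ.symm e).inverse =
        differential (V := E) (W := E) κ (κ.symm e) := by
      apply ContinuousLinearMap.inverse_eq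
      · ext u; exact differential_symm_comp_extChartAt 1 he u
      · ext u; exact differential_extChartAt_comp_symm 1 he u
    exact congrArg (fun A : E →L[ℝ] E => A (differential (V := E) (W := E)
      (fun b : G => κ.symm e * b) 1 X)) h1
  -- The bracket is transported back to 1 by the inverse of the differential of the chart, which is
  -- the identity.
  have hinv : (differential (V := E) (W := E) κ (1 : G)).inverse =
      ContinuousLinearMap.id ℝ E := by
    rw [hκ, differential_extChartAt_self]; exact ContinuousLinearMap.inverse_id
  have hl : ∀ X : E, leftField (chartMul E G) (κ 1) X (κ 1) = X := by
    intro X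
    have hid : (fun b : G => 1 * b) = fun b => b := by ext; simp
    rw [leftField_chartMul (mem_extChartAt_target 1), chart_symm_one,
      differential_extChartAt_self, hid, differential_id]
    rfl
  rw [GroupLieAlgebra.bracket_def, VectorField.mlieBracket, VectorField.mlieBracketWithin_apply]
  have h2 : ∀ u : E, (differential (V := E) (W := E) κ (1 : G)).inverse u = u := by
    intro u; rw [hinv]; rfl
  refine (h2 _).trans ?_
  simp only [modelWithCornersSelf_coe, Set.range_id, Set.preimage_univ, Set.inter_univ]
  refine (congrFun (VectorField.lieBracketWithin_univ (𝕜 := ℝ) (E := E)) _).trans ?_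
  refine (Filter.EventuallyEq.lieBracket_vectorField_eq (𝕜 := ℝ) (E := E) (key X)
    (key Y)).trans ?_
  exact congrArg₂ (fun a b : E => a - b)
    (congrArg (fderiv ℝ (leftField (chartMul E G) (κ 1) Y) (κ 1)) (hl X))
    (congrArg (fderiv ℝ (leftField (chartMul E G) (κ 1) X) (κ 1)) (hl Y))

end GroupChart

/-! ### The adjoint representation -/

section Adjoint

variable {E : Type*} [NormedAddCommGroup E] [NormedSpace ℝ E]
  {G : Type*} [TopologicalSpace G] [ChartedSpace E G] [Group G]

variable (E) in
/-- The adjoint representation as a continuous linear map on the model space. -/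
def adMap (a : G) : E →L[ℝ] E := differential (V := E) (W := E) (fun x : G => a * x * a⁻¹) 1

variable [LieGroup 𝓘(ℝ, E) ∞ G]

lemma contMDiff_conj (a : G) : ContMDiff 𝓘(ℝ, E) 𝓘(ℝ, E) ∞ (fun x : G => a * x * a⁻¹) :=
  fun _ => contMDiffAt_mul_of (contMDiffAt_mul_of contMDiffAt_const contMDiffAt_id)
    contMDiffAt_const

/-- The differential of a map at the neutral element precomposed with a conjugation. -/
lemma differential_comp_conj {V M : Type*} [NormedAddCommGroup V] [NormedSpace ℝ V]
    [TopologicalSpace M] [ChartedSpace V M] {f : G → M}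
    (hf : MDifferentiableAt 𝓘(ℝ, E) 𝓘(ℝ, V) f 1) (a : G) (X : E) :
    differential (V := E) (W := V) (fun x : G => f (a * x * a⁻¹)) 1 X =
      differential (V := E) (W := V) f 1 (adMap E a X) := by
  have h1 : a * 1 * a⁻¹ = 1 := by simp
  rw [differential_comp_apply (V := E) (W := E) (U := V) (g := f) (f := fun x => a * x * a⁻¹)
    (by rwa [h1]) ((contMDiff_conj a).mdiff 1), h1]
  rfl

lemma adMap_mul_apply (a b : G) (X : E) : adMap E (a * b) X = adMap E a (adMap E b X) := by
  rw [adMap, adMap, ← differential_comp_conj ((contMDiff_conj a).mdiff 1)]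
  congr 2
  ext x; group

omit [LieGroup 𝓘(ℝ, E) ∞ G] in
lemma adMap_one_apply (X : E) : adMap E (1 : G) X = X := by
  have : (fun x : G => 1 * x * 1⁻¹) = fun x => x := by ext; simp
  rw [adMap, this, differential_id]; rfl

lemma adMap_inv_apply (a : G) (X : E) : adMap E a⁻¹ (adMap E a X) = X := by
  rw [← adMap_mul_apply, inv_mul_cancel, adMap_one_apply]

lemma adMap_apply_inv (a : G) (X : E) : adMap E a (adMap E a⁻¹ X) = X := by
  rw [← adMap_mul_apply, mul_inv_cancel, adMap_one_apply]

variable (E G) in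
/-- Conjugation in the preferred chart at `1`. -/
def chartConj (p : E × E) : E :=
  extChartAt 𝓘(ℝ, E) (1 : G) ((extChartAt 𝓘(ℝ, E) (1 : G)).symm p.1 *
    (extChartAt 𝓘(ℝ, E) (1 : G)).symm p.2 * ((extChartAt 𝓘(ℝ, E) (1 : G)).symm p.1)⁻¹)

lemma contDiffAt_chartConj {e : E} (he : e ∈ (extChartAt 𝓘(ℝ, E) (1 : G)).target) :
    ContDiffAt ℝ ∞ (chartConj E G) (e, extChartAt 𝓘(ℝ, E) (1 : G) 1) := by
  rw [← contMDiffAt_iff_contDiffAt]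
  have h1 := contMDiffAt_chart_symm_fst (E := E) (G := G) (V := E)
    (p := (e, extChartAt 𝓘(ℝ, E) (1 : G) 1)) he
  have h2 := contMDiffAt_chart_symm_snd (E := E) (1 : G)
    (p := (e, extChartAt 𝓘(ℝ, E) (1 : G) 1)) (mem_extChartAt_target 1)
  refine ContMDiffAt.comp (x := (e, extChartAt 𝓘(ℝ, E) (1 : G) 1)) (contMDiffAt_extChart (1 : G) ?_)
    (contMDiffAt_mul_of (contMDiffAt_mul_of h1 h2) (contMDiffAt_inv_of h1))
  simp only [chart_symm_one, mul_one, mul_inv_cancel]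
  exact mem_extChartAt_source 1

/-- Exhibits Ad as a partial derivative of a jointly smooth map, from which its smoothness in the
group variable follows. -/
lemma adMap_chart {e : E} (he : e ∈ (extChartAt 𝓘(ℝ, E) (1 : G)).target) :
    adMap E ((extChartAt 𝓘(ℝ, E) (1 : G)).symm e) =
      (fderiv ℝ (chartConj E G) (e, extChartAt 𝓘(ℝ, E) (1 : G) 1)).comp
        (ContinuousLinearMap.inr ℝ E E) := by
  rw [adMap, ← fderiv_chart_eq_differential (y := (1 : G)) (by simp) ((contMDiff_conj _).mdiff 1)]
  have h := ((contDiffAt_chartConj (G := G) he).differentiableAt (by simp)).hasFDerivAt.comp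
    (extChartAt 𝓘(ℝ, E) (1 : G) 1) (hasFDerivAt_prodMk_right (𝕜 := ℝ) e _)
  exact h.fderiv

lemma contDiffAt_adMap_chart :
    ContDiffAt ℝ ∞ (fun e => adMap E ((extChartAt 𝓘(ℝ, E) (1 : G)).symm e))
      (extChartAt 𝓘(ℝ, E) (1 : G) 1) := by
  have h1 : ContDiffAt ℝ ∞ (fun e => (fderiv ℝ (chartConj E G)
      (e, extChartAt 𝓘(ℝ, E) (1 : G) 1)).comp (ContinuousLinearMap.inr ℝ E E))
      (extChartAt 𝓘(ℝ, E) (1 : G) 1) := by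
    have h2 : ContDiffAt ℝ ∞ (fderiv ℝ (chartConj E G))
        (extChartAt 𝓘(ℝ, E) (1 : G) 1, extChartAt 𝓘(ℝ, E) (1 : G) 1) :=
      (contDiffAt_chartConj (mem_extChartAt_target 1)).fderiv_right (by simp)
    exact (ContDiffAt.comp (f := fun e => (e, extChartAt 𝓘(ℝ, E) (1 : G) 1))
      (extChartAt 𝓘(ℝ, E) (1 : G) 1) h2
      (contDiffAt_id.prodMk contDiffAt_const)).clm_comp contDiffAt_const
  refine h1.congr_of_eventuallyEq ?_
  filter_upwards [eventually_mem_target (E := E) (G := G)] with e he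
  exact adMap_chart he

/-- The adjoint representation is smooth. -/
lemma contMDiff_adMap : ContMDiff 𝓘(ℝ, E) 𝓘(ℝ, E →L[ℝ] E) ∞ (adMap E : G → E →L[ℝ] E) := by
  have h1 : ContMDiffAt 𝓘(ℝ, E) 𝓘(ℝ, E →L[ℝ] E) ∞ (adMap E : G → E →L[ℝ] E) 1 := by
    have h2 := ContMDiffAt.comp (1 : G) (contDiffAt_adMap_chart (E := E) (G := G)).contMDiffAt
      (contMDiffAt_extChart (1 : G) (mem_extChartAt_source 1))
    refine h2.congr_of_eventuallyEq ?_
    filter_upwards [extChartAt_source_mem_nhds (I := 𝓘(ℝ, E)) (1 : G)] with a ha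
    simp only [Function.comp]
    rw [(extChartAt 𝓘(ℝ, E) (1 : G)).left_inv ha]
  intro a
  -- Smoothness at 1 spreads to `a` through Ad b = Ad a ∘ Ad (a⁻¹ b).
  have h3 : ContMDiffAt 𝓘(ℝ, E) 𝓘(ℝ, E →L[ℝ] E) ∞ (fun b : G => adMap E (a⁻¹ * b)) a := by
    refine ContMDiffAt.comp (x := a) (g := adMap E) (f := fun b : G => a⁻¹ * b) ?_
      (contMDiffAt_mul_of contMDiffAt_const contMDiffAt_id)
    rwa [inv_mul_cancel]
  have h4 : (adMap E : G → E →L[ℝ] E) =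
      (ContinuousLinearMap.compL ℝ E E E (adMap E a)) ∘ fun b : G => adMap E (a⁻¹ * b) := by
    ext b X
    simp only [Function.comp, ContinuousLinearMap.compL_apply, ContinuousLinearMap.coe_comp]
    rw [← adMap_mul_apply, mul_inv_cancel_left]
  rw [h4]
  exact ContMDiffAt.comp a
    (ContinuousLinearMap.compL ℝ E E E (adMap E a)).contDiff.contMDiff.contMDiffAt h3

lemma contMDiff_adMap_apply (Y : E) :
    ContMDiff 𝓘(ℝ, E) 𝓘(ℝ, E) ∞ (fun a : G => adMap E a Y) :=
  (ContinuousLinearMap.apply ℝ E Y).contDiff.contMDiff.comp contMDiff_adMap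

/-- Differentiate (a b a⁻¹) a = a b in b at 1: right translation by a applied to Ad a Y is the
left-invariant field of Y at a. Then differentiate in a along X. The derivative of right translation
is a mixed second derivative of the product, equal by symmetry to the derivative of the
left-invariant field of X along Y. -/
lemma differential_adMap_eq_fderiv (X Y : E) :
    differential (V := E) (W := E) (fun a : G => adMap E a Y) 1 X =
      fderiv ℝ (leftField (chartMul E G) (extChartAt 𝓘(ℝ, E) (1 : G) 1) Y)
        (extChartAt 𝓘(ℝ, E) (1 : G) 1) X
      - fderiv ℝ (leftField (chartMul E G) (extChartAt 𝓘(ℝ, E) (1 : G) 1) X)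
        (extChartAt 𝓘(ℝ, E) (1 : G) 1) Y := by
  set κ := extChartAt 𝓘(ℝ, E) (1 : G) with hκ
  have hA : fderiv ℝ (fun e => adMap E (κ.symm e) Y) (κ 1) X =
      differential (V := E) (W := E) (fun a : G => adMap E a Y) 1 X := by
    rw [← fderiv_chart_eq_differential (x := (1 : G)) rfl ((contMDiff_adMap_apply Y).mdiff 1)]
    rfl
  rw [← hA]
  have hm : ContDiffAt ℝ ∞ (chartMul E G) (κ 1, κ 1) :=
    contDiffAt_chartMul (mem_extChartAt_target 1) (mem_extChartAt_target 1)
      (by simp only; rw [chart_symm_one, mul_one]; exact mem_extChartAt_source 1)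
  have hm2 : ContDiffAt ℝ 2 (chartMul E G) (κ 1, κ 1) := hm.of_le ENat.LEInfty.out
  have hmd := ((hm2.fderiv_right (m := 1) (by norm_num)).differentiableAt (by norm_num)).hasFDerivAt
  have hright : ∀ e ∈ κ.target, ∀ Z, fderiv ℝ (chartMul E G) (κ 1, e) (Z, 0) =
      fderiv ℝ (fun e' => chartMul E G (e', e)) (κ 1) Z := by
    intro e he Z
    have hd : HasFDerivAt (chartMul E G) (fderiv ℝ (chartMul E G) (κ 1, e))
        ((fun e' => (e', e)) (κ 1)) :=
      ((contDiffAt_chartMul (p := (κ 1, e)) (mem_extChartAt_target 1) he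
        (by simp only; rw [chart_symm_one, one_mul]; exact κ.map_target he)).differentiableAt
        (by simp)).hasFDerivAt
    have h2 : fderiv ℝ (fun e' => chartMul E G (e', e)) (κ 1) = _ :=
      (HasFDerivAt.comp (f := fun e' => (e', e)) (κ 1) hd
      (hasFDerivAt_prodMk_left (𝕜 := ℝ) (κ 1) e)).fderiv
    rw [h2]; simp
  have hkey : ∀ᶠ e in 𝓝 (κ 1), fderiv ℝ (chartMul E G) (κ 1, e) (adMap E (κ.symm e) Y, 0) =
      leftField (chartMul E G) (κ 1) Y e := by
    filter_upwards [eventually_mem_target (E := E) (G := G)] with e he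
    rw [adMap_chart he]
    have hc1 : chartConj E G (e, κ 1) = κ 1 := by
      change κ (κ.symm e * κ.symm (κ 1) * (κ.symm e)⁻¹) = κ 1
      rw [chart_symm_one, mul_one, mul_inv_cancel]
    have hd : HasFDerivAt (chartMul E G) (fderiv ℝ (chartMul E G) (κ 1, e))
        (chartConj E G (e, κ 1), e) := by
      rw [hc1]
      exact ((contDiffAt_chartMul (p := (κ 1, e)) (mem_extChartAt_target 1) he
        (by simp only; rw [chart_symm_one, one_mul]; exact κ.map_target he)).differentiableAt
        (by simp)).hasFDerivAt
    have hdc := ((contDiffAt_chartConj (G := G) he).differentiableAt (by simp)).hasFDerivAt.comp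
      (κ 1) (hasFDerivAt_prodMk_right (𝕜 := ℝ) e (κ 1))
    have h1 := HasFDerivAt.comp (f := fun e' => (chartConj E G (e, e'), e)) (κ 1) hd
      (hdc.prodMk (hasFDerivAt_const e (κ 1)))
    have hd' : HasFDerivAt (chartMul E G) (fderiv ℝ (chartMul E G) (e, κ 1))
        ((fun e' => (e, e')) (κ 1)) :=
      ((contDiffAt_chartMul (p := (e, κ 1)) he (mem_extChartAt_target 1)
        (by simp only; rw [chart_symm_one, mul_one]; exact κ.map_target he)).differentiableAt
        (by simp)).hasFDerivAt
    have h2 := HasFDerivAt.comp (f := fun e' => (e, e')) (κ 1) hd'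
      (hasFDerivAt_prodMk_right (𝕜 := ℝ) e (κ 1))
    have heq : (chartMul E G ∘ fun e' => (chartConj E G (e, e'), e)) =ᶠ[𝓝 (κ 1)]
        (chartMul E G ∘ fun e' => (e, e')) := by
      have hcont : ContinuousAt (fun e' => κ.symm e * κ.symm e' * (κ.symm e)⁻¹) (κ 1) := by
        have := ((contMDiff_conj (E := E) (κ.symm e)).continuous.continuousAt
          (x := κ.symm (κ 1))).comp (continuousAt_extChartAt_symm (I := 𝓘(ℝ, E)) (1 : G))
        exact this
      have hmem : κ.source ∈ 𝓝 (κ.symm e * κ.symm (κ 1) * (κ.symm e)⁻¹) := by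
        rw [chart_symm_one, mul_one, mul_inv_cancel]
        exact extChartAt_source_mem_nhds 1
      filter_upwards [hcont.preimage_mem_nhds hmem] with e' he'
      simp only [Function.comp, chartMul, chartConj]
      rw [κ.left_inv he', inv_mul_cancel_right]
    have h3 := heq.fderiv_eq (𝕜 := ℝ)
    rw [h1.fderiv, h2.fderiv] at h3
    have h4 := DFunLike.congr_fun h3 Y
    exact h4
  have ht : Tendsto (fun e : E => (κ 1, e)) (𝓝 (κ 1)) (𝓝 (κ 1, κ 1)) :=
    (Continuous.prodMk_right _).tendsto _
  have hAd : DifferentiableAt ℝ (fun e => adMap E (κ.symm e) Y) (κ 1) :=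
    ((contDiffAt_adMap_chart (E := E) (G := G)).clm_apply contDiffAt_const).differentiableAt
      (by simp)
  have hl : HasFDerivAt (fun e => fderiv ℝ (chartMul E G) (κ 1, e)) _ (κ 1) :=
    HasFDerivAt.comp (f := fun e => (κ 1, e)) (κ 1) hmd
      (hasFDerivAt_prodMk_right (𝕜 := ℝ) (κ 1) (κ 1))
  have hL := hl.clm_apply (((ContinuousLinearMap.inl ℝ E E).hasFDerivAt).comp (κ 1)
    hAd.hasFDerivAt)
  have hLf : ∀ Z : E, fderiv ℝ (leftField (chartMul E G) (κ 1) Z) (κ 1) =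
      ((fderiv ℝ (fderiv ℝ (chartMul E G)) (κ 1, κ 1)).comp
        (ContinuousLinearMap.inl ℝ E E)).flip ((0 : E), Z) := by
    intro Z
    have hr := HasFDerivAt.comp (f := fun e => (e, κ 1)) (κ 1) hmd
      (hasFDerivAt_prodMk_left (𝕜 := ℝ) (κ 1) (κ 1))
    have h2 : fderiv ℝ (leftField (chartMul E G) (κ 1) Z) (κ 1) = _ :=
      (hr.clm_apply (hasFDerivAt_const ((0 : E), Z) (κ 1))).fderiv
    rw [h2]; ext u; simp
  have hLeq : fderiv ℝ (fun e => fderiv ℝ (chartMul E G) (κ 1, e) (adMap E (κ.symm e) Y, 0))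
      (κ 1) = _ := hL.fderiv
  rw [Filter.EventuallyEq.fderiv_eq (𝕜 := ℝ) hkey] at hLeq
  have hZ : ∀ Z, fderiv ℝ (chartMul E G) (κ 1, κ 1) (Z, 0) = Z := by
    intro Z
    rw [hright _ (mem_extChartAt_target 1)]
    have : (fun e' => chartMul E G (e', κ 1)) =ᶠ[𝓝 (κ 1)] id := by
      filter_upwards [eventually_mem_target (E := E) (G := G)] with e he
      simp only [chartMul]
      rw [chart_symm_one, mul_one, κ.right_inv he, id]
    rw [this.fderiv_eq, fderiv_id]; rfl
  have h5 := DFunLike.congr_fun hLeq X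
  have hsymm := hm2.isSymmSndFDerivAt (by simp) ((0 : E), X) (Y, (0 : E))
  have h6 : fderiv ℝ (leftField (chartMul E G) (κ 1) X) (κ 1) Y =
      fderiv ℝ (fderiv ℝ (chartMul E G)) (κ 1, κ 1) (Y, 0) (0, X) := by
    rw [hLf]; simp
  have h7 : (adMap E (κ.symm (κ 1)) : E →L[ℝ] E) Y = Y := by
    rw [chart_symm_one, adMap_one_apply]
  refine eq_sub_of_add_eq ?_
  rw [h6, ← hsymm, h5]
  simp [h7, hZ]

/-- The derivative of `Ad` is `ad`. -/
lemma differential_adMap (X Y : GroupLieAlgebra 𝓘(ℝ, E) G) :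
    differential (V := E) (W := E) (fun a : G => adMap E a Y) 1 X = ⁅X, Y⁆ :=
  (differential_adMap_eq_fderiv (E := E) (G := G) X Y).trans (lie_eq_fderiv_leftField X Y).symm

/-- The derivative in b at 1 of Ad (a b a⁻¹) Ad a = Ad a Ad b. Once `differential_adMap` turns
derivatives of Ad into brackets, it says that Ad a is a Lie algebra automorphism. -/
lemma differential_adMap_conj (a : G) (X Y : E) :
    differential (V := E) (W := E) (fun b : G => adMap E b (adMap E a Y)) 1 (adMap E a X) =
      adMap E a (differential (V := E) (W := E) (fun b : G => adMap E b Y) 1 X) := by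
  have h1 := differential_comp_conj (V := E) (f := fun b : G => adMap E b (adMap E a Y))
    ((contMDiff_adMap_apply _).mdiff 1) a X
  have h2 := differential_comp_apply (V := E) (W := E) (U := E) (M := G) (g := adMap E a)
    (f := fun b : G => adMap E b Y) (x := 1) ((adMap E a).contDiff.contMDiff.mdiff _)
    ((contMDiff_adMap_apply _).mdiff 1) X
  have h3 : differential (V := E) (W := E) (adMap E a) (adMap E (1 : G) Y) = adMap E a := by
    rw [differential_eq_fderiv]; exact (adMap E a).fderiv
  rw [h3] at h2
  rw [← h1, ← h2]
  have h4 : (fun b : G => adMap E (a * b * a⁻¹) (adMap E a Y)) =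
      fun b => adMap E a (adMap E b Y) := by
    ext b
    rw [adMap_mul_apply, adMap_mul_apply, adMap_inv_apply]
  rw [h4]

lemma adjointRep_lie (a : G) (X Y : GroupLieAlgebra 𝓘(ℝ, E) G) :
    adjointRep E a ⁅X, Y⁆ = ⁅adjointRep E a X, adjointRep E a Y⁆ := by
  have h := differential_adMap_conj (E := E) a X Y
  have h1 : differential (V := E) (W := E) (fun b : G => adMap E b (adMap E a Y)) 1 (adMap E a X)
      = ⁅adjointRep E a X, adjointRep E a Y⁆ := differential_adMap _ _
  refine Eq.trans ?_ (h.symm.trans h1)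
  exact congrArg (adMap E a) (differential_adMap X Y).symm

variable [FiniteDimensional ℝ E]

/-- `Ad a` as an automorphism of the Lie algebra. -/
def adEquiv (a : G) : GroupLieAlgebra 𝓘(ℝ, E) G ≃ₗ⁅ℝ⁆ GroupLieAlgebra 𝓘(ℝ, E) G where
  toFun := adjointRep E a
  map_add' := (adMap E a).map_add
  map_smul' := (adMap E a).map_smul
  map_lie' := adjointRep_lie a _ _
  invFun := adjointRep E a⁻¹
  left_inv X := adMap_inv_apply (E := E) a X
  right_inv X := adMap_apply_inv (E := E) a X

lemma killingForm_adjointRep (a : G) (X Y : GroupLieAlgebra 𝓘(ℝ, E) G) :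
    killingForm ℝ (GroupLieAlgebra 𝓘(ℝ, E) G) (adjointRep E a X) (adjointRep E a Y) =
      killingForm ℝ (GroupLieAlgebra 𝓘(ℝ, E) G) X Y :=
  LieAlgebra.killingForm_of_equiv_apply (adEquiv a) X Y

end Adjoint

/-! ### Definiteness of the Killing form of a compact semisimple group -/

section CompactForm

/-- In a β-orthonormal basis, skewness of ad X turns -tr (ad X)² into the sum of the squared lengths
of the `⁅X, b i⁆`. It vanishes only if X is central, and the centre is zero. -/
lemma negForm_pos_of_skew {𝔤 : Type*} [LieRing 𝔤] [LieAlgebra ℝ 𝔤] [FiniteDimensional ℝ 𝔤]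
    [LieModule.IsFaithful ℝ 𝔤 𝔤]
    (β : LinearMap.BilinForm ℝ 𝔤) (hs : ∀ X Y, β X Y = β Y X) (hp : ∀ X, X ≠ 0 → 0 < β X X)
    (hskew : ∀ Z X Y : 𝔤, β ⁅Z, X⁆ Y + β X ⁅Z, Y⁆ = 0) (X : 𝔤) (hX : X ≠ 0) :
    0 < negForm 𝔤 X X := by
  obtain ⟨b, hb⟩ := exists_orthonormal_basis_of_pos β hs hp
  have h1 : negForm 𝔤 X X = ∑ i, β ⁅X, b i⁆ ⁅X, b i⁆ := by
    rw [negForm, LinearMap.neg_apply, LinearMap.neg_apply, killingForm_apply_apply,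
      trace_eq_sum_dual b (fun i => β (b i)) hb (fun v => by rw [b.span_eq]; trivial),
      ← Finset.sum_neg_distrib]
    refine Finset.sum_congr rfl fun i _ => ?_
    have := hskew X (b i) ⁅X, b i⁆
    simp only [LinearMap.comp_apply, LieAlgebra.ad_apply]
    linarith
  have h0 : ∀ Y, 0 ≤ β Y Y := fun Y => by
    by_cases hY : Y = 0
    · simp [hY]
    · exact (hp Y hY).le
  rw [h1]
  refine lt_of_le_of_ne (Finset.sum_nonneg fun i _ => h0 _) fun h => hX ?_
  have h2 := (Finset.sum_eq_zero_iff_of_nonneg fun i _ => h0 _).mp h.symm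
  have h3 : ∀ i, ⁅X, b i⁆ = 0 := fun i => by
    by_contra hne
    exact (hp _ hne).ne' (h2 i (Finset.mem_univ i))
  have h4 : LieAlgebra.ad ℝ 𝔤 X = 0 := b.ext fun i => by simp [h3]
  have h5 : X ∈ LieAlgebra.center ℝ 𝔤 := by
    refine (LieModule.mem_maxTrivSubmodule ℝ 𝔤 𝔤 X).mpr fun Y => ?_
    rw [← lie_skew, ← LieAlgebra.ad_apply ℝ 𝔤, h4, LinearMap.zero_apply, neg_zero]
  rw [LieAlgebra.center_eq_bot] at h5
  simpa using h5

variable {E : Type*} [NormedAddCommGroup E] [NormedSpace ℝ E] [FiniteDimensional ℝ E]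
  {G : Type*} [TopologicalSpace G] [ChartedSpace E G] [Group G] [LieGroup 𝓘(ℝ, E) ∞ G]

omit [FiniteDimensional ℝ E] in
/-- An `Ad`-invariant bilinear form is `ad`-invariant. -/
lemma skew_of_adMap_invariant (β : E →L[ℝ] E →L[ℝ] ℝ)
    (hβ : ∀ (a : G) (X Y : E), β (adMap E a X) (adMap E a Y) = β X Y) (Z X Y : E) :
    β (differential (V := E) (W := E) (fun a : G => adMap E a X) 1 Z) Y +
      β X (differential (V := E) (W := E) (fun a : G => adMap E a Y) 1 Z) = 0 := by
  set κ := extChartAt 𝓘(ℝ, E) (1 : G) with hκ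
  have hA : ∀ Y, HasFDerivAt (fun e => adMap E (κ.symm e) Y)
      (differential (V := E) (W := E) (fun a : G => adMap E a Y) 1) (κ 1) := by
    intro Y
    rw [← fderiv_chart_eq_differential (x := (1 : G)) rfl ((contMDiff_adMap_apply Y).mdiff 1)]
    exact (((contDiffAt_adMap_chart (E := E) (G := G)).clm_apply
      contDiffAt_const).differentiableAt (by simp)).hasFDerivAt
  have h1 := β.hasFDerivAt_of_bilinear (hA X) (hA Y)
  have h2 : HasFDerivAt (fun e => β (adMap E (κ.symm e) X) (adMap E (κ.symm e) Y))
      (0 : E →L[ℝ] ℝ) (κ 1) := by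
    simp only [hβ]; exact hasFDerivAt_const _ _
  have h3 := DFunLike.congr_fun (h1.unique h2) Z
  have h7 : ∀ Y, adMap E (κ.symm (κ 1)) Y = Y := fun Y => by
    rw [chart_symm_one, adMap_one_apply]
  simp only [add_apply, ContinuousLinearMap.precompR_apply, ContinuousLinearMap.compL_apply,
    ContinuousLinearMap.coe_comp, Function.comp_apply,
    ContinuousLinearMap.precompL_apply, h7, zero_apply] at h3
  linarith

variable (E G) in
/-- On a compact Lie group there is an `Ad`-invariant Euclidean product. -/
lemma exists_adMap_invariant_form [T2Space G] [CompactSpace G] :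
    ∃ β : LinearMap.BilinForm ℝ E, (∀ X Y, β X Y = β Y X) ∧ (∀ X, X ≠ 0 → 0 < β X X) ∧
      ∀ (a : G) (X Y : E), β (adMap E a X) (adMap E a Y) = β X Y := by
  have : IsTopologicalGroup G := topologicalGroup_of_lieGroup 𝓘(ℝ, E) ∞
  let : MeasurableSpace G := borel G
  have : BorelSpace G := ⟨rfl⟩
  let μ : MeasureTheory.Measure G := MeasureTheory.Measure.haar
  let T : E ≃L[ℝ] EuclideanSpace ℝ (Fin (Module.finrank ℝ E)) := toEuclidean
  -- Average over Haar measure of a Euclidean product pulled back by Ad a⁻¹. With the inverse, Ad b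
  -- is absorbed by the left translation a ↦ b a, which preserves the measure.
  let f : E → E → G → ℝ := fun X Y a => inner ℝ (T (adMap E a⁻¹ X)) (T (adMap E a⁻¹ Y))
  have hc : ∀ X : E, Continuous fun a : G => T (adMap E a⁻¹ X) := fun X =>
    T.continuous.comp ((contMDiff_adMap_apply X).continuous.comp continuous_inv)
  have hf : ∀ X Y, Continuous (f X Y) := fun X Y => (hc X).inner (hc Y)
  have hint : ∀ X Y, MeasureTheory.Integrable (f X Y) μ := fun X Y =>
    (hf X Y).integrable_of_hasCompactSupport (HasCompactSupport.of_compactSpace _)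
  refine ⟨LinearMap.mk₂ ℝ (fun X Y => ∫ a, f X Y a ∂μ) ?_ ?_ ?_ ?_, ?_, ?_, ?_⟩
  · intro X X' Y
    rw [← MeasureTheory.integral_add (hint _ _) (hint _ _)]
    simp [f, inner_add_left]
  · intro c X Y
    rw [smul_eq_mul, ← MeasureTheory.integral_const_mul]
    simp [f, inner_smul_left]
  · intro X Y Y'
    rw [← MeasureTheory.integral_add (hint _ _) (hint _ _)]
    simp [f, inner_add_right]
  · intro c X Y
    rw [smul_eq_mul, ← MeasureTheory.integral_const_mul]
    simp [f, inner_smul_right]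
  · intro X Y
    simp only [LinearMap.mk₂_apply, f]
    congr 1; ext a; exact real_inner_comm _ _
  · intro X hX
    simp only [LinearMap.mk₂_apply]
    refine (hf X X).integral_pos_of_hasCompactSupport_nonneg_nonzero
      (HasCompactSupport.of_compactSpace _) (fun a => real_inner_self_nonneg) (x := 1) ?_
    simp only [f, inv_one, adMap_one_apply]
    exact inner_self_ne_zero.mpr (by simpa using hX)
  · intro b X Y
    simp only [LinearMap.mk₂_apply]
    rw [← MeasureTheory.integral_mul_left_eq_self (μ := μ) (f (adMap E b X) (adMap E b Y)) b]
    congr 1; ext a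
    simp only [f, mul_inv_rev, adMap_mul_apply, adMap_inv_apply]

/-- Compactness provides an `Ad`-invariant inner product, whose infinitesimal invariance is the
skewness asked for in `negForm_pos_of_skew`; semisimplicity kills the centre. -/
theorem negForm_pos_of_compact [T2Space G] [CompactSpace G]
    [LieAlgebra.IsSemisimple ℝ (GroupLieAlgebra 𝓘(ℝ, E) G)]
    (X : GroupLieAlgebra 𝓘(ℝ, E) G) (hX : X ≠ 0) :
    0 < negForm (GroupLieAlgebra 𝓘(ℝ, E) G) X X := by
  obtain ⟨β, hs, hp, hβ⟩ := exists_adMap_invariant_form E G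
  let β' : E →L[ℝ] E →L[ℝ] ℝ :=
    LinearMap.toContinuousLinearMap (LinearMap.toContinuousLinearMap.toLinearMap ∘ₗ β)
  refine negForm_pos_of_skew (𝔤 := GroupLieAlgebra 𝓘(ℝ, E) G) β hs hp ?_ X hX
  intro Z X Y
  have h := skew_of_adMap_invariant (G := G) β' hβ Z X Y
  rwa [differential_adMap, differential_adMap] at h

end CompactForm

/-! ### Local sections of submersions and curves in their fibres -/

section Submersion

variable {E : Type*} [NormedAddCommGroup E] [NormedSpace ℝ E]
  {M : Type*} [TopologicalSpace M] [ChartedSpace E M]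
  {V : Type*} [NormedAddCommGroup V] [NormedSpace ℝ V]
  {N : Type*} [TopologicalSpace N] [ChartedSpace V N]

/-- Charts in which `f` is a linear projection `P`, with right inverse `Q`. -/
structure IsSubmersionChart (f : M → N) (a : M) (φ : OpenPartialHomeomorph M E)
    (ψ : OpenPartialHomeomorph N V) (P : E →L[ℝ] V) (Q : V →L[ℝ] E) : Prop where
  right_inv : ∀ v, P (Q v) = v
  mem_source : a ∈ φ.source
  mapsTo : ∀ b ∈ φ.source, f b ∈ ψ.source
  chart_eq : ∀ e ∈ φ.target, ψ (f (φ.symm e)) = P e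
  smooth : ∀ b ∈ φ.source, ContMDiffAt 𝓘(ℝ, E) 𝓘(ℝ, E) ∞ φ b
  smooth_symm : ∀ e ∈ φ.target, ContMDiffAt 𝓘(ℝ, E) 𝓘(ℝ, E) ∞ φ.symm e
  smooth_cod : ∀ y ∈ ψ.source, ContMDiffAt 𝓘(ℝ, V) 𝓘(ℝ, V) ∞ ψ y
  smooth_cod_symm : ∀ v ∈ ψ.target, ContMDiffAt 𝓘(ℝ, V) 𝓘(ℝ, V) ∞ ψ.symm v

lemma exists_isSubmersionChart {f : M → N} {a : M}
    (hf : Manifold.IsSubmersionAt 𝓘(ℝ, E) 𝓘(ℝ, V) ∞ f a) :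
    ∃ φ ψ P Q, IsSubmersionChart (E := E) (V := V) f a φ ψ P Q := by
  refine ⟨hf.domChart, hf.codChart,
    (ContinuousLinearMap.fst ℝ V hf.complement).comp (hf.equiv : E →L[ℝ] V × hf.complement),
    (hf.equiv.symm : V × hf.complement →L[ℝ] E).comp (ContinuousLinearMap.inl ℝ V _), ?_⟩
  constructor
  · intro v; simp
  · exact hf.mem_domChart_source
  · exact fun b hb => hf.source_subset_preimage_source hb
  · intro e he
    have he' : e ∈ (hf.domChart.extend 𝓘(ℝ, E)).target := by simpa using he
    have := hf.writtenInCharts he'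
    simpa using this
  · exact fun b hb => (contMDiffOn_of_mem_maximalAtlas hf.domChart_mem_maximalAtlas).contMDiffAt
      (hf.domChart.open_source.mem_nhds hb)
  · exact fun b hb => (contMDiffOn_symm_of_mem_maximalAtlas
      hf.domChart_mem_maximalAtlas).contMDiffAt (hf.domChart.open_target.mem_nhds hb)
  · exact fun b hb => (contMDiffOn_of_mem_maximalAtlas hf.codChart_mem_maximalAtlas).contMDiffAt
      (hf.codChart.open_source.mem_nhds hb)
  · exact fun b hb => (contMDiffOn_symm_of_mem_maximalAtlas
      hf.codChart_mem_maximalAtlas).contMDiffAt (hf.codChart.open_target.mem_nhds hb)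

/-- A submersion has smooth local sections. -/
lemma exists_local_section {f : M → N} {a : M}
    (hf : Manifold.IsSubmersionAt 𝓘(ℝ, E) 𝓘(ℝ, V) ∞ f a) :
    ∃ σ : N → M, σ (f a) = a ∧
      ∀ᶠ y in 𝓝 (f a), ContMDiffAt 𝓘(ℝ, V) 𝓘(ℝ, E) ∞ σ y ∧ f (σ y) = y := by
  obtain ⟨φ, ψ, P, Q, H⟩ := exists_isSubmersionChart hf
  have hfa := H.mapsTo a H.mem_source
  -- In the charts the section is the affine slice through φ a in the direction of the right inverse
  -- Q.
  let τ : N → E := fun y => φ a + Q (ψ y - ψ (f a))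
  have h0 : τ (f a) = φ a := by simp [τ]
  have hτ : ∀ y ∈ ψ.source, ContMDiffAt 𝓘(ℝ, V) 𝓘(ℝ, E) ∞ τ y := fun y hy => by
    have hg : ContDiff ℝ ∞ fun v => φ a + Q (v - ψ (f a)) :=
      contDiff_const.add (Q.contDiff.comp (contDiff_id.sub contDiff_const))
    exact ContMDiffAt.comp (x := y) (g := fun v => φ a + Q (v - ψ (f a)))
      hg.contMDiff.contMDiffAt (H.smooth_cod y hy)
  refine ⟨fun y => φ.symm (τ y), by simp only [h0]; exact φ.left_inv H.mem_source, ?_⟩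
  have h1 : ∀ᶠ y in 𝓝 (f a), τ y ∈ φ.target :=
    (hτ _ hfa).continuousAt.preimage_mem_nhds
      (by rw [h0]; exact φ.open_target.mem_nhds (φ.map_source H.mem_source))
  filter_upwards [h1, ψ.open_source.mem_nhds hfa] with y hy hyψ
  refine ⟨ContMDiffAt.comp (x := y) (H.smooth_symm _ hy) (hτ y hyψ), ?_⟩
  have h2 : ψ (f (φ.symm (τ y))) = ψ y := by
    rw [H.chart_eq _ hy]
    have h3 : P (φ a) = ψ (f a) := by
      rw [← H.chart_eq _ (φ.map_source H.mem_source), φ.left_inv H.mem_source]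
    simp [τ, h3, H.right_inv]
  exact ψ.injOn (H.mapsTo _ (φ.map_target hy)) hyψ h2

lemma contMDiffAt_of_submersion {f : M → N}
    (hf : Manifold.IsSubmersion 𝓘(ℝ, E) 𝓘(ℝ, V) ∞ f) (x : M) :
    ContMDiffAt 𝓘(ℝ, E) 𝓘(ℝ, V) ∞ f x := hf.contMDiff x

lemma differential_surjective_of_submersion {f : M → N}
    (hf : Manifold.IsSubmersion 𝓘(ℝ, E) 𝓘(ℝ, V) ∞ f) (a : M) :
    Function.Surjective (differential (V := E) (W := V) f a) := by
  obtain ⟨σ, hσ, h⟩ := exists_local_section (hf.isSubmersionAt a)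
  intro v
  refine ⟨differential (V := V) (W := E) σ (f a) v, ?_⟩
  have h1 := differential_comp_apply (V := V) (W := E) (U := V) (g := f) (f := σ) (x := f a)
    (by rw [hσ]; exact (contMDiffAt_of_submersion hf a).mdiff) h.self_of_nhds.1.mdiff v
  rw [hσ] at h1
  rw [← h1, differential_congr (h.mono fun y hy => hy.2), differential_id]
  rfl

/-- A map out of the target of a surjective submersion is smooth if it is upstairs. -/
lemma contMDiffAt_of_comp_submersion {f : M → N}
    (hf : Manifold.IsSubmersion 𝓘(ℝ, E) 𝓘(ℝ, V) ∞ f)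
    {U P : Type*} [NormedAddCommGroup U] [NormedSpace ℝ U] [TopologicalSpace P] [ChartedSpace U P]
    {g : N → P} {a : M} (hg : ContMDiffAt 𝓘(ℝ, E) 𝓘(ℝ, U) ∞ (fun b => g (f b)) a) :
    ContMDiffAt 𝓘(ℝ, V) 𝓘(ℝ, U) ∞ g (f a) := by
  obtain ⟨σ, hσ, h⟩ := exists_local_section (hf.isSubmersionAt a)
  have h1 : ContMDiffAt 𝓘(ℝ, V) 𝓘(ℝ, U) ∞ (fun y => g (f (σ y))) (f a) :=
    ContMDiffAt.comp (x := f a) (g := fun b => g (f b)) (f := σ) (by rwa [hσ])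
      h.self_of_nhds.1
  refine h1.congr_of_eventuallyEq ?_
  filter_upwards [h] with y hy
  rw [hy.2]

/-- Vectors in the kernel of the differential of a submersion are velocities of curves in the
fibre. -/
lemma exists_curve_of_differential_eq_zero {f : M → N}
    (hf : Manifold.IsSubmersion 𝓘(ℝ, E) 𝓘(ℝ, V) ∞ f) (a : M) (X : E)
    (hX : differential (V := E) (W := V) f a X = 0) :
    ∃ c : ℝ → M, (∀ t, f (c t) = f a) ∧ c 0 = a ∧ ContMDiffAt 𝓘(ℝ, ℝ) 𝓘(ℝ, E) ∞ c 0 ∧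
      differential (V := ℝ) (W := E) c 0 1 = X := by
  obtain ⟨φ, ψ, P, Q, H⟩ := exists_isSubmersionChart (hf.isSubmersionAt a)
  have hta := φ.map_source H.mem_source
  have hfa := H.mapsTo a H.mem_source
  set v := differential (V := E) (W := E) φ a X with hv
  have hPv : P v = 0 := by
    have h1 : (fun b => ψ (f b)) =ᶠ[𝓝 a] fun b => P (φ b) := by
      filter_upwards [φ.open_source.mem_nhds H.mem_source] with b hb
      rw [← H.chart_eq _ (φ.map_source hb), φ.left_inv hb]
    have h2 := differential_comp_apply (V := E) (W := V) (U := V) (g := ψ) (f := f) (x := a)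
      (H.smooth_cod _ hfa).mdiff (contMDiffAt_of_submersion hf a).mdiff X
    rw [differential_congr h1, hX, map_zero,
      differential_comp_apply (V := E) (W := E) (U := V) (g := P) (P.contDiff.contMDiff.mdiff _)
      (H.smooth a H.mem_source).mdiff, differential_eq_fderiv, P.fderiv] at h2
    exact h2
  let c : ℝ → M := fun t => φ.symm (φ a + t • v)
  have hc0 : c 0 = a := by simp [c, φ.left_inv H.mem_source]
  have hlin : ContDiff ℝ ∞ fun t : ℝ => φ a + t • v :=
    contDiff_const.add (contDiff_id.smul contDiff_const)
  have h00 : φ a + (0 : ℝ) • v = φ a := by simp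
  have hcs : ContMDiffAt 𝓘(ℝ, ℝ) 𝓘(ℝ, E) ∞ c 0 :=
    ContMDiffAt.comp (x := 0) (g := φ.symm) (f := fun t : ℝ => φ a + t • v)
      (H.smooth_symm _ (by rwa [h00])) hlin.contMDiff.contMDiffAt
  have hfc : ∀ᶠ t in 𝓝 (0 : ℝ), f (c t) = f a := by
    have : ∀ᶠ t in 𝓝 (0 : ℝ), φ a + t • v ∈ φ.target :=
      hlin.continuous.continuousAt.preimage_mem_nhds
        (by rw [h00]; exact φ.open_target.mem_nhds hta)
    filter_upwards [this] with t ht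
    refine ψ.injOn (H.mapsTo _ (φ.map_target ht)) hfa ?_
    rw [H.chart_eq _ ht, map_add, map_smul, hPv, smul_zero, add_zero, ← H.chart_eq _ hta,
      φ.left_inv H.mem_source]
  classical
  -- The straight line in the chart is controlled only near time 0. Elsewhere it is replaced by the
  -- constant a, so that the curve stays in the fibre at all times; smoothness is asked only at 0.
  have heq : (fun t => if f (c t) = f a then c t else a) =ᶠ[𝓝 0] c := by
    filter_upwards [hfc] with t ht
    rw [if_pos ht]
  refine ⟨fun t => if f (c t) = f a then c t else a, fun t => ?_, ?_,
    hcs.congr_of_eventuallyEq heq, ?_⟩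
  · dsimp only; split_ifs with h
    · exact h
    · rfl
  · simp [hc0]
  · rw [differential_congr heq, differential_comp_apply (V := ℝ) (W := E) (U := E) (g := φ.symm)
      (f := fun t : ℝ => φ a + t • v) (H.smooth_symm _ (by rwa [h00])).mdiff
      (hlin.contMDiff.mdiff 0), differential_eq_fderiv]
    have h3 : fderiv ℝ (fun t : ℝ => φ a + t • v) 0 1 = v := by
      have : HasDerivAt (fun t : ℝ => φ a + t • v) v 0 := by
        simpa using ((hasDerivAt_id (0 : ℝ)).smul_const v).const_add (φ a)
      rw [fderiv_apply_one_eq_deriv]; exact this.deriv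
    rw [h3, h00, hv, ← differential_comp_apply (V := E) (W := E) (U := E) (g := φ.symm) (f := φ)
      (H.smooth_symm _ hta).mdiff (H.smooth a H.mem_source).mdiff]
    have h4 : (fun y => φ.symm (φ y)) =ᶠ[𝓝 a] fun y => y := by
      filter_upwards [φ.open_source.mem_nhds H.mem_source] with b hb
      exact φ.left_inv hb
    rw [differential_congr h4, differential_id]; rfl

/-- Points of a fibre near `a` are joined to `a` by smooth curves in the fibre. -/
lemma eventually_exists_curve {f : M → N}
    (hf : Manifold.IsSubmersion 𝓘(ℝ, E) 𝓘(ℝ, V) ∞ f) (a : M) :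
    ∀ᶠ b in 𝓝 a, f b = f a → ∃ c : ℝ → M, c 0 = a ∧ c 1 = b ∧ ∀ t ∈ Set.Icc (0 : ℝ) 1,
      ContMDiffAt 𝓘(ℝ, ℝ) 𝓘(ℝ, E) ∞ c t ∧ ∀ᶠ s in 𝓝 t, f (c s) = f a := by
  obtain ⟨φ, ψ, P, Q, H⟩ := exists_isSubmersionChart (hf.isSubmersionAt a)
  have hta := φ.map_source H.mem_source
  have hfa := H.mapsTo a H.mem_source
  -- A ball is convex, so the segment from φ a to φ b stays in the chart, and the linear projection
  -- is constant along it.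
  obtain ⟨r, hr, hball⟩ := Metric.isOpen_iff.mp φ.open_target _ hta
  have h1 : ∀ᶠ b in 𝓝 a, φ b ∈ Metric.ball (φ a) r :=
    (φ.continuousAt H.mem_source).preimage_mem_nhds (Metric.ball_mem_nhds _ hr)
  filter_upwards [h1, φ.open_source.mem_nhds H.mem_source] with b hb hbs hfb
  have hlin : ContDiff ℝ ∞ fun t : ℝ => φ a + t • (φ b - φ a) :=
    contDiff_const.add (contDiff_id.smul contDiff_const)
  have hPe : ∀ d ∈ φ.source, P (φ d) = ψ (f d) := fun d hd => by
    rw [← H.chart_eq _ (φ.map_source hd), φ.left_inv hd]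
  have hPv : P (φ b - φ a) = 0 := by
    rw [map_sub, hPe b hbs, hPe a H.mem_source, hfb, sub_self]
  refine ⟨fun t => φ.symm (φ a + t • (φ b - φ a)), by simp [φ.left_inv H.mem_source],
    by simp [φ.left_inv hbs], fun t ht => ?_⟩
  have hmem : φ a + t • (φ b - φ a) ∈ φ.target := by
    refine hball ?_
    exact (convex_ball (φ a) r).add_smul_sub_mem (Metric.mem_ball_self hr) hb ht
  refine ⟨ContMDiffAt.comp (x := t) (g := φ.symm) (H.smooth_symm _ hmem)
    hlin.contMDiff.contMDiffAt, ?_⟩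
  have : ∀ᶠ s in 𝓝 t, φ a + s • (φ b - φ a) ∈ φ.target :=
    hlin.continuous.continuousAt.preimage_mem_nhds (φ.open_target.mem_nhds hmem)
  filter_upwards [this] with s hs
  refine ψ.injOn (H.mapsTo _ (φ.map_target hs)) hfa ?_
  rw [H.chart_eq _ hs, map_add, map_smul, hPv, smul_zero, add_zero, hPe a H.mem_source]

end Submersion

/-! ### Orbit maps and the Lie algebra of a closed subgroup -/

section HomogeneousSpace

variable {E : Type*} [NormedAddCommGroup E] [NormedSpace ℝ E]
  {G : Type*} [TopologicalSpace G] [ChartedSpace E G] [Group G] [LieGroup 𝓘(ℝ, E) ∞ G]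
  {H : Subgroup G}
  {V : Type*} [NormedAddCommGroup V] [NormedSpace ℝ V] [ChartedSpace V (G ⧸ H)]

variable (E H V) in
/-- The differential at `1` of the orbit map `b ↦ (a * b) H` of the coset `a H`, for the action of
`G` conjugated by `a`. -/
def orbitMap (a : G) : E →L[ℝ] V :=
  differential (V := E) (W := V) (fun b : G => ((a * b : G) : G ⧸ H)) 1

section

variable (hH : Manifold.IsSubmersion 𝓘(ℝ, E) 𝓘(ℝ, V) ∞ (QuotientGroup.mk : G → G ⧸ H))

include hH

omit [LieGroup 𝓘(ℝ, E) ∞ G] in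
lemma contMDiffAt_mk (a : G) : ContMDiffAt 𝓘(ℝ, E) 𝓘(ℝ, V) ∞ (QuotientGroup.mk : G → G ⧸ H) a :=
  contMDiffAt_of_submersion hH a

lemma contMDiffAt_orbit (a b : G) :
    ContMDiffAt 𝓘(ℝ, E) 𝓘(ℝ, V) ∞ (fun b : G => ((a * b : G) : G ⧸ H)) b :=
  ContMDiffAt.comp (x := b) (I' := 𝓘(ℝ, E)) (g := (QuotientGroup.mk : G → G ⧸ H))
    (contMDiffAt_mk hH _)
    (contMDiffAt_mul_of contMDiffAt_const contMDiffAt_id)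

/-- The translations of `G ⧸ H` are smooth. -/
lemma contMDiffAt_smul (a : G) (x : G ⧸ H) :
    ContMDiffAt 𝓘(ℝ, V) 𝓘(ℝ, V) ∞ (fun y : G ⧸ H => a • y) x := by
  refine QuotientGroup.induction_on x fun b => ?_
  exact contMDiffAt_of_comp_submersion (E := E) (V := V) (U := V) hH
    (g := fun y : G ⧸ H => a • y) (contMDiffAt_orbit hH a b)

lemma differential_smul_orbitMap (a b : G) (X : E) :
    differential (V := V) (W := V) (fun y : G ⧸ H => a • y) ((b : G) : G ⧸ H) (orbitMap E H V b X) =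
      orbitMap E H V (a * b) X := by
  have h := differential_comp_apply (V := E) (W := V) (U := V) (g := fun y : G ⧸ H => a • y)
    (f := fun c : G => ((b * c : G) : G ⧸ H)) (x := 1)
    (contMDiffAt_smul hH a _).mdiff (contMDiffAt_orbit hH b 1).mdiff X
  rw [mul_one] at h
  rw [orbitMap, ← h, orbitMap]
  congr 2
  ext c
  rw [mul_assoc]; rfl

omit [LieGroup 𝓘(ℝ, E) ∞ G] hH in
lemma orbitMap_one : orbitMap E H V (1 : G) =
    differential (V := E) (W := V) (QuotientGroup.mk : G → G ⧸ H) 1 := by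
  simp [orbitMap]

lemma orbitMap_surjective (a : G) : Function.Surjective (orbitMap E H V a) := by
  have h1 := differential_surjective_of_submersion hH 1
  intro v
  obtain ⟨X, hX⟩ := h1 (differential (V := V) (W := V) (fun y : G ⧸ H => a⁻¹ • y)
    ((a : G) : G ⧸ H) v)
  refine ⟨X, ?_⟩
  have h2 := differential_smul_orbitMap hH a 1 X
  rw [mul_one] at h2
  rw [← h2, orbitMap_one, hX]
  have h3 := differential_comp_apply (V := V) (W := V) (U := V) (g := fun y : G ⧸ H => a • y)
    (f := fun y : G ⧸ H => a⁻¹ • y) (x := ((a : G) : G ⧸ H))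
    (contMDiffAt_smul hH a _).mdiff (contMDiffAt_smul hH a⁻¹ _).mdiff v
  have h4 : a⁻¹ • ((a : G) : G ⧸ H) = ((1 : G) : G ⧸ H) := by
    rw [← inv_mul_cancel a]; rfl
  rw [h4] at h3
  rw [← h3]
  simp only [smul_inv_smul]
  rw [differential_id]; rfl

/-- For k in H the cosets of a k b and of a (k b k⁻¹) agree. Changing the representative of a coset
thus changes the frame by Ad k, which is why `Ad H`-invariance is the condition for a form to
descend. -/
lemma orbitMap_mul_mem (a : G) {k : G} (hk : k ∈ H) (X : E) :
    orbitMap E H V (a * k) X = orbitMap E H V a (adMap E k X) := by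
  have h := differential_comp_conj (V := V) (f := fun b : G => ((a * b : G) : G ⧸ H))
    (contMDiffAt_orbit hH a 1).mdiff k X
  rw [orbitMap, orbitMap, ← h]
  congr 2
  ext b
  rw [QuotientGroup.eq]
  have : (a * k * b)⁻¹ * (a * (k * b * k⁻¹)) = k⁻¹ := by group
  rw [this]
  exact H.inv_mem hk

lemma orbitMap_eq_zero_iff (a : G) (X : E) :
    orbitMap E H V a X = 0 ↔ orbitMap E H V (1 : G) X = 0 := by
  constructor
  · intro h
    have := differential_smul_orbitMap hH a⁻¹ a X
    rw [h, map_zero, inv_mul_cancel] at this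
    exact this.symm
  · intro h
    have := differential_smul_orbitMap hH a 1 X
    rw [h, map_zero, mul_one] at this
    exact this.symm

lemma orbitMap_adMap_eq_zero {k : G} (hk : k ∈ H) (X : E) (hX : orbitMap E H V (1 : G) X = 0) :
    orbitMap E H V (1 : G) (adMap E k X) = 0 := by
  rw [← orbitMap_mul_mem hH 1 hk, one_mul, orbitMap_eq_zero_iff hH, hX]

omit [LieGroup 𝓘(ℝ, E) ∞ G] in
/-- The Lie algebra of `H` is the kernel of the differential of the projection. -/
lemma mem_lieAlgebraOf_iff (X : GroupLieAlgebra 𝓘(ℝ, E) G) :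
    X ∈ lieAlgebraOf E H ↔ orbitMap E H V (1 : G) X = 0 := by
  rw [orbitMap_one]
  constructor
  · intro hX
    let D : GroupLieAlgebra 𝓘(ℝ, E) G →ₗ[ℝ] V :=
      (differential (V := E) (W := V) (QuotientGroup.mk : G → G ⧸ H) 1 : E →ₗ[ℝ] V)
    have : lieAlgebraOf E H ≤ LinearMap.ker D := by
      refine Submodule.span_le.mpr ?_
      rintro X ⟨c, hc, hc0, hcs, rfl⟩
      have h := differential_comp_apply (V := ℝ) (W := E) (U := V)
        (g := (QuotientGroup.mk : G → G ⧸ H)) (f := c) (x := 0)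
        (contMDiffAt_mk hH _).mdiff hcs.mdiff 1
      have h1 : (fun t => (QuotientGroup.mk (c t) : G ⧸ H)) = fun _ => ((1 : G) : G ⧸ H) := by
        ext t
        rw [QuotientGroup.eq]; simpa using hc t
      rw [h1, differential_const, hc0] at h
      exact h.symm
    exact this hX
  · intro hX
    obtain ⟨c, hc, hc0, hcs, hcX⟩ := exists_curve_of_differential_eq_zero hH 1 X hX
    refine Submodule.subset_span ⟨c, fun t => ?_, hc0, hcs, hcX⟩
    simpa using QuotientGroup.eq.mp (hc t).symm

lemma isAdInvariant_lieAlgebraOf : IsAdInvariant H (lieAlgebraOf E H) := by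
  intro k hk X hX
  rw [mem_lieAlgebraOf_iff hH] at hX ⊢
  exact orbitMap_adMap_eq_zero hH hk X hX

/-- Derivative of `Ad` along a curve in `H`. -/
lemma differential_adMap_curve {c : ℝ → G} {t : ℝ}
    (hc : ContMDiffAt 𝓘(ℝ, ℝ) 𝓘(ℝ, E) ∞ c t)
    (hcH : ∀ᶠ s in 𝓝 t, (QuotientGroup.mk (c s) : G ⧸ H) = QuotientGroup.mk (c t)) :
    ∃ X ∈ lieAlgebraOf E H, ∀ Y : E, HasDerivAt (fun s => adMap E (c s) Y)
      (adMap E (c t) (differential (V := E) (W := E) (fun b : G => adMap E b Y) 1 X)) t := by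
  have hd : ContMDiffAt 𝓘(ℝ, ℝ) 𝓘(ℝ, E) ∞ (fun s => (c t)⁻¹ * c s) t :=
    contMDiffAt_mul_of contMDiffAt_const hc
  have h0 : (c t)⁻¹ * c t = 1 := inv_mul_cancel _
  refine ⟨differential (V := ℝ) (W := E) (fun s => (c t)⁻¹ * c s) t 1, ?_, fun Y => ?_⟩
  · refine (mem_lieAlgebraOf_iff hH _).mpr ?_
    rw [orbitMap_one]
    have h := differential_comp_apply (V := ℝ) (W := E) (U := V)
      (g := (QuotientGroup.mk : G → G ⧸ H)) (f := fun s => (c t)⁻¹ * c s) (x := t)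
      (contMDiffAt_mk hH _).mdiff hd.mdiff 1
    have h1 : (fun s => (QuotientGroup.mk ((c t)⁻¹ * c s) : G ⧸ H)) =ᶠ[𝓝 t]
        fun _ => ((1 : G) : G ⧸ H) := by
      filter_upwards [hcH] with s hs
      have := QuotientGroup.eq.mp hs.symm
      rw [eq_comm, QuotientGroup.eq]; simpa using this
    rw [differential_congr h1, differential_const, h0] at h
    exact h.symm
  · have h := differential_comp_apply (V := ℝ) (W := E) (U := E) (g := fun b : G => adMap E b Y)
      (f := fun s => (c t)⁻¹ * c s) (x := t) ((contMDiff_adMap_apply Y).mdiff _) hd.mdiff 1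
    rw [h0] at h
    have hs : ContMDiffAt 𝓘(ℝ, ℝ) 𝓘(ℝ, E) ∞ (fun s => adMap E ((c t)⁻¹ * c s) Y) t :=
      ContMDiffAt.comp (x := t) (g := fun b : G => adMap E b Y)
        (contMDiff_adMap_apply Y).contMDiffAt hd
    have h2 : HasDerivAt (fun s => adMap E ((c t)⁻¹ * c s) Y)
        (differential (V := E) (W := E) (fun b : G => adMap E b Y) 1
          (differential (V := ℝ) (W := E) (fun s => (c t)⁻¹ * c s) t 1)) t := by
      rw [← h, differential_eq_fderiv, fderiv_apply_one_eq_deriv]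
      exact (hs.contDiffAt.differentiableAt (by simp)).hasDerivAt
    have h3 := (adMap E (c t)).hasFDerivAt.comp_hasDerivAt t h2
    refine h3.congr_of_eventuallyEq (Eventually.of_forall fun s => ?_)
    simp only [Function.comp]
    rw [← adMap_mul_apply, mul_inv_cancel_left]

/-- An `Ad H`-submodule is stable under the Lie algebra of `H`. -/
lemma lie_mem_of_isAdInvariant [FiniteDimensional ℝ E]
    {U : Submodule ℝ (GroupLieAlgebra 𝓘(ℝ, E) G)} (hU : IsAdInvariant H U)
    {X Y : GroupLieAlgebra 𝓘(ℝ, E) G} (hX : X ∈ lieAlgebraOf E H) (hY : Y ∈ U) : ⁅X, Y⁆ ∈ U := by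
  rw [mem_lieAlgebraOf_iff hH, orbitMap_one] at hX
  obtain ⟨c, hc, hc0, hcs, hcX⟩ := exists_curve_of_differential_eq_zero hH 1 X hX
  have h := differential_comp_apply (V := ℝ) (W := E) (U := E) (g := fun b : G => adMap E b Y)
      (f := c) (x := 0) ((contMDiff_adMap_apply _).mdiff _) hcs.mdiff 1
  rw [hc0, hcX] at h
  have h1 : differential (V := E) (W := E) (fun b : G => adMap E b Y) 1 X = ⁅X, Y⁆ :=
    differential_adMap X Y
  let U' : Submodule ℝ E := U
  -- The bracket is a limit of difference quotients of Ad along a curve in H. They lie in U, which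
  -- is closed because it is finite-dimensional.
  have hcl : IsClosed (U' : Set E) := U'.closed_of_finiteDimensional
  have hs : ContMDiffAt 𝓘(ℝ, ℝ) 𝓘(ℝ, E) ∞ (fun s => adMap E (c s) Y) 0 :=
    ContMDiffAt.comp (x := 0) (g := fun b : G => adMap E b Y)
      (contMDiff_adMap_apply _).contMDiffAt hcs
  have h2 : HasDerivAt (fun s => adMap E (c s) Y)
      (differential (V := E) (W := E) (fun b : G => adMap E b Y) 1 X) 0 := by
    rw [← h, differential_eq_fderiv, fderiv_apply_one_eq_deriv]
    exact (hs.contDiffAt.differentiableAt (by simp)).hasDerivAt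
  have h3 : differential (V := E) (W := E) (fun b : G => adMap E b Y) 1 X ∈ U' := by
    have hmem : ∀ t, adMap E (c t) Y ∈ U' := fun t =>
      hU (c t) (by simpa using QuotientGroup.eq.mp (hc t).symm) Y hY
    refine hcl.mem_of_tendsto h2.tendsto_slope_zero (Eventually.of_forall fun t => ?_)
    exact U'.smul_mem _ (U'.sub_mem (hmem _) (hmem _))
  rwa [h1] at h3

/-- Elements of H near 1 are joined to 1 by a smooth curve in H, along which Ad Y has zero
derivative and is constant. So the stabiliser of Y in H is an open subgroup of a connected group. -/
lemma adMap_eq_self_of_differential_eq_zero (hconn : IsConnected (H : Set G)) (Y : E)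
    (hY : ∀ X ∈ lieAlgebraOf E H,
      differential (V := E) (W := E) (fun b : G => adMap E b Y) 1 X = 0)
    {k : G} (hk : k ∈ H) : adMap E k Y = Y := by
  have hcurve : ∀ᶠ b in 𝓝 (1 : G), b ∈ H → adMap E b Y = Y := by
    filter_upwards [eventually_exists_curve hH 1] with b hb hbH
    obtain ⟨c, hc0, hc1, hc⟩ := hb (by rw [eq_comm, QuotientGroup.eq]; simpa using hbH)
    have hder : ∀ t ∈ Set.Icc (0 : ℝ) 1, HasDerivAt (fun s => adMap E (c s) Y) 0 t := by
      intro t ht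
      obtain ⟨X, hX, h⟩ := differential_adMap_curve hH (hc t ht).1 (by
        filter_upwards [(hc t ht).2] with s hs
        rw [hs, (hc t ht).2.self_of_nhds])
      have h2 := h Y
      rwa [hY X hX, map_zero] at h2
    have := constant_of_has_deriv_right_zero (f := fun s => adMap E (c s) Y)
      (fun t ht => (hder t ht).continuousAt.continuousWithinAt)
      (fun t ht => (hder t ⟨ht.1, ht.2.le⟩).hasDerivWithinAt) 1 (by simp)
    rw [hc0, hc1, adMap_one_apply] at this
    exact this
  have hpre : IsPreconnected (H : Set G) := hconn.isPreconnected
  have : IsTopologicalGroup G := topologicalGroup_of_lieGroup 𝓘(ℝ, E) ∞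
  have hPC : PreconnectedSpace H := isPreconnected_iff_preconnectedSpace.mp hpre
  let S : Subgroup H :=
    { carrier := {b | adMap E (b : G) Y = Y}
      mul_mem' := fun {a b} ha hb => by
        change adMap E ((a : G) * b) Y = Y
        rw [adMap_mul_apply, hb, ha]
      one_mem' := adMap_one_apply (E := E) (G := G) Y
      inv_mem' := fun {a} ha => by
        change adMap E (a : G)⁻¹ Y = Y
        conv_lhs => rw [← show adMap E (a : G) Y = Y from ha]
        rw [adMap_inv_apply] }
  have hS : IsOpen (S : Set H) := by
    refine S.isOpen_of_mem_nhds (g := 1) ?_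
    have : Tendsto (fun b : H => (b : G)) (𝓝 1) (𝓝 1) := continuous_subtype_val.tendsto 1
    filter_upwards [this.eventually hcurve] with b hb
    exact hb b.2
  have htop : S = ⊤ := by
    have hclopen : IsClopen (S : Set H) := ⟨S.isClosed_of_isOpen hS, hS⟩
    have := hclopen.eq_univ ⟨1, S.one_mem⟩
    exact SetLike.coe_injective (by simpa using this)
  have : (⟨k, hk⟩ : H) ∈ S := by rw [htop]; trivial
  exact this

/-- If `H` is connected, then vectors killed by the Lie algebra of `H` are fixed by `Ad H`. -/
lemma adjointRep_eq_self_of_lie_eq_zero (hconn : IsConnected (H : Set G))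
    (Y : GroupLieAlgebra 𝓘(ℝ, E) G) (hY : ∀ X ∈ lieAlgebraOf E H, ⁅X, Y⁆ = 0) {k : G}
    (hk : k ∈ H) : adjointRep E k Y = Y :=
  adMap_eq_self_of_differential_eq_zero (E := E) hH hconn Y
    (fun X hX => (differential_adMap X Y).trans (hY X hX)) hk

end

end HomogeneousSpace

/-! ### Riemannian metrics and their coefficients in charts -/

section MetricCoefficients

variable {V : Type*} [NormedAddCommGroup V] [NormedSpace ℝ V]
  {M : Type*} [TopologicalSpace M] [ChartedSpace V M] [IsManifold 𝓘(ℝ, V) ∞ M]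

/-- A field of bilinear forms, in the preferred chart at `x`. -/
def formCoeff (b : M → V →L[ℝ] V →L[ℝ] ℝ) (x : M) (y : V) : V →L[ℝ] V →L[ℝ] ℝ :=
  (b ((extChartAt 𝓘(ℝ, V) x).symm y)).bilinearComp
    (differential (extChartAt 𝓘(ℝ, V) x).symm y) (differential (extChartAt 𝓘(ℝ, V) x).symm y)

lemma inCoordinates_eq_formCoeff (b : M → V →L[ℝ] V →L[ℝ] ℝ) {x₀ x : M}
    (hx : x ∈ (extChartAt 𝓘(ℝ, V) x₀).source) :
    ContinuousLinearMap.inCoordinates V (TangentSpace 𝓘(ℝ, V) : M → Type _) (V →L[ℝ] ℝ)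
      (fun x : M => TangentSpace 𝓘(ℝ, V) x →L[ℝ] ℝ) x₀ x x₀ x (b x) =
      formCoeff b x₀ (extChartAt 𝓘(ℝ, V) x₀ x) := by
  have hx' : x ∈ (chartAt V x₀).source := by simpa using hx
  have hb : x ∈ (trivializationAt V (TangentSpace 𝓘(ℝ, V) : M → Type _) x₀).baseSet := by
    simpa using hx'
  ext u w
  refine (inCoordinates_apply_eq₂ (𝕜 := ℝ) (E₃ := fun _ : M => ℝ) (F₃ := ℝ) hb hb
    (Set.mem_univ _)).trans ?_
  have h := TangentBundle.symmL_trivializationAt (𝕜 := ℝ) (I := 𝓘(ℝ, V)) hx'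
  simp only [modelWithCornersSelf_coe, Set.range_id, mfderivWithin_univ] at h
  have h1 : ∀ u : V, (trivializationAt V (TangentSpace 𝓘(ℝ, V) : M → Type _) x₀).symm x u =
      differential (V := V) (W := V) (extChartAt 𝓘(ℝ, V) x₀).symm (extChartAt 𝓘(ℝ, V) x₀ x) u := by
    intro u
    exact (Trivialization.symmL_apply (R := ℝ) (hb := hb) ..).symm.trans (DFunLike.congr_fun h u)
  have h2 := (extChartAt 𝓘(ℝ, V) x₀).left_inv hx
  simp only [formCoeff, ContinuousLinearMap.bilinearComp_apply, h2]
  rw [h1, h1]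
  simp
  rfl

/-- Near x₀ the trivialisation of the bundle of forms is the pull-back by the inverse chart, so that
smoothness of the section is smoothness of its coefficients. It serves both to read coefficients off
a metric and to build metrics. -/
lemma contMDiffAt_form_iff (b : M → V →L[ℝ] V →L[ℝ] ℝ) (x₀ : M) :
    ContMDiffAt 𝓘(ℝ, V) (𝓘(ℝ, V).prod 𝓘(ℝ, V →L[ℝ] V →L[ℝ] ℝ)) ∞
      (fun x => TotalSpace.mk' (V →L[ℝ] V →L[ℝ] ℝ)
        (E := fun x : M => TangentSpace 𝓘(ℝ, V) x →L[ℝ] TangentSpace 𝓘(ℝ, V) x →L[ℝ] ℝ)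
        x (b x)) x₀ ↔
      ContDiffAt ℝ ∞ (formCoeff b x₀) (extChartAt 𝓘(ℝ, V) x₀ x₀) := by
  have h0 := contMDiffAt_hom_bundle (n := ∞) (IM := 𝓘(ℝ, V)) (IB := 𝓘(ℝ, V))
    (fun x => TotalSpace.mk' (V →L[ℝ] V →L[ℝ] ℝ)
        (E := fun x : M => TangentSpace 𝓘(ℝ, V) x →L[ℝ] TangentSpace 𝓘(ℝ, V) x →L[ℝ] ℝ)
        x (b x)) (x₀ := x₀)
  refine h0.trans ?_
  have h1 : ContMDiffAt 𝓘(ℝ, V) 𝓘(ℝ, V) ∞ (fun x : M => x) x₀ := contMDiffAt_id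
  refine (and_iff_right h1).trans ?_
  have h2 : (fun x : M => ContinuousLinearMap.inCoordinates V (TangentSpace 𝓘(ℝ, V) : M → Type _)
      (V →L[ℝ] ℝ) (fun x : M => TangentSpace 𝓘(ℝ, V) x →L[ℝ] ℝ) x₀ x x₀ x (b x)) =ᶠ[𝓝 x₀]
      fun x => formCoeff b x₀ (extChartAt 𝓘(ℝ, V) x₀ x) := by
    filter_upwards [extChartAt_source_mem_nhds (I := 𝓘(ℝ, V)) x₀] with x hx
    exact inCoordinates_eq_formCoeff b hx
  refine h2.contMDiffAt_iff.trans ?_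
  constructor
  · intro h
    have h3 : ContMDiffAt 𝓘(ℝ, V) 𝓘(ℝ, V →L[ℝ] V →L[ℝ] ℝ) ∞
        (fun v => formCoeff b x₀ (extChartAt 𝓘(ℝ, V) x₀ ((extChartAt 𝓘(ℝ, V) x₀).symm v)))
        (extChartAt 𝓘(ℝ, V) x₀ x₀) :=
      ContMDiffAt.comp (x := extChartAt 𝓘(ℝ, V) x₀ x₀) (I' := 𝓘(ℝ, V))
        (g := fun x => formCoeff b x₀ (extChartAt 𝓘(ℝ, V) x₀ x))
        (f := (extChartAt 𝓘(ℝ, V) x₀).symm) (by rwa [extChartAt_to_inv])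
        (contMDiffAt_extChart_symm x₀ (mem_extChartAt_target x₀))
    refine h3.contDiffAt.congr_of_eventuallyEq ?_
    filter_upwards [extChartAt_target_mem_nhds (I := 𝓘(ℝ, V)) x₀] with v hv
    rw [(extChartAt 𝓘(ℝ, V) x₀).right_inv hv]
  · intro h
    exact ContMDiffAt.comp (x := x₀) (I' := 𝓘(ℝ, V)) (g := formCoeff b x₀) h.contMDiffAt
      (contMDiffAt_extChart x₀ (mem_extChartAt_source x₀))

lemma SmoothMetric.contDiffAt_coeff (g : SmoothMetric V M) (x : M) :
    ContDiffAt ℝ ∞ (g.coeff x) (extChartAt 𝓘(ℝ, V) x x) :=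
  (contMDiffAt_form_iff g.at x).mp (g.contMDiff x)

lemma SmoothMetric.coeff_apply (g : SmoothMetric V M) (x : M) (y u w : V) :
    g.coeff x y u w = g.at ((extChartAt 𝓘(ℝ, V) x).symm y)
      (differential (extChartAt 𝓘(ℝ, V) x).symm y u)
      (differential (extChartAt 𝓘(ℝ, V) x).symm y w) := rfl

lemma SmoothMetric.coeff_self (g : SmoothMetric V M) (x : M) :
    g.coeff x (extChartAt 𝓘(ℝ, V) x x) = g.at x := by
  ext u w
  rw [SmoothMetric.coeff_apply, extChartAt_to_inv, differential_extChartAt_symm_self]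
  rfl

lemma SmoothMetric.at_symm (g : SmoothMetric V M) (x : M) (u w : V) : g.at x u w = g.at x w u :=
  g.symm x u w

lemma SmoothMetric.at_pos (g : SmoothMetric V M) (x : M) (u : V) (hu : u ≠ 0) : 0 < g.at x u u :=
  g.pos x u hu

/-- The constant is the minimum of the form on the compact unit sphere. -/
lemma exists_pos_le_of_pos {V : Type*} [NormedAddCommGroup V] [NormedSpace ℝ V]
    [FiniteDimensional ℝ V] (b : V →L[ℝ] V →L[ℝ] ℝ) (hb : ∀ u, u ≠ 0 → 0 < b u u) :
    ∃ m > 0, ∀ v, m * ‖v‖ ^ 2 ≤ b v v := by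
  rcases subsingleton_or_nontrivial V with hV | hV
  · exact ⟨1, one_pos, fun v => by simp [Subsingleton.elim v 0]⟩
  have : ProperSpace V := FiniteDimensional.proper ℝ V
  obtain ⟨u, hu, hmin⟩ := (isCompact_sphere (0 : V) 1).exists_isMinOn
    (NormedSpace.sphere_nonempty.mpr zero_le_one)
    (f := fun v => b v v) (by fun_prop)
  have hu0 : u ≠ 0 := by
    rintro rfl; simp at hu
  refine ⟨b u u, hb u hu0, fun v => ?_⟩
  by_cases hv : v = 0
  · simp [hv]
  have hv' : 0 < ‖v‖ := norm_pos_iff.mpr hv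
  have h1 := hmin (show ‖v‖⁻¹ • v ∈ Metric.sphere (0 : V) 1 by
    simp [norm_smul, hv'.ne'])
  have h2 : b u u ≤ ‖v‖⁻¹ * (‖v‖⁻¹ * b v v) := by simpa using h1
  calc b u u * ‖v‖ ^ 2 ≤ ‖v‖⁻¹ * (‖v‖⁻¹ * b v v) * ‖v‖ ^ 2 := by gcongr
    _ = b v v := by field_simp

lemma isVonNBounded_of_pos {V : Type*} [NormedAddCommGroup V] [NormedSpace ℝ V]
    [FiniteDimensional ℝ V] (b : V →L[ℝ] V →L[ℝ] ℝ) (hb : ∀ u, u ≠ 0 → 0 < b u u) :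
    Bornology.IsVonNBounded ℝ {v : V | b v v < 1} := by
  obtain ⟨m, hm, h⟩ := exists_pos_le_of_pos b hb
  -- The radius 1/m + 1 bounds the norm without square roots, as 2‖v‖ ≤ ‖v‖² + 1.
  refine (NormedSpace.isVonNBounded_closedBall ℝ V (1 / m + 1)).subset fun v hv => ?_
  have hv' : b v v < 1 := hv
  have h1 := h v
  rw [mem_closedBall_zero_iff]
  have h2 : ‖v‖ ^ 2 ≤ 1 / m := by
    rw [le_div_iff₀ hm]; linarith [mul_comm m (‖v‖ ^ 2)]
  nlinarith [sq_nonneg (‖v‖ - 1), norm_nonneg v]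

/-- A smooth field of positive definite forms is a Riemannian metric. -/
def SmoothMetric.ofForm [FiniteDimensional ℝ V] (b : M → V →L[ℝ] V →L[ℝ] ℝ)
    (hsymm : ∀ x u w, b x u w = b x w u) (hpos : ∀ x u, u ≠ 0 → 0 < b x u u)
    (hsmooth : ∀ x, ContDiffAt ℝ ∞ (formCoeff b x) (extChartAt 𝓘(ℝ, V) x x)) :
    SmoothMetric V M where
  inner := b
  symm := hsymm
  pos := hpos
  isVonNBounded x := isVonNBounded_of_pos (b x) (hpos x)
  contMDiff x := (contMDiffAt_form_iff b x).mpr (hsmooth x)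

end MetricCoefficients

/-! ### The action on a homogeneous space in charts -/

section ActionInCharts

variable {E : Type*} [NormedAddCommGroup E] [NormedSpace ℝ E]
  {G : Type*} [TopologicalSpace G] [ChartedSpace E G] [Group G] [LieGroup 𝓘(ℝ, E) ∞ G]
  {H : Subgroup G}
  {V : Type*} [NormedAddCommGroup V] [NormedSpace ℝ V] [ChartedSpace V (G ⧸ H)]

variable (E H V) in
/-- The action of `G` on `G ⧸ H`, conjugated by `a`, in the preferred charts at `1` and `a H`. -/
def chartAct (a : G) (p : E × V) : V :=
  extChartAt 𝓘(ℝ, V) ((a : G) : G ⧸ H) ((a * (extChartAt 𝓘(ℝ, E) (1 : G)).symm p.1 * a⁻¹) •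
    (extChartAt 𝓘(ℝ, V) ((a : G) : G ⧸ H)).symm p.2)

omit [LieGroup 𝓘(ℝ, E) ∞ G] in
lemma chartAct_mk (a b : G) (hb : (b : G ⧸ H) ∈ (extChartAt 𝓘(ℝ, V) ((a : G) : G ⧸ H)).source)
    (e : E) :
    chartAct E H V a (e, extChartAt 𝓘(ℝ, V) ((a : G) : G ⧸ H) b) =
      extChartAt 𝓘(ℝ, V) ((a : G) : G ⧸ H) ((b * ((b⁻¹ * a) *
        (extChartAt 𝓘(ℝ, E) (1 : G)).symm e * (b⁻¹ * a)⁻¹) : G) : G ⧸ H) := by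
  simp only [chartAct]
  rw [(extChartAt 𝓘(ℝ, V) ((a : G) : G ⧸ H)).left_inv hb]
  congr 1
  have : b * ((b⁻¹ * a) * (extChartAt 𝓘(ℝ, E) (1 : G)).symm e * (b⁻¹ * a)⁻¹) =
      (a * (extChartAt 𝓘(ℝ, E) (1 : G)).symm e * a⁻¹) * b := by group
  rw [this]; rfl

variable (hH : Manifold.IsSubmersion 𝓘(ℝ, E) 𝓘(ℝ, V) ∞ (QuotientGroup.mk : G → G ⧸ H))

include hH

/-- The action on `G ⧸ H` is jointly smooth. -/
lemma contMDiffAt_smul_of {U P : Type*} [NormedAddCommGroup U] [NormedSpace ℝ U]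
    [TopologicalSpace P] [ChartedSpace U P] {f : P → G} {g : P → G ⧸ H} {x : P}
    (hf : ContMDiffAt 𝓘(ℝ, U) 𝓘(ℝ, E) ∞ f x) (hg : ContMDiffAt 𝓘(ℝ, U) 𝓘(ℝ, V) ∞ g x) :
    ContMDiffAt 𝓘(ℝ, U) 𝓘(ℝ, V) ∞ (fun y => f y • g y) x := by
  obtain ⟨b, hb⟩ := QuotientGroup.mk_surjective (g x)
  obtain ⟨σ, hσ, h⟩ := exists_local_section (hH.isSubmersionAt b)
  rw [hb] at h hσ
  have h1 : ContMDiffAt 𝓘(ℝ, U) 𝓘(ℝ, E) ∞ (fun y => f y * σ (g y)) x :=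
    contMDiffAt_mul_of hf (ContMDiffAt.comp (x := x) h.self_of_nhds.1 hg)
  have h2 : ContMDiffAt 𝓘(ℝ, U) 𝓘(ℝ, V) ∞
      (fun y => (QuotientGroup.mk (f y * σ (g y)) : G ⧸ H)) x :=
    ContMDiffAt.comp (x := x) (I' := 𝓘(ℝ, E)) (g := (QuotientGroup.mk : G → G ⧸ H))
      (contMDiffAt_mk hH _) h1
  refine h2.congr_of_eventuallyEq ?_
  filter_upwards [hg.continuousAt.eventually h] with y hy
  conv_lhs => rw [← hy.2]
  rfl

variable [IsManifold 𝓘(ℝ, V) ∞ (G ⧸ H)]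

lemma contMDiffAt_act (a : G) {p : E × V} (h1 : p.1 ∈ (extChartAt 𝓘(ℝ, E) (1 : G)).target)
    (h2 : p.2 ∈ (extChartAt 𝓘(ℝ, V) ((a : G) : G ⧸ H)).target) :
    ContMDiffAt 𝓘(ℝ, E × V) 𝓘(ℝ, V) ∞ (fun p : E × V =>
      (a * (extChartAt 𝓘(ℝ, E) (1 : G)).symm p.1 * a⁻¹) •
        (extChartAt 𝓘(ℝ, V) ((a : G) : G ⧸ H)).symm p.2) p :=
  contMDiffAt_smul_of hH (contMDiffAt_mul_of (contMDiffAt_mul_of contMDiffAt_const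
    (contMDiffAt_chart_symm_fst h1)) contMDiffAt_const) (contMDiffAt_chart_symm_snd _ h2)

lemma contDiffAt_chartAct (a : G) {p : E × V}
    (h1 : p.1 ∈ (extChartAt 𝓘(ℝ, E) (1 : G)).target)
    (h2 : p.2 ∈ (extChartAt 𝓘(ℝ, V) ((a : G) : G ⧸ H)).target)
    (h3 : (a * (extChartAt 𝓘(ℝ, E) (1 : G)).symm p.1 * a⁻¹) •
      (extChartAt 𝓘(ℝ, V) ((a : G) : G ⧸ H)).symm p.2 ∈
        (extChartAt 𝓘(ℝ, V) ((a : G) : G ⧸ H)).source) :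
    ContDiffAt ℝ ∞ (chartAct E H V a) p := by
  rw [← contMDiffAt_iff_contDiffAt]
  exact ContMDiffAt.comp (x := p) (I' := 𝓘(ℝ, V)) (contMDiffAt_extChart _ h3)
    (contMDiffAt_act hH a h1 h2)

omit hH in
lemma act_chart_one (a : G) (y : G ⧸ H) :
    (a * (extChartAt 𝓘(ℝ, E) (1 : G)).symm (extChartAt 𝓘(ℝ, E) (1 : G) 1) * a⁻¹) • y = y := by
  rw [chart_symm_one, mul_one, mul_inv_cancel, one_smul]

lemma eventually_act_mem_source (a : G) :
    ∀ᶠ p : E × V in 𝓝 (extChartAt 𝓘(ℝ, E) (1 : G) 1,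
        extChartAt 𝓘(ℝ, V) ((a : G) : G ⧸ H) ((a : G) : G ⧸ H)),
      p.1 ∈ (extChartAt 𝓘(ℝ, E) (1 : G)).target ∧
      p.2 ∈ (extChartAt 𝓘(ℝ, V) ((a : G) : G ⧸ H)).target ∧
      (a * (extChartAt 𝓘(ℝ, E) (1 : G)).symm p.1 * a⁻¹) •
        (extChartAt 𝓘(ℝ, V) ((a : G) : G ⧸ H)).symm p.2 ∈
          (extChartAt 𝓘(ℝ, V) ((a : G) : G ⧸ H)).source := by
  have h1 := (contMDiffAt_act hH a (p := (extChartAt 𝓘(ℝ, E) (1 : G) 1,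
    extChartAt 𝓘(ℝ, V) ((a : G) : G ⧸ H) ((a : G) : G ⧸ H))) (mem_extChartAt_target 1)
    (mem_extChartAt_target _)).continuousAt
  refine Filter.Eventually.and
    (continuousAt_fst.preimage_mem_nhds (extChartAt_target_mem_nhds (I := 𝓘(ℝ, E)) (1 : G)))
    (Filter.Eventually.and (continuousAt_snd.preimage_mem_nhds
      (extChartAt_target_mem_nhds (I := 𝓘(ℝ, V)) ((a : G) : G ⧸ H)))
    (h1.eventually (extChartAt_source_mem_nhds' (I := 𝓘(ℝ, V)) (x := ((a : G) : G ⧸ H)) ?_)))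
  simp only
  rw [act_chart_one, extChartAt_to_inv]
  exact mem_extChartAt_source _

lemma isLocalAction_chartAct (a : G) :
    IsLocalAction (chartMul E G) (extChartAt 𝓘(ℝ, E) (1 : G) 1) (chartAct E H V a)
      (extChartAt 𝓘(ℝ, V) ((a : G) : G ⧸ H) ((a : G) : G ⧸ H)) := by
  set κ := extChartAt 𝓘(ℝ, E) (1 : G) with hκ
  set φ := extChartAt 𝓘(ℝ, V) ((a : G) : G ⧸ H) with hφ
  have hm : ContDiffAt ℝ ∞ (chartMul E G) (κ 1, κ 1) :=
    contDiffAt_chartMul (mem_extChartAt_target 1) (mem_extChartAt_target 1)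
      (by simp only; rw [chart_symm_one, mul_one]; exact mem_extChartAt_source 1)
  have hev := eventually_act_mem_source hH a
  constructor
  · exact hm.of_le ENat.LEInfty.out
  · exact (contDiffAt_chartAct hH a hev.self_of_nhds.1 hev.self_of_nhds.2.1
      hev.self_of_nhds.2.2).of_le ENat.LEInfty.out
  · filter_upwards [eventually_mem_target (E := E) (G := G)] with e he
    simp only [chartMul]
    rw [chart_symm_one, mul_one, κ.right_inv he]
  · filter_upwards [eventually_mem_target (E := E) (G := G)] with e he
    simp only [chartMul]
    rw [chart_symm_one, one_mul, κ.right_inv he]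
  · filter_upwards [extChartAt_target_mem_nhds (I := 𝓘(ℝ, V)) ((a : G) : G ⧸ H)] with v hv
    simp only [chartAct]
    rw [act_chart_one, φ.right_inv hv]
  · have h1 : Tendsto (fun q : E × E × V => q.2) (𝓝 (κ 1, κ 1, φ ((a : G) : G ⧸ H)))
        (𝓝 (κ 1, φ ((a : G) : G ⧸ H))) := continuous_snd.tendsto _
    have h2 : Tendsto (fun q : E × E × V => (q.1, q.2.1)) (𝓝 (κ 1, κ 1, φ ((a : G) : G ⧸ H)))
        (𝓝 (κ 1, κ 1)) :=
      (continuous_fst.prodMk (continuous_fst.comp continuous_snd)).tendsto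
        (κ 1, κ 1, φ ((a : G) : G ⧸ H))
    have h3 : ∀ᶠ p : E × E in 𝓝 (κ 1, κ 1), κ.symm p.1 * κ.symm p.2 ∈ κ.source := by
      have h4 : ContMDiffAt 𝓘(ℝ, E × E) 𝓘(ℝ, E) ∞
          (fun p : E × E => κ.symm p.1 * κ.symm p.2) (κ 1, κ 1) :=
        contMDiffAt_mul_of (contMDiffAt_chart_symm_fst (mem_extChartAt_target 1))
          (contMDiffAt_chart_symm_snd 1 (mem_extChartAt_target 1))
      refine h4.continuousAt.eventually (extChartAt_source_mem_nhds' (I := 𝓘(ℝ, E)) ?_)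
      simp only [hκ]
      rw [chart_symm_one, mul_one]; exact mem_extChartAt_source 1
    filter_upwards [h1.eventually hev, h2.eventually h3] with q hq hq'
    simp only [chartAct, chartMul]
    rw [κ.left_inv hq', φ.left_inv hq.2.2, smul_smul]
    have h5 : ∀ b c : G, a * (b * c) * a⁻¹ = a * b * a⁻¹ * (a * c * a⁻¹) := by intros; group
    rw [h5]

/-- The fundamental fields of the action, in charts. -/
lemma fundField_chartAct (a b : G)
    (hb : (b : G ⧸ H) ∈ (extChartAt 𝓘(ℝ, V) ((a : G) : G ⧸ H)).source) (X : E) :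
    fundField (chartAct E H V a) (extChartAt 𝓘(ℝ, E) (1 : G) 1) X
        (extChartAt 𝓘(ℝ, V) ((a : G) : G ⧸ H) b) =
      differential (V := V) (W := V) (extChartAt 𝓘(ℝ, V) ((a : G) : G ⧸ H)) b
        (orbitMap E H V b (adMap E (b⁻¹ * a) X)) := by
  set κ := extChartAt 𝓘(ℝ, E) (1 : G) with hκ
  set φ := extChartAt 𝓘(ℝ, V) ((a : G) : G ⧸ H) with hφ
  have hact : ContDiffAt ℝ ∞ (chartAct E H V a) (κ 1, φ b) := by
    refine contDiffAt_chartAct hH a (mem_extChartAt_target 1) (φ.map_source hb) ?_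
    simp only
    rw [act_chart_one, φ.left_inv hb]
    exact hb
  have h1 : fundField (chartAct E H V a) (κ 1) X (φ b) =
      fderiv ℝ (fun e => chartAct E H V a (e, φ b)) (κ 1) X := by
    have h2 : fderiv ℝ (fun e => chartAct E H V a (e, φ b)) (κ 1) = _ :=
      (HasFDerivAt.comp (f := fun e => (e, φ b)) (κ 1)
        (hact.differentiableAt (by simp)).hasFDerivAt
        (hasFDerivAt_prodMk_left (𝕜 := ℝ) (κ 1) (φ b))).fderiv
    rw [h2]; simp [fundField]
  have h3 : (fun e => chartAct E H V a (e, φ b)) = fun e => φ ((fun g : G =>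
      ((b * ((b⁻¹ * a) * g * (b⁻¹ * a)⁻¹) : G) : G ⧸ H)) (κ.symm e)) := by
    ext e; exact chartAct_mk a b hb e
  have hf : ContMDiffAt 𝓘(ℝ, E) 𝓘(ℝ, V) ∞ (fun g : G =>
      ((b * ((b⁻¹ * a) * g * (b⁻¹ * a)⁻¹) : G) : G ⧸ H)) 1 :=
    ContMDiffAt.comp (x := 1) (I' := 𝓘(ℝ, E)) (g := fun c : G => ((b * c : G) : G ⧸ H))
      (contMDiffAt_orbit hH b _) (contMDiff_conj _ 1)
  have hf1 : ((b * ((b⁻¹ * a) * 1 * (b⁻¹ * a)⁻¹) : G) : G ⧸ H) = b := by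
    rw [mul_one, mul_inv_cancel, mul_one]
  have hs := contMDiffAt_extChart_symm (1 : G) (mem_extChartAt_target (I := 𝓘(ℝ, E)) (1 : G))
  have h10 : κ.symm (κ 1) = 1 := chart_symm_one
  rw [h1, h3, ← differential_eq_fderiv,
    differential_comp_apply (V := E) (W := V) (U := V) (M := E) (g := φ)
      (f := fun e => (fun g : G =>
      ((b * ((b⁻¹ * a) * g * (b⁻¹ * a)⁻¹) : G) : G ⧸ H)) (κ.symm e)),
    differential_comp_apply (V := E) (W := E) (U := V) (M := E) (g := fun g : G =>
      ((b * ((b⁻¹ * a) * g * (b⁻¹ * a)⁻¹) : G) : G ⧸ H)) (f := κ.symm)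
      (by rw [h10]; exact hf.mdiff) hs.mdiff]
  · have h11 : differential (V := E) (W := E) κ.symm (κ 1) = ContinuousLinearMap.id ℝ E :=
      differential_extChartAt_symm_self (1 : G)
    rw [h11]
    simp only [h10, hf1]
    congr 1
    rw [← hκ, h10]
    exact differential_comp_conj (V := V) (f := fun c : G => ((b * c : G) : G ⧸ H))
      (contMDiffAt_orbit hH b 1).mdiff (b⁻¹ * a) X
  · simp only [h10, hf1]
    exact (contMDiffAt_extChart _ hb).mdiff
  · exact MDifferentiableAt.comp (I' := 𝓘(ℝ, E)) (κ 1)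
      (g := fun g : G => ((b * ((b⁻¹ * a) * g * (b⁻¹ * a)⁻¹) : G) : G ⧸ H))
      (by rw [h10]; exact hf.mdiff) hs.mdiff

/-- This is the purpose of conjugating the action by `a` in `chartAct`: no Ad appears at the coset
of `a`, so an invariant metric evaluates on the fundamental fields by the same form at every point.
-/
lemma fundField_chartAct_self (a : G) (X : E) :
    fundField (chartAct E H V a) (extChartAt 𝓘(ℝ, E) (1 : G) 1) X
        (extChartAt 𝓘(ℝ, V) ((a : G) : G ⧸ H) ((a : G) : G ⧸ H)) = orbitMap E H V a X := by
  rw [fundField_chartAct hH a a (mem_extChartAt_source _), differential_extChartAt_self,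
    inv_mul_cancel, adMap_one_apply]
  rfl

/-- The action is isometric for the coefficients of an invariant metric. -/
lemma IsInvariantMetric.eventually_coeff_chartAct {g : SmoothMetric V (G ⧸ H)}
    (hg : IsInvariantMetric g) (a : G) :
    ∀ᶠ p : E × V in 𝓝 (extChartAt 𝓘(ℝ, E) (1 : G) 1,
        extChartAt 𝓘(ℝ, V) ((a : G) : G ⧸ H) ((a : G) : G ⧸ H)), ∀ u w,
      g.coeff a (chartAct E H V a p) (fderiv ℝ (chartAct E H V a) p (0, u))
        (fderiv ℝ (chartAct E H V a) p (0, w)) = g.coeff a p.2 u w := by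
  filter_upwards [eventually_act_mem_source hH a] with p hp u w
  obtain ⟨h1, h2, h3⟩ := hp
  set κ := extChartAt 𝓘(ℝ, E) (1 : G) with hκ
  set φ := extChartAt 𝓘(ℝ, V) ((a : G) : G ⧸ H) with hφ
  set k := a * κ.symm p.1 * a⁻¹ with hk
  have hact := contDiffAt_chartAct hH a h1 h2 h3
  have hs := contMDiffAt_extChart_symm _ h2
  have hd : ∀ u, fderiv ℝ (chartAct E H V a) p (0, u) =
      differential (V := V) (W := V) φ (k • φ.symm p.2)
        (differential (V := V) (W := V) (fun y : G ⧸ H => k • y) (φ.symm p.2)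
          (differential (V := V) (W := V) φ.symm p.2 u)) := by
    intro u
    have h4 : fderiv ℝ (fun v => chartAct E H V a (p.1, v)) p.2 = _ :=
      (HasFDerivAt.comp (f := fun v => (p.1, v)) p.2
        (hact.differentiableAt (by simp)).hasFDerivAt
        (hasFDerivAt_prodMk_right (𝕜 := ℝ) p.1 p.2)).fderiv
    have h5 : fderiv ℝ (chartAct E H V a) p (0, u) =
        fderiv ℝ (fun v => φ (k • φ.symm v)) p.2 u := by
      have h6 : (fun v => φ (k • φ.symm v)) = fun v => chartAct E H V a (p.1, v) := rfl
      rw [h6, h4]; simp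
    rw [h5, ← differential_eq_fderiv,
      differential_comp_apply (V := V) (W := V) (U := V) (M := V) (g := φ)
        (f := fun v => k • φ.symm v) (contMDiffAt_extChart _ h3).mdiff
        (MDifferentiableAt.comp (I' := 𝓘(ℝ, V)) p.2 (g := fun y : G ⧸ H => k • y)
          (contMDiffAt_smul hH k _).mdiff hs.mdiff),
      differential_comp_apply (V := V) (W := V) (U := V) (M := V) (g := fun y : G ⧸ H => k • y)
        (f := φ.symm) (contMDiffAt_smul hH k _).mdiff hs.mdiff]
  have hF : φ.symm (chartAct E H V a p) = k • φ.symm p.2 := φ.left_inv h3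
  have hFt : chartAct E H V a p ∈ φ.target := φ.map_source h3
  have hback : ∀ u, differential (V := V) (W := V) φ.symm (chartAct E H V a p)
      (differential (V := V) (W := V) φ (k • φ.symm p.2) u) = u := by
    intro u
    rw [← hF]
    exact differential_symm_comp_extChartAt _ hFt u
  rw [SmoothMetric.coeff_apply, SmoothMetric.coeff_apply, ← hφ, hd, hd, hback, hback, hF]
  exact hg k _ _ _

end ActionInCharts

/-! ### Invariant metrics and invariant forms on 𝔤 -/

section InvariantMetrics

variable {E : Type*} [NormedAddCommGroup E] [NormedSpace ℝ E]
  {G : Type*} [TopologicalSpace G] [ChartedSpace E G] [Group G] [LieGroup 𝓘(ℝ, E) ∞ G]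
  {H : Subgroup G}
  {V : Type*} [NormedAddCommGroup V] [NormedSpace ℝ V] [ChartedSpace V (G ⧸ H)]
  [IsManifold 𝓘(ℝ, V) ∞ (G ⧸ H)]
  (hH : Manifold.IsSubmersion 𝓘(ℝ, E) 𝓘(ℝ, V) ∞ (QuotientGroup.mk : G → G ⧸ H))

include hH

lemma IsInvariantMetric.at_orbitMap {g : SmoothMetric V (G ⧸ H)} (hg : IsInvariantMetric g)
    (a : G) (X Y : E) :
    g.at ((a : G) : G ⧸ H) (orbitMap E H V a X) (orbitMap E H V a Y) =
      g.at ((1 : G) : G ⧸ H) (orbitMap E H V (1 : G) X) (orbitMap E H V (1 : G) Y) := by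
  have h := hg a ((1 : G) : G ⧸ H) (orbitMap E H V (1 : G) X) (orbitMap E H V (1 : G) Y)
  rw [differential_smul_orbitMap hH, differential_smul_orbitMap hH, mul_one] at h
  have h1 : a • ((1 : G) : G ⧸ H) = ((a : G) : G ⧸ H) := by
    conv_rhs => rw [← mul_one a]
    rfl
  rwa [h1] at h

/-- A metric which is the same bilinear form in all the frames of the orbit maps is invariant. -/
lemma isInvariantMetric_of_at_orbitMap {g : SmoothMetric V (G ⧸ H)} {ψ : E → E → ℝ}
    (h : ∀ a X Y, g.at ((a : G) : G ⧸ H) (orbitMap E H V a X) (orbitMap E H V a Y) = ψ X Y) :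
    IsInvariantMetric g := by
  intro a x u w
  obtain ⟨b, rfl⟩ := QuotientGroup.mk_surjective x
  obtain ⟨X, rfl⟩ := orbitMap_surjective hH b u
  obtain ⟨Y, rfl⟩ := orbitMap_surjective hH b w
  rw [differential_smul_orbitMap hH, differential_smul_orbitMap hH, h]
  exact h (a * b) X Y

lemma IsInvariantMetric.isKillingAlgebra [FiniteDimensional ℝ E] {g : SmoothMetric V (G ⧸ H)}
    (hg : IsInvariantMetric g) (a : G) :
    IsKillingAlgebra (g.coeff a) (fun X : GroupLieAlgebra 𝓘(ℝ, E) G =>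
      fundField (chartAct E H V a) (extChartAt 𝓘(ℝ, E) (1 : G) 1) X)
      (extChartAt 𝓘(ℝ, V) ((a : G) : G ⧸ H) ((a : G) : G ⧸ H)) := by
  refine (isLocalAction_chartAct hH a).isKillingAlgebra
    (𝔤 := GroupLieAlgebra 𝓘(ℝ, E) G) (fun X => X) lie_eq_fderiv_leftField
    ((g.contDiffAt_coeff _).of_le ENat.LEInfty.out) (Eventually.of_forall fun y u w => ?_)
    (fun u hu => ?_) (hg.eventually_coeff_chartAct hH a)
  · exact g.at_symm _ _ _
  · rw [g.coeff_self]; exact g.at_pos _ u hu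

omit [IsManifold 𝓘(ℝ, V) ∞ (G ⧸ H)] in
/-- An `Ad H`-invariant positive semidefinite form with kernel the Lie algebra of `H` defines a
field of forms on `G ⧸ H`. -/
lemma exists_field_of_form [FiniteDimensional ℝ V] (ψ : E →L[ℝ] E →L[ℝ] ℝ)
    (hsymm : ∀ X Y, ψ X Y = ψ Y X) (hker : ∀ X Y, orbitMap E H V (1 : G) X = 0 → ψ X Y = 0)
    (hinv : ∀ k ∈ H, ∀ X Y, ψ (adMap E k X) (adMap E k Y) = ψ X Y) :
    ∃ b : G ⧸ H → V →L[ℝ] V →L[ℝ] ℝ,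
      ∀ a X Y, b ((a : G) : G ⧸ H) (orbitMap E H V a X) (orbitMap E H V a Y) = ψ X Y := by
  have hS : ∀ a : G, ∃ S : V →L[ℝ] E, ∀ v, orbitMap E H V a (S v) = v := by
    intro a
    obtain ⟨S, hS⟩ := (orbitMap E H V a : E →ₗ[ℝ] V).exists_rightInverse_of_surjective
      (LinearMap.range_eq_top.mpr (orbitMap_surjective hH a))
    exact ⟨LinearMap.toContinuousLinearMap S, fun v => LinearMap.congr_fun hS v⟩
  choose S hS using hS
  -- The form at a coset is pulled back by a right inverse of the orbit map at the chosen
  -- representative. Another representative differs by an element of H and another lift by a vector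
  -- of the kernel; `hinv` and `hker` absorb both.
  refine ⟨fun x => ψ.bilinearComp (S x.out) (S x.out), fun a X Y => ?_⟩
  set a' := (QuotientGroup.mk a : G ⧸ H).out with ha'
  have hk : a'⁻¹ * a ∈ H := QuotientGroup.eq.mp (QuotientGroup.out_eq' _)
  have hψ : ∀ X X' Y Y', orbitMap E H V (1 : G) (X - X') = 0 →
      orbitMap E H V (1 : G) (Y - Y') = 0 → ψ X Y = ψ X' Y' := by
    intro X X' Y Y' h1 h2
    have e1 := hker (X - X') Y h1
    have e2 := hker (Y - Y') X' h2
    rw [hsymm] at e2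
    simp only [map_sub, sub_apply] at e1 e2
    linarith
  have horb : ∀ X, orbitMap E H V a X = orbitMap E H V a' (adMap E (a'⁻¹ * a) X) := by
    intro X
    rw [← orbitMap_mul_mem hH a' hk, mul_inv_cancel_left]
  have hz : ∀ X, orbitMap E H V (1 : G) (S a' (orbitMap E H V a X) - adMap E (a'⁻¹ * a) X) = 0 := by
    intro X
    rw [← orbitMap_eq_zero_iff hH a', map_sub, hS, horb, sub_self]
  rw [ContinuousLinearMap.bilinearComp_apply, ← hinv _ hk X Y]
  exact hψ _ _ _ _ (hz X) (hz Y)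

/-- Take a smooth local section s of the projection, in the chart. The derivative T v of v' ↦ (s
v)⁻¹ s v' at v lifts the differential of the inverse chart through the orbit map at s v. The
coefficients are therefore ψ(T v ·, T v ·), smooth in v. -/
lemma contDiffAt_formCoeff_of_orbitMap {b : G ⧸ H → V →L[ℝ] V →L[ℝ] ℝ} {ψ : E →L[ℝ] E →L[ℝ] ℝ}
    (hb : ∀ a X Y, b ((a : G) : G ⧸ H) (orbitMap E H V a X) (orbitMap E H V a Y) = ψ X Y)
    (x : G ⧸ H) : ContDiffAt ℝ ∞ (formCoeff b x) (extChartAt 𝓘(ℝ, V) x x) := by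
  obtain ⟨a, rfl⟩ := QuotientGroup.mk_surjective x
  set x : G ⧸ H := QuotientGroup.mk a with hx
  set φ := extChartAt 𝓘(ℝ, V) x with hφ
  set κ := extChartAt 𝓘(ℝ, E) (1 : G) with hκ
  obtain ⟨σ, hσ, hsec⟩ := exists_local_section (hH.isSubmersionAt a)
  let s : V → G := fun v => σ (φ.symm v)
  have h0 : φ.symm (φ x) = x := extChartAt_to_inv x
  have htend : ∀ᶠ v in 𝓝 (φ x), ContMDiffAt 𝓘(ℝ, V) 𝓘(ℝ, E) ∞ s v ∧
      (QuotientGroup.mk (s v) : G ⧸ H) = φ.symm v ∧ v ∈ φ.target := by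
    have hc : ContinuousAt φ.symm (φ x) := continuousAt_extChartAt_symm x
    have h1 : ∀ᶠ v in 𝓝 (φ x), ContMDiffAt 𝓘(ℝ, V) 𝓘(ℝ, E) ∞ σ (φ.symm v) ∧
        (QuotientGroup.mk (σ (φ.symm v)) : G ⧸ H) = φ.symm v :=
      hc.eventually (by rw [h0]; exact hsec)
    filter_upwards [h1, extChartAt_target_mem_nhds (I := 𝓘(ℝ, V)) x] with v hv hvt
    exact ⟨ContMDiffAt.comp (x := v) (I' := 𝓘(ℝ, V)) hv.1 (contMDiffAt_extChart_symm x hvt),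
      hv.2, hvt⟩
  let R : V × V → E := fun p => κ ((s p.1)⁻¹ * s p.2)
  have hR : ∀ v, ContMDiffAt 𝓘(ℝ, V) 𝓘(ℝ, E) ∞ s v → ContDiffAt ℝ ∞ R (v, v) := by
    intro v hv
    rw [← contMDiffAt_iff_contDiffAt]
    have h1 : ContMDiffAt 𝓘(ℝ, V × V) 𝓘(ℝ, E) ∞ (fun p : V × V => s p.1) (v, v) :=
      ContMDiffAt.comp (x := (v, v)) (I' := 𝓘(ℝ, V)) (g := s) (f := Prod.fst) hv
        contDiff_fst.contMDiff.contMDiffAt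
    have h2 : ContMDiffAt 𝓘(ℝ, V × V) 𝓘(ℝ, E) ∞ (fun p : V × V => s p.2) (v, v) :=
      ContMDiffAt.comp (x := (v, v)) (I' := 𝓘(ℝ, V)) (g := s) (f := Prod.snd) hv
        contDiff_snd.contMDiff.contMDiffAt
    refine ContMDiffAt.comp (x := (v, v)) (I' := 𝓘(ℝ, E)) (contMDiffAt_extChart (1 : G) ?_)
      (contMDiffAt_mul_of (contMDiffAt_inv_of h1) h2)
    simp only [inv_mul_cancel]
    exact mem_extChartAt_source 1
  let T : V → V →L[ℝ] E := fun v => (fderiv ℝ R (v, v)).comp (ContinuousLinearMap.inr ℝ V V)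
  have hT : ContDiffAt ℝ ∞ T (φ x) := by
    have h1 : ContDiffAt ℝ ∞ (fderiv ℝ R) (φ x, φ x) :=
      (hR _ htend.self_of_nhds.1).fderiv_right (by simp)
    exact (ContDiffAt.comp (f := fun v : V => (v, v)) (φ x) h1
      (contDiffAt_id.prodMk contDiffAt_id)).clm_comp contDiffAt_const
  have hTorb : ∀ᶠ v in 𝓝 (φ x), ∀ u, orbitMap E H V (s v) (T v u) =
      differential (V := V) (W := V) φ.symm v u := by
    filter_upwards [htend.eventually_nhds] with v hv u
    obtain ⟨hs, hmk, hvt⟩ := hv.self_of_nhds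
    let q : V → G := fun v' => (s v)⁻¹ * s v'
    have hq : ContMDiffAt 𝓘(ℝ, V) 𝓘(ℝ, E) ∞ q v := contMDiffAt_mul_of contMDiffAt_const hs
    have hq1 : q v = 1 := inv_mul_cancel _
    have h1 : φ.symm =ᶠ[𝓝 v] fun v' => ((s v * q v' : G) : G ⧸ H) := by
      filter_upwards [hv] with v' hv'
      simp only [q, mul_inv_cancel_left]
      exact hv'.2.1.symm
    have h2 : T v u = differential (V := V) (W := E) q v u := by
      have h3 : fderiv ℝ (fun v' => R (v, v')) v = _ :=
        (HasFDerivAt.comp (f := fun v' => (v, v')) v ((hR v hs).differentiableAt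
          (by simp)).hasFDerivAt (hasFDerivAt_prodMk_right (𝕜 := ℝ) v v)).fderiv
      have h4 : T v u = fderiv ℝ (fun v' => κ (q v')) v u := by
        have h5 : (fun v' => κ (q v')) = fun v' => R (v, v') := rfl
        rw [h5, h3]
      rw [h4, ← differential_eq_fderiv, differential_comp_apply (V := V) (W := E) (U := E) (M := V)
        (g := κ) (f := q) (by rw [hq1]; exact (contMDiffAt_extChart (1 : G)
          (mem_extChartAt_source 1)).mdiff) hq.mdiff, hq1, hκ, differential_extChartAt_self]
      rfl
    rw [h2, differential_congr h1, differential_comp_apply (V := V) (W := E) (U := V) (M := V)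
      (g := fun c : G => ((s v * c : G) : G ⧸ H)) (f := q) (contMDiffAt_orbit hH _ _).mdiff
      hq.mdiff, hq1]
    rfl
  have hfin : ContDiffAt ℝ ∞ (fun v => ψ.bilinearComp (T v) (T v)) (φ x) := by
    simp only [ContinuousLinearMap.bilinearComp]
    have hflip : ContDiffAt ℝ ∞ (fun v => (ψ.comp (T v)).flip) (φ x) :=
      (ContinuousLinearMap.flipₗᵢ ℝ V E ℝ).contDiff.contDiffAt.comp (φ x)
        (contDiffAt_const.clm_comp hT)
    exact (ContinuousLinearMap.flipₗᵢ ℝ V V ℝ).contDiff.contDiffAt.comp (φ x)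
        (hflip.clm_comp hT)
  refine hfin.congr_of_eventuallyEq ?_
  filter_upwards [hTorb, htend] with v hv hv'
  ext u w
  simp only [formCoeff, ContinuousLinearMap.bilinearComp_apply]
  rw [← hφ, ← hv, ← hv, ← hv'.2.1, hb]

/-- Invariant metrics on `G ⧸ H` from `Ad H`-invariant forms. -/
theorem exists_metric_of_form [FiniteDimensional ℝ V] (ψ : E →L[ℝ] E →L[ℝ] ℝ)
    (hsymm : ∀ X Y, ψ X Y = ψ Y X) (hker : ∀ X Y, orbitMap E H V (1 : G) X = 0 → ψ X Y = 0)
    (hpos : ∀ X, orbitMap E H V (1 : G) X ≠ 0 → 0 < ψ X X)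
    (hinv : ∀ k ∈ H, ∀ X Y, ψ (adMap E k X) (adMap E k Y) = ψ X Y) :
    ∃ g : SmoothMetric V (G ⧸ H), ∀ a X Y,
      g.at ((a : G) : G ⧸ H) (orbitMap E H V a X) (orbitMap E H V a Y) = ψ X Y := by
  obtain ⟨b, hb⟩ := exists_field_of_form hH ψ hsymm hker hinv
  refine ⟨SmoothMetric.ofForm b (fun x u w => ?_) (fun x u hu => ?_)
    (contDiffAt_formCoeff_of_orbitMap hH hb), hb⟩
  · obtain ⟨a, rfl⟩ := QuotientGroup.mk_surjective x
    obtain ⟨X, rfl⟩ := orbitMap_surjective hH a u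
    obtain ⟨Y, rfl⟩ := orbitMap_surjective hH a w
    rw [hb, hb, hsymm]
  · obtain ⟨a, rfl⟩ := QuotientGroup.mk_surjective x
    obtain ⟨X, rfl⟩ := orbitMap_surjective hH a u
    rw [hb]
    exact hpos X fun h => hu ((orbitMap_eq_zero_iff hH a X).mpr h)

end InvariantMetrics

/-! ### Casimir operators, their invariance, and Schur's lemma -/

section CasimirOperator

variable {E : Type*} [NormedAddCommGroup E] [NormedSpace ℝ E] [FiniteDimensional ℝ E]
  {G : Type*} [TopologicalSpace G] [ChartedSpace E G] [Group G] [LieGroup 𝓘(ℝ, E) ∞ G]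

local notation "𝔤" => GroupLieAlgebra 𝓘(ℝ, E) G

lemma adEquiv_apply (a : G) (X : 𝔤) : adEquiv a X = adjointRep E a X := rfl

lemma adjointRep_apply_inv (a : G) (X : 𝔤) : adjointRep E a (adjointRep E a⁻¹ X) = X :=
  (adEquiv a).right_inv X

lemma negForm_adjointRep (a : G) (X Y : 𝔤) :
    negForm 𝔤 (adjointRep E a X) (adjointRep E a Y) = negForm 𝔤 X Y :=
  congrArg Neg.neg (killingForm_adjointRep a X Y)

lemma negForm_adjointRep_left (a : G) (X Y : 𝔤) :
    negForm 𝔤 (adjointRep E a X) Y = negForm 𝔤 X (adjointRep E a⁻¹ Y) := by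
  rw [← negForm_adjointRep a X, adjointRep_apply_inv]

lemma negKilling_eq (X Y : 𝔤) : negKilling X Y = negForm 𝔤 X Y := rfl

lemma IsFrame.adjointRep {ι : Type*} [Fintype ι] [DecidableEq ι] {U : Submodule ℝ 𝔤} {e : ι → 𝔤}
    (he : IsFrame U e) {H : Subgroup G} (hU : IsAdInvariant H U) {a : G} (ha : a ∈ H) :
    IsFrame U (fun i => adjointRep E a (e i)) where
  mem i := hU a ha _ (he.mem i)
  orthonormal i j := by rw [negForm_adjointRep, he.orthonormal]
  expand X hX := by
    have h := congrArg (adEquiv a) (he.expand _ (hU a⁻¹ (H.inv_mem ha) X hX))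
    rw [adEquiv_apply, adjointRep_apply_inv, map_sum] at h
    refine h.trans (Finset.sum_congr rfl fun i _ => ?_)
    rw [map_smul, adEquiv_apply, negForm_adjointRep_left, inv_inv]

variable {ι : Type*} [Fintype ι] [DecidableEq ι] {U : Submodule ℝ (GroupLieAlgebra 𝓘(ℝ, E) G)}
  {e : ι → GroupLieAlgebra 𝓘(ℝ, E) G}

/-- The Casimir operator in an orthonormal basis. -/
lemma IsFrame.casimir_eq (he : IsFrame U e) (X : 𝔤) :
    casimir U X = -∑ k, ⁅e k, ⁅e k, X⁆⁆ := by
  set u := fun i => (Module.finBasis ℝ U i : 𝔤) with hu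
  set P : Matrix (Fin (Module.finrank ℝ U)) ι ℝ := Matrix.of fun i k => negForm 𝔤 (u i) (e k)
    with hP
  set R : Matrix ι (Fin (Module.finrank ℝ U)) ℝ :=
    Matrix.of fun k j => (Module.finBasis ℝ U).repr ⟨e k, he.mem k⟩ j with hR
  have hue : ∀ i, u i = ∑ k, P i k • e k := fun i => he.expand _ (Module.finBasis ℝ U i).2
  have heu : ∀ k, e k = ∑ j, R k j • u j := by
    intro k
    have := congrArg U.subtype ((Module.finBasis ℝ U).sum_repr ⟨e k, he.mem k⟩)
    rw [map_sum] at this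
    simp only [map_smul, Submodule.subtype_apply] at this
    exact this.symm
  have hRP : R * P = 1 := by
    ext k m
    have h1 : negForm 𝔤 (e k) (e m) = ∑ j, R k j * P j m := by
      conv_lhs => rw [heu k]
      simp [hP]
    rw [Matrix.mul_apply, ← h1, he.orthonormal, Matrix.one_apply]
  have hPR : P * R = 1 := by
    ext i j
    have h1 : Module.finBasis ℝ U i = ∑ k, P i k • (⟨e k, he.mem k⟩ : U) := by
      apply Subtype.ext
      have := hue i
      simpa using this
    have h2 := congrArg (fun x => (Module.finBasis ℝ U).repr x j) h1
    simp only [Module.Basis.repr_self, map_sum, map_smul, Finsupp.coe_finsetSum,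
      Finset.sum_apply, Finsupp.smul_apply, smul_eq_mul] at h2
    rw [Matrix.mul_apply, Matrix.one_apply]
    refine h2.symm.trans ?_
    simp [Finsupp.single_apply]
  -- With P the matrix of the given basis in the frame and R = P⁻¹, the Gram matrix of Φ is -P Pᵀ,
  -- with inverse -Rᵀ R. The two factors R turn the double sum into one over the frame.
  have hQ : (Matrix.of fun i j => killingForm ℝ 𝔤 (u i) (u j)) = -(P * P.transpose) := by
    ext i j
    have h1 : negForm 𝔤 (u i) (u j) = ∑ k, P i k * P j k := by
      conv_lhs => rw [hue i]
      simp [hP, negForm_symm]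
    rw [Matrix.of_apply, Matrix.neg_apply, Matrix.mul_apply]
    simp only [Matrix.transpose_apply]
    rw [← h1]; simp [negForm]
  have hQi : (Matrix.of fun i j => killingForm ℝ 𝔤 (u i) (u j))⁻¹ = -(R.transpose * R) := by
    apply Matrix.inv_eq_right_inv
    rw [hQ, neg_mul_neg, Matrix.mul_assoc, ← Matrix.mul_assoc P.transpose, ← Matrix.transpose_mul,
      hRP, Matrix.transpose_one, Matrix.one_mul, hPR]
  have hdef : casimir U X = ∑ i, ∑ j, (Matrix.of fun i j => killingForm ℝ 𝔤 (u i) (u j))⁻¹ i j •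
      ⁅u i, ⁅u j, X⁆⁆ := rfl
  rw [hdef, hQi]
  have hk : ∀ k, ⁅e k, ⁅e k, X⁆⁆ = ∑ i, ∑ j, (R k i * R k j) • ⁅u i, ⁅u j, X⁆⁆ := by
    intro k
    conv_lhs => rw [heu k]
    simp only [sum_lie, lie_sum, smul_lie, lie_smul]
    rw [Finset.sum_comm]
    refine Finset.sum_congr rfl fun i _ => ?_
    rw [Finset.smul_sum]
    refine Finset.sum_congr rfl fun j _ => ?_
    rw [smul_smul, mul_comm]
  simp only [hk, Matrix.neg_apply, Matrix.mul_apply, Matrix.transpose_apply, neg_smul,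
    Finset.sum_neg_distrib, Finset.sum_smul]
  congr 1
  conv_rhs => rw [Finset.sum_comm]
  refine Finset.sum_congr rfl fun i _ => ?_
  rw [Finset.sum_comm]

lemma IsFrame.negForm_casimir (he : IsFrame U e) (X Z : 𝔤) :
    negForm 𝔤 (casimir U X) Z = casimirForm e X Z := by
  rw [he.casimir_eq, map_neg, LinearMap.neg_apply, map_sum, LinearMap.sum_apply, casimirForm,
    ← Finset.sum_neg_distrib]
  refine Finset.sum_congr rfl fun i _ => ?_
  rw [negForm_lie_right (e i) ⁅e i, X⁆ Z]

/-- The Casimir form is the same in the frame moved by Ad a⁻¹, because it comes from an operator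
which does not depend on the frame. -/
lemma IsFrame.casimirForm_adjointRep (he : IsFrame U e) {H : Subgroup G} (hU : IsAdInvariant H U)
    {a : G} (ha : a ∈ H) (X Y : 𝔤) :
    casimirForm e (_root_.adjointRep E a X) (_root_.adjointRep E a Y) = casimirForm e X Y := by
  have h := he.adjointRep hU (H.inv_mem ha)
  rw [← he.negForm_casimir X, h.negForm_casimir, casimirForm, casimirForm]
  refine Finset.sum_congr rfl fun i _ => ?_
  conv_rhs => rw [← negForm_adjointRep a, adjointRep_lie, adjointRep_lie, adjointRep_apply_inv]

lemma casimirIsScalarOn_iff (hpos : ∀ X : 𝔤, X ≠ 0 → 0 < negForm 𝔤 X X) (he : IsFrame U e)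
    {U' : Submodule ℝ 𝔤} (hU : ∀ X ∈ U', casimir U X ∈ U') (c : ℝ) :
    CasimirIsScalarOn U U' c ↔ ∀ X ∈ U', ∀ Y ∈ U', casimirForm e X Y = c * negForm 𝔤 X Y := by
  constructor
  · intro h X hX Y _
    rw [← he.negForm_casimir, h X hX, map_smul, LinearMap.smul_apply, smul_eq_mul]
  · intro h X hX
    by_contra hne
    have hmem : casimir U X - c • X ∈ U' := U'.sub_mem (hU X hX) (U'.smul_mem c hX)
    refine (hpos _ (sub_ne_zero.mpr hne)).ne' ?_
    rw [LinearMap.BilinForm.sub_left, he.negForm_casimir, h X hX _ hmem, map_smul,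
      LinearMap.smul_apply, smul_eq_mul, sub_self]

/-- The form of the Casimir operator, as a bilinear form. -/
def casimirBilin (e : ι → 𝔤) : LinearMap.BilinForm ℝ 𝔤 :=
  ∑ i, (negForm 𝔤).compl₁₂ (LieAlgebra.ad ℝ 𝔤 (e i)) (LieAlgebra.ad ℝ 𝔤 (e i))

omit [DecidableEq ι] in
lemma casimirBilin_apply (e : ι → 𝔤) (X Y : 𝔤) : casimirBilin e X Y = casimirForm e X Y := by
  simp [casimirBilin, casimirForm, LinearMap.sum_apply]

/-- Schur's lemma for invariant symmetric forms. -/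
lemma IsAdIrreducible.exists_form_eq (hpos : ∀ X : 𝔤, X ≠ 0 → 0 < negForm 𝔤 X X) {H : Subgroup G}
    (hU : IsAdIrreducible H U) (q : LinearMap.BilinForm ℝ 𝔤) (hsymm : ∀ X Y, q X Y = q Y X)
    (hinv : ∀ a ∈ H, ∀ X ∈ U, ∀ Y ∈ U, q (adjointRep E a X) (adjointRep E a Y) = q X Y) :
    ∃ c : ℝ, ∀ X ∈ U, ∀ Y ∈ U, q X Y = c * negForm 𝔤 X Y := by
  obtain ⟨e, he⟩ := exists_isFrame hpos U
  have : Nontrivial U := Submodule.nontrivial_iff_ne_bot.mpr hU.2.1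
  -- The operator on U which represents q with respect to B; symmetry of q makes it symmetric, so it
  -- has a real eigenvalue c.
  let T : U →ₗ[ℝ] U := ∑ i, ((q.flip (e i)).comp U.subtype).smulRight (⟨e i, he.mem i⟩ : U)
  have hTB : ∀ (X : U) (Y : 𝔤), Y ∈ U → negForm 𝔤 (T X) Y = q X Y := by
    intro X Y hY
    have h1 : (T X : 𝔤) = ∑ i, q X (e i) • e i := by simp [T]
    rw [h1, map_sum, LinearMap.sum_apply]
    conv_rhs => rw [he.expand Y hY, map_sum]
    refine Finset.sum_congr rfl fun i _ => ?_
    rw [map_smul, LinearMap.smul_apply, map_smul, smul_eq_mul, smul_eq_mul, negForm_symm, mul_comm]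
  obtain ⟨c, x, hx0, hx⟩ := exists_eigenvector_of_pos
    ((negForm 𝔤).compl₁₂ U.subtype U.subtype) (fun x y => negForm_symm _ _)
    (fun x hx => hpos _ (by simpa using hx)) T (fun x y => by
      simp only [LinearMap.compl₁₂_apply, Submodule.subtype_apply]
      rw [hTB _ _ y.2, negForm_symm, hTB _ _ x.2, hsymm])
  -- The eigenspace of c, written without the operator; it is an `Ad H`-submodule and nonzero, hence
  -- all of U.
  let U' : Submodule ℝ 𝔤 :=
    { carrier := {X | X ∈ U ∧ ∀ Y ∈ U, q X Y = c * negForm 𝔤 X Y}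
      add_mem' := fun {X X'} h h' => ⟨U.add_mem h.1 h'.1, fun Y hY => by
        simp only [map_add, LinearMap.add_apply, h.2 Y hY, h'.2 Y hY]; ring⟩
      zero_mem' := ⟨U.zero_mem, fun Y _ => by simp⟩
      smul_mem' := fun r X h => ⟨U.smul_mem r h.1, fun Y hY => by
        simp only [map_smul, LinearMap.smul_apply, h.2 Y hY, smul_eq_mul]; ring⟩ }
  have hU'inv : IsAdInvariant H U' := by
    intro a ha X hX
    refine ⟨hU.1 a ha X hX.1, fun Y hY => ?_⟩
    have hY' := hU.1 a⁻¹ (H.inv_mem ha) Y hY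
    rw [negForm_adjointRep_left, ← hX.2 _ hY', ← hinv a ha X hX.1 _ hY', adjointRep_apply_inv]
  have hxU' : (x : 𝔤) ∈ U' := by
    refine ⟨x.2, fun Y hY => ?_⟩
    rw [← hTB x Y hY, hx]
    simp
  rcases hU.2.2 U' (fun X hX => hX.1) hU'inv with h | h
  · rw [h] at hxU'
    exact absurd (Subtype.ext (by simpa using hxU')) hx0
  · exact ⟨c, fun X hX Y hY => by rw [← h] at hX; exact hX.2 Y hY⟩

end CasimirOperator

/-! ### The form B composed with an orthogonal projection -/

section FrameProjection

variable {𝔤 : Type*} [LieRing 𝔤] [LieAlgebra ℝ 𝔤]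
  {ι : Type*} [Fintype ι] [DecidableEq ι] {U : Submodule ℝ 𝔤} {e : ι → 𝔤}

/-- The form `B(P X, P Y)`, with `P` the orthogonal projection to the span of `e`. -/
def projForm (e : ι → 𝔤) : LinearMap.BilinForm ℝ 𝔤 :=
  ∑ i, LinearMap.BilinForm.linMulLin ((negForm 𝔤).flip (e i)) ((negForm 𝔤).flip (e i))

omit [DecidableEq ι] in
lemma projForm_apply (e : ι → 𝔤) (X Y : 𝔤) :
    projForm e X Y = ∑ i, negForm 𝔤 X (e i) * negForm 𝔤 Y (e i) := by
  simp [projForm, LinearMap.sum_apply]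

omit [DecidableEq ι] in
lemma projForm_symm (e : ι → 𝔤) (X Y : 𝔤) : projForm e X Y = projForm e Y X := by
  simp only [projForm_apply, mul_comm]

omit [DecidableEq ι] in
lemma projForm_self_nonneg (e : ι → 𝔤) (X : 𝔤) : 0 ≤ projForm e X X := by
  rw [projForm_apply]; exact Finset.sum_nonneg fun i _ => mul_self_nonneg _

lemma IsFrame.exists_proj (he : IsFrame U e) (X : 𝔤) :
    ∃ Y ∈ U, ∀ Z ∈ U, negForm 𝔤 X Z = negForm 𝔤 Y Z := by
  refine ⟨∑ i, negForm 𝔤 X (e i) • e i, Submodule.sum_mem _ fun i _ =>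
    Submodule.smul_mem _ _ (he.mem i), fun Z hZ => ?_⟩
  conv_lhs => rw [he.expand Z hZ]
  simp only [map_sum, map_smul, LinearMap.sum_apply, LinearMap.smul_apply, smul_eq_mul]
  refine Finset.sum_congr rfl fun i _ => ?_
  rw [negForm_symm (e i) Z, mul_comm]

lemma IsFrame.projForm_of_mem (he : IsFrame U e) {X : 𝔤} (hX : X ∈ U) (Y : 𝔤) :
    projForm e X Y = negForm 𝔤 X Y := by
  rw [projForm_apply]
  conv_rhs => rw [he.expand X hX]
  simp only [map_sum, map_smul, LinearMap.sum_apply, LinearMap.smul_apply, smul_eq_mul]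
  refine Finset.sum_congr rfl fun i _ => ?_
  rw [negForm_symm Y]

lemma IsFrame.projForm_of_orthogonal (he : IsFrame U e) {X : 𝔤}
    (hX : ∀ Z ∈ U, negForm 𝔤 X Z = 0) (Y : 𝔤) : projForm e X Y = 0 := by
  rw [projForm_apply]
  exact Finset.sum_eq_zero fun i _ => by rw [hX _ (he.mem i), zero_mul]

lemma IsFrame.projForm_congr (he : IsFrame U e) {X X' Y Y' : 𝔤}
    (hX : ∀ Z ∈ U, negForm 𝔤 X Z = negForm 𝔤 X' Z) (hY : ∀ Z ∈ U, negForm 𝔤 Y Z = negForm 𝔤 Y' Z) :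
    projForm e X Y = projForm e X' Y' := by
  simp only [projForm_apply]
  exact Finset.sum_congr rfl fun i _ => by rw [hX _ (he.mem i), hY _ (he.mem i)]

/-- Both frames give B of the projections to U. Applied to a frame moved by Ad, this yields the
invariance of `projForm`. -/
lemma IsFrame.projForm_eq {κ : Type*} [Fintype κ] [DecidableEq κ] {f : κ → 𝔤} (he : IsFrame U e)
    (hf : IsFrame U f) (X Y : 𝔤) : projForm e X Y = projForm f X Y := by
  obtain ⟨X', hX', hXX'⟩ := he.exists_proj X
  obtain ⟨Y', hY', hYY'⟩ := he.exists_proj Y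
  rw [he.projForm_congr hXX' hYY', hf.projForm_congr hXX' hYY', he.projForm_of_mem hX',
    hf.projForm_of_mem hX']

end FrameProjection

/-! ### The symmetric fibration and positivity of γ -/

section SymmetricFibrations

variable {E : Type*} [NormedAddCommGroup E] [NormedSpace ℝ E] [FiniteDimensional ℝ E]
  {G : Type*} [TopologicalSpace G] [ChartedSpace E G] [Group G] [LieGroup 𝓘(ℝ, E) ∞ G]

lemma IsFrame.projForm_adjointRep {ι : Type*} [Fintype ι] [DecidableEq ι]
    {U : Submodule ℝ (GroupLieAlgebra 𝓘(ℝ, E) G)} {e : ι → GroupLieAlgebra 𝓘(ℝ, E) G}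
    (he : IsFrame U e) {H : Subgroup G} (hU : IsAdInvariant H U) {a : G} (ha : a ∈ H)
    (X Y : GroupLieAlgebra 𝓘(ℝ, E) G) :
    projForm e (_root_.adjointRep E a X) (_root_.adjointRep E a Y) = projForm e X Y := by
  rw [he.projForm_eq (he.adjointRep hU ha), projForm_apply, projForm_apply]
  simp only [negForm_adjointRep]

omit [FiniteDimensional ℝ E] [LieGroup 𝓘(ℝ, E) ∞ G] in
lemma lieAlgebraOf_mono {L K : Subgroup G} (h : L ≤ K) : lieAlgebraOf E L ≤ lieAlgebraOf E K :=
  Submodule.span_mono fun _ ⟨c, hc, h'⟩ => ⟨c, fun t => h (hc t), h'⟩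

lemma mem_horizontalSpace_iff {K : Subgroup G} {X : GroupLieAlgebra 𝓘(ℝ, E) G} :
    X ∈ horizontalSpace E K ↔
      ∀ Y ∈ lieAlgebraOf E K, negForm (GroupLieAlgebra 𝓘(ℝ, E) G) Y X = 0 := by
  refine LinearMap.BilinForm.mem_orthogonal_iff.trans
    (forall₂_congr fun Y _ => ?_)
  exact neg_eq_zero.symm

lemma mem_verticalSpace_iff {K L : Subgroup G} {X : GroupLieAlgebra 𝓘(ℝ, E) G} :
    X ∈ verticalSpace E K L ↔ X ∈ lieAlgebraOf E K ∧
      ∀ Y ∈ lieAlgebraOf E L, negForm (GroupLieAlgebra 𝓘(ℝ, E) G) Y X = 0 := by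
  refine Submodule.mem_inf.trans (and_congr_right fun _ =>
    LinearMap.BilinForm.mem_orthogonal_iff.trans (forall₂_congr fun Y _ => ?_))
  exact neg_eq_zero.symm

lemma verticalSpace_le {K L : Subgroup G} : verticalSpace E K L ≤ lieAlgebraOf E K := inf_le_left

variable {K L : Subgroup G}
  {V : Type*} [NormedAddCommGroup V] [NormedSpace ℝ V] [ChartedSpace V (G ⧸ L)]
  {W : Type*} [NormedAddCommGroup W] [NormedSpace ℝ W] [ChartedSpace W (G ⧸ K)]

variable (E K L V W) in
/-- A fibration `G ⧸ L → G ⧸ K` of a homogeneous space of a group with positive definite form `B`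
with irreducible symmetric base and fibre. -/
structure IsSymmetricFibration : Prop where
  le : L ≤ K
  submersion_fst : Manifold.IsSubmersion 𝓘(ℝ, E) 𝓘(ℝ, V) ∞ (QuotientGroup.mk : G → G ⧸ L)
  submersion_snd : Manifold.IsSubmersion 𝓘(ℝ, E) 𝓘(ℝ, W) ∞ (QuotientGroup.mk : G → G ⧸ K)
  pos : ∀ X : GroupLieAlgebra 𝓘(ℝ, E) G, X ≠ 0 → 0 < negForm (GroupLieAlgebra 𝓘(ℝ, E) G) X X
  connected : IsConnected (L : Set G)
  lie_horizontal : ∀ X ∈ horizontalSpace E K, ∀ Y ∈ horizontalSpace E K, ⁅X, Y⁆ ∈ lieAlgebraOf E K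
  irreducible_horizontal : IsAdIrreducible K (horizontalSpace E K)
  lie_vertical : ∀ X ∈ verticalSpace E K L, ∀ Y ∈ verticalSpace E K L, ⁅X, Y⁆ ∈ lieAlgebraOf E L
  irreducible_vertical : IsAdIrreducible L (verticalSpace E K L)
  one_lt_finrank : 1 < Module.finrank ℝ (verticalSpace E K L)
  noCommon : NoCommonAdSubmodule L (verticalSpace E K L) (horizontalSpace E K)

namespace IsSymmetricFibration

local notation "𝔤" => GroupLieAlgebra 𝓘(ℝ, E) G

variable (F : IsSymmetricFibration E K L V W)
include F

lemma sup_eq : lieAlgebraOf E L ⊔ verticalSpace E K L = lieAlgebraOf E K := by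
  refine le_antisymm (sup_le (lieAlgebraOf_mono F.le) verticalSpace_le) fun X hX => ?_
  obtain ⟨e, he⟩ := exists_isFrame F.pos (lieAlgebraOf E L)
  obtain ⟨Y, hY, h⟩ := he.exists_proj X
  rw [← add_sub_cancel Y X]
  refine Submodule.add_mem_sup hY (mem_verticalSpace_iff.mpr
    ⟨Submodule.sub_mem _ hX (lieAlgebraOf_mono F.le hY), fun Z hZ => ?_⟩)
  rw [map_sub, negForm_symm Z, negForm_symm Z, h Z hZ, sub_self]

/-- The brackets of 𝔩 with 𝔭 and of 𝔨 with 𝔫 are the infinitesimal forms of the Ad-invariance of 𝔭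
and 𝔫; the other inclusions are the symmetry of base and fibre. -/
lemma isSymmetricSplitting :
    IsSymmetricSplitting (lieAlgebraOf E L) (verticalSpace E K L) (horizontalSpace E K) where
  pos := F.pos
  orth_lp X hX Y hY := (mem_verticalSpace_iff.mp hY).2 X hX
  orth_ln X hX Y hY := mem_horizontalSpace_iff.mp hY X (lieAlgebraOf_mono F.le hX)
  orth_pn X hX Y hY := mem_horizontalSpace_iff.mp hY X (verticalSpace_le hX)
  sup := by
    rw [F.sup_eq, eq_top_iff]
    intro X _
    obtain ⟨e, he⟩ := exists_isFrame F.pos (lieAlgebraOf E K)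
    obtain ⟨Y, hY, h⟩ := he.exists_proj X
    rw [← add_sub_cancel Y X]
    refine Submodule.add_mem_sup hY (mem_horizontalSpace_iff.mpr fun Z hZ => ?_)
    rw [map_sub, negForm_symm Z, negForm_symm Z, h Z hZ, sub_self]
  lie_lp X hX Y hY := lie_mem_of_isAdInvariant F.submersion_fst F.irreducible_vertical.1 hX hY
  lie_ln X hX Y hY := lie_mem_of_isAdInvariant F.submersion_snd F.irreducible_horizontal.1
    (lieAlgebraOf_mono F.le hX) hY
  lie_pp := F.lie_vertical
  lie_pn X hX Y hY := lie_mem_of_isAdInvariant F.submersion_snd F.irreducible_horizontal.1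
    (verticalSpace_le hX) hY
  lie_nn X hX Y hY := by rw [F.sup_eq]; exact F.lie_horizontal X hX Y hY

lemma isFrame_sum {ι μ : Type*} [Fintype ι] [Fintype μ] [DecidableEq ι] [DecidableEq μ]
    {el : μ → 𝔤} {ep : ι → 𝔤} (hl : IsFrame (lieAlgebraOf E L) el)
    (hp : IsFrame (verticalSpace E K L) ep) : IsFrame (lieAlgebraOf E K) (Sum.elim el ep) := by
  have h := hl.sum hp F.isSymmetricSplitting.orth_lp
  rwa [F.sup_eq] at h

/-- The Casimir operator of `𝔨` preserves `𝔭`. -/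
lemma casimir_mem_vertical {X : 𝔤} (hX : X ∈ verticalSpace E K L) :
    casimir (lieAlgebraOf E K) X ∈ verticalSpace E K L := by
  have S := F.isSymmetricSplitting
  obtain ⟨el, hl⟩ := exists_isFrame F.pos (lieAlgebraOf E L)
  obtain ⟨ep, hp⟩ := exists_isFrame F.pos (verticalSpace E K L)
  rw [(F.isFrame_sum hl hp).casimir_eq]
  refine Submodule.neg_mem _ (Submodule.sum_mem _ ?_)
  rintro (i | i) _
  · exact S.lie_lp _ (hl.mem i) _ (S.lie_lp _ (hl.mem i) _ hX)
  · exact S.lie_pl (hp.mem i) (S.lie_pp _ (hp.mem i) _ hX)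

/-- The Casimir operator of `𝔭` preserves `𝔫`. -/
lemma casimir_mem_horizontal {X : 𝔤} (hX : X ∈ horizontalSpace E K) :
    casimir (verticalSpace E K L) X ∈ horizontalSpace E K := by
  have S := F.isSymmetricSplitting
  obtain ⟨ep, hp⟩ := exists_isFrame F.pos (verticalSpace E K L)
  rw [hp.casimir_eq]
  exact Submodule.neg_mem _ (Submodule.sum_mem _ fun i _ =>
    S.lie_pn _ (hp.mem i) _ (S.lie_pn _ (hp.mem i) _ hX))

/-- The Casimir operator of `𝔨` acts on `𝔭` as a positive scalar. -/
theorem exists_casimir_vertical :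
    ∃ γ : ℝ, 0 < γ ∧ CasimirIsScalarOn (lieAlgebraOf E K) (verticalSpace E K L) γ := by
  obtain ⟨e, he⟩ := exists_isFrame F.pos (lieAlgebraOf E K)
  obtain ⟨γ, hγ⟩ := F.irreducible_vertical.exists_form_eq F.pos (casimirBilin e)
    (fun X Y => by simp only [casimirBilin_apply, casimirForm]; simp only [negForm_symm ⁅_, X⁆])
    (fun a ha X _ Y _ => by
      rw [casimirBilin_apply, casimirBilin_apply]
      exact he.casimirForm_adjointRep (isAdInvariant_lieAlgebraOf F.submersion_snd) (F.le ha) X Y)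
  simp only [casimirBilin_apply] at hγ
  have hsc := (casimirIsScalarOn_iff F.pos he (fun X hX => F.casimir_mem_vertical hX) γ).mpr hγ
  refine ⟨γ, ?_, hsc⟩
  by_contra hneg
  -- γ B(Y, Y) is a sum of squared lengths of brackets with a frame of 𝔨; if γ ≤ 0 they all vanish.
  have hzero : ∀ Y ∈ verticalSpace E K L, ∀ X ∈ lieAlgebraOf E K, ⁅X, Y⁆ = 0 := by
    intro Y hY X hX
    have h0 : ∀ Z : 𝔤, 0 ≤ negForm 𝔤 Z Z := fun Z => by
      by_cases hZ : Z = 0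
      · simp [hZ]
      · exact (F.pos Z hZ).le
    have h1 : ∑ i, negForm 𝔤 ⁅e i, Y⁆ ⁅e i, Y⁆ = 0 := by
      refine le_antisymm ?_ (Finset.sum_nonneg fun i _ => h0 _)
      have h2 : ∑ i, negForm 𝔤 ⁅e i, Y⁆ ⁅e i, Y⁆ = γ * negForm 𝔤 Y Y := hγ Y hY Y hY
      rw [h2]
      exact mul_nonpos_of_nonpos_of_nonneg (not_lt.mp hneg) (h0 Y)
    rw [Finset.sum_eq_zero_iff_of_nonneg fun i _ => h0 _] at h1
    have h3 : ∀ i, ⁅e i, Y⁆ = 0 := fun i => by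
      by_contra hne
      exact (F.pos _ hne).ne' (h1 i (Finset.mem_univ i))
    rw [he.expand X hX, sum_lie]
    exact Finset.sum_eq_zero fun i _ => by rw [smul_lie, h3, smul_zero]
  obtain ⟨Y, hY, hY0⟩ := Submodule.exists_mem_ne_zero_of_ne_bot F.irreducible_vertical.2.1
  have hle : Submodule.span ℝ {Y} ≤ verticalSpace E K L := by
    rwa [Submodule.span_le, Set.singleton_subset_iff]
  -- L is connected, so `Ad L` fixes every vector of the line of Y. This line is then a submodule,
  -- and irreducibility would make 𝔭 one-dimensional.
  rcases F.irreducible_vertical.2.2 (Submodule.span ℝ {Y}) hle (fun a ha X hX => by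
    rwa [adjointRep_eq_self_of_lie_eq_zero F.submersion_fst F.connected X
      (fun Z hZ => hzero X (hle hX) Z (lieAlgebraOf_mono F.le hZ)) ha]) with h | h
  · exact hY0 (Submodule.span_singleton_eq_bot.mp h)
  · have h1 := F.one_lt_finrank
    rw [← h, finrank_span_singleton hY0] at h1
    exact lt_irrefl _ h1

end IsSymmetricFibration

end SymmetricFibrations

/-! ### Existence, Ricci curvature and Einstein equation of binormal metrics -/

section BinormalMetrics

variable {E : Type*} [NormedAddCommGroup E] [NormedSpace ℝ E] [FiniteDimensional ℝ E]
  {G : Type*} [TopologicalSpace G] [ChartedSpace E G] [Group G] [LieGroup 𝓘(ℝ, E) ∞ G]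
  {K L : Subgroup G}
  {V : Type*} [NormedAddCommGroup V] [NormedSpace ℝ V] [ChartedSpace V (G ⧸ L)]
  {W : Type*} [NormedAddCommGroup W] [NormedSpace ℝ W] [ChartedSpace W (G ⧸ K)]

local notation "𝔤" => GroupLieAlgebra 𝓘(ℝ, E) G

omit [FiniteDimensional ℝ E] in
lemma fundField_add (F : E × V → V) (e₀ X Y : E) (v : V) :
    fundField F e₀ (X + Y) v = fundField F e₀ X v + fundField F e₀ Y v := by
  simp only [fundField]
  rw [← map_add, Prod.mk_add_mk, add_zero]

omit [FiniteDimensional ℝ E] in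
lemma fundField_smul (F : E × V → V) (e₀ : E) (c : ℝ) (X : E) (v : V) :
    fundField F e₀ (c • X) v = c • fundField F e₀ X v := by
  simp only [fundField]
  rw [← map_smul, Prod.smul_mk, smul_zero]

omit [FiniteDimensional ℝ E] [LieGroup 𝓘(ℝ, E) ∞ G] in
lemma orbitMap_add (a : G) (X Y : 𝔤) :
    orbitMap E L V a (X + Y) = orbitMap E L V a X + orbitMap E L V a Y :=
  (orbitMap E L V a).map_add X Y

/-- A bilinear form on a finite-dimensional space as a continuous bilinear map. -/
def contForm (q : LinearMap.BilinForm ℝ E) : E →L[ℝ] E →L[ℝ] ℝ :=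
  LinearMap.toContinuousLinearMap (LinearMap.toContinuousLinearMap.toLinearMap ∘ₗ q)

lemma exists_metric_of_bilinForm [IsManifold 𝓘(ℝ, V) ∞ (G ⧸ L)] [FiniteDimensional ℝ V]
    (hL : Manifold.IsSubmersion 𝓘(ℝ, E) 𝓘(ℝ, V) ∞ (QuotientGroup.mk : G → G ⧸ L))
    (q : LinearMap.BilinForm ℝ 𝔤) (hsymm : ∀ X Y, q X Y = q Y X)
    (hker : ∀ X ∈ lieAlgebraOf E L, ∀ Y, q X Y = 0)
    (hpos : ∀ X, X ∉ lieAlgebraOf E L → 0 < q X X)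
    (hinv : ∀ k ∈ L, ∀ X Y, q (adjointRep E k X) (adjointRep E k Y) = q X Y) :
    ∃ g : SmoothMetric V (G ⧸ L), ∀ (a : G) (X Y : 𝔤),
      g.at ((a : G) : G ⧸ L) (orbitMap E L V a X) (orbitMap E L V a Y) = q X Y :=
  exists_metric_of_form hL (contForm (E := E) q) hsymm
    (fun X Y hX => hker X ((mem_lieAlgebraOf_iff hL X).mpr hX) Y)
    (fun X hX => hpos X fun h => hX ((mem_lieAlgebraOf_iff hL X).mp h)) hinv

namespace IsSymmetricFibration

lemma exists_add_add (F : IsSymmetricFibration E K L V W) (U : 𝔤) :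
    ∃ X ∈ lieAlgebraOf E L, ∃ Y ∈ verticalSpace E K L, ∃ Z ∈ horizontalSpace E K,
      U = X + Y + Z := by
  have h : U ∈ lieAlgebraOf E L ⊔ verticalSpace E K L ⊔ horizontalSpace E K := by
    rw [F.isSymmetricSplitting.sup]; trivial
  obtain ⟨T, hT, Z, hZ, rfl⟩ := Submodule.mem_sup.mp h
  obtain ⟨X, hX, Y, hY, rfl⟩ := Submodule.mem_sup.mp hT
  exact ⟨X, hX, Y, hY, Z, hZ, rfl⟩

variable [IsManifold 𝓘(ℝ, V) ∞ (G ⧸ L)] [IsManifold 𝓘(ℝ, W) ∞ (G ⧸ K)]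
  {ι κ : Type*} [Fintype ι] [Fintype κ] [DecidableEq ι] [DecidableEq κ]
  {ep : ι → GroupLieAlgebra 𝓘(ℝ, E) G} {en : κ → GroupLieAlgebra 𝓘(ℝ, E) G}

variable (F : IsSymmetricFibration E K L V W) (hp : IsFrame (verticalSpace E K L) ep)
  (hn : IsFrame (horizontalSpace E K) en)

include F hp hn

omit [IsManifold 𝓘(ℝ, V) ∞ (G ⧸ L)] [IsManifold 𝓘(ℝ, W) ∞ (G ⧸ K)] in
lemma projForm_add {X X' Y Y' Z Z' : 𝔤} (hX : X ∈ lieAlgebraOf E L) (hX' : X' ∈ lieAlgebraOf E L)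
    (hY : Y ∈ verticalSpace E K L) (hY' : Y' ∈ verticalSpace E K L)
    (hZ : Z ∈ horizontalSpace E K) (hZ' : Z' ∈ horizontalSpace E K) :
    projForm ep (X + Y + Z) (X' + Y' + Z') = negForm 𝔤 Y Y' ∧
    projForm en (X + Y + Z) (X' + Y' + Z') = negForm 𝔤 Z Z' := by
  have S := F.isSymmetricSplitting
  have h1 : ∀ T ∈ verticalSpace E K L, negForm 𝔤 Z T = 0 := fun T hT => by
    rw [negForm_symm, S.orth_pn T hT Z hZ]
  have h1' : ∀ T ∈ verticalSpace E K L, negForm 𝔤 Z' T = 0 := fun T hT => by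
    rw [negForm_symm, S.orth_pn T hT Z' hZ']
  constructor
  · rw [hp.projForm_congr (X' := Y) (Y' := Y'), hp.projForm_of_mem hY]
    · intro T hT
      simp only [map_add, LinearMap.add_apply, S.orth_lp X hX T hT, h1 T hT, zero_add, add_zero]
    · intro T hT
      simp only [map_add, LinearMap.add_apply, S.orth_lp X' hX' T hT, h1' T hT, zero_add, add_zero]
  · rw [hn.projForm_congr (X' := Z) (Y' := Z'), hn.projForm_of_mem hZ]
    · intro T hT
      simp only [map_add, LinearMap.add_apply, S.orth_ln X hX T hT, S.orth_pn Y hY T hT, zero_add]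
    · intro T hT
      simp only [map_add, LinearMap.add_apply, S.orth_ln X' hX' T hT, S.orth_pn Y' hY' T hT,
        zero_add]

omit [IsManifold 𝓘(ℝ, W) ∞ (G ⧸ K)] in
/-- A binormal metric at all points, in terms of the projections to `𝔭` and `𝔫`. -/
lemma at_orbitMap {g : SmoothMetric V (G ⧸ L)} {s t : ℝ} (hg : IsBinormalMetric E K g s t)
    (a : G) (U U' : 𝔤) :
    g.at ((a : G) : G ⧸ L) (orbitMap E L V a U) (orbitMap E L V a U') =
      s * projForm ep U U' + t * projForm en U U' := by
  refine (hg.1.at_orbitMap F.submersion_fst a U U').trans ?_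
  obtain ⟨X, hX, Y, hY, Z, hZ, rfl⟩ := F.exists_add_add U
  obtain ⟨X', hX', Y', hY', Z', hZ', rfl⟩ := F.exists_add_add U'
  obtain ⟨h1, h2⟩ := F.projForm_add hp hn hX hX' hY hY' hZ hZ'
  rw [h1, h2]
  have h3 := hg.2 Y hY Y' hY' Z hZ Z' hZ'
  have h4 : ∀ X ∈ lieAlgebraOf E L, orbitMap E L V (1 : G) X = 0 := fun X hX =>
    (mem_lieAlgebraOf_iff F.submersion_fst X).mp hX
  rw [← orbitMap_one] at h3
  rw [add_assoc, add_assoc, orbitMap_add 1 X, orbitMap_add 1 X', h4 X hX, h4 X' hX', zero_add,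
    zero_add]
  exact h3

omit [IsManifold 𝓘(ℝ, W) ∞ (G ⧸ K)] in
/-- The invariant metrics given by the forms `s B_𝔭 ⊕ t B_𝔫` exist. -/
theorem exists_isBinormalMetric [FiniteDimensional ℝ V] {s t : ℝ} (hs : 0 < s) (ht : 0 < t) :
    ∃ g : SmoothMetric V (G ⧸ L), IsBinormalMetric E K g s t := by
  have S := F.isSymmetricSplitting
  let q : LinearMap.BilinForm ℝ 𝔤 := s • projForm ep + t • projForm en
  have hq : ∀ X Y : 𝔤, q X Y = s * projForm ep X Y + t * projForm en X Y := fun X Y => rfl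
  have key := exists_metric_of_bilinForm F.submersion_fst q (fun X Y => by
      rw [hq, hq, projForm_symm ep, projForm_symm en])
    (fun X hX Y => by
      rw [hq, hp.projForm_of_orthogonal (S.orth_lp _ hX),
        hn.projForm_of_orthogonal (S.orth_ln _ hX)]
      simp)
    (fun X hX => by
      rw [hq]
      have h1 := projForm_self_nonneg ep X
      have h2 := projForm_self_nonneg en X
      by_contra hneg
      have h3 : projForm ep X X = 0 := by nlinarith
      have h4 : projForm en X X = 0 := by nlinarith
      refine hX ?_
      obtain ⟨X₁, hX₁, Y, hY, Z, hZ, hU⟩ := F.exists_add_add X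
      obtain ⟨e1, e2⟩ := F.projForm_add hp hn hX₁ hX₁ hY hY hZ hZ
      rw [← hU] at e1 e2
      have hY0 : Y = 0 := by
        by_contra hne; exact (F.pos Y hne).ne' (e1.symm.trans h3)
      have hZ0 : Z = 0 := by
        by_contra hne; exact (F.pos Z hne).ne' (e2.symm.trans h4)
      rw [hU, hY0, hZ0, add_zero, add_zero]
      exact hX₁)
    (fun k hk X Y => by
      rw [hq, hq, hp.projForm_adjointRep F.irreducible_vertical.1 hk X Y,
        hn.projForm_adjointRep F.irreducible_horizontal.1 (F.le hk) X Y])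
  obtain ⟨g, hg⟩ := key
  refine ⟨g, isInvariantMetric_of_at_orbitMap F.submersion_fst hg, fun X hX X' hX' Y hY Y' hY' =>
    ?_⟩
  have h := hg 1 (X + Y) (X' + Y')
  rw [orbitMap_one] at h
  refine h.trans ((hq _ _).trans ?_)
  obtain ⟨h1, h2⟩ := F.projForm_add hp hn (Submodule.zero_mem _) (Submodule.zero_mem _)
    hX hX' hY hY'
  rw [zero_add, zero_add] at h1 h2
  rw [h1, h2]; rfl

omit [IsManifold 𝓘(ℝ, W) ∞ (G ⧸ K)] in
lemma isBinormalKillingAlgebra {g : SmoothMetric V (G ⧸ L)} {s t : ℝ}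
    (hg : IsBinormalMetric E K g s t) (a : G) :
    IsBinormalKillingAlgebra (g.coeff a) (fun X : 𝔤 =>
      fundField (chartAct E L V a) (extChartAt 𝓘(ℝ, E) (1 : G) 1) X)
      (extChartAt 𝓘(ℝ, V) ((a : G) : G ⧸ L) ((a : G) : G ⧸ L))
      (lieAlgebraOf E L) (verticalSpace E K L) (horizontalSpace E K) s t := by
  have S := F.isSymmetricSplitting
  have hmet : ∀ U X : 𝔤, g.coeff a (extChartAt 𝓘(ℝ, V) ((a : G) : G ⧸ L) ((a : G) : G ⧸ L))
      (fundField (chartAct E L V a) (extChartAt 𝓘(ℝ, E) (1 : G) 1) U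
        (extChartAt 𝓘(ℝ, V) ((a : G) : G ⧸ L) ((a : G) : G ⧸ L)))
      (fundField (chartAct E L V a) (extChartAt 𝓘(ℝ, E) (1 : G) 1) X
        (extChartAt 𝓘(ℝ, V) ((a : G) : G ⧸ L) ((a : G) : G ⧸ L))) =
      s * projForm ep X U + t * projForm en X U := by
    intro U X
    refine (congrArg₂ (fun u w : V => g.coeff ((a : G) : G ⧸ L) _ u w)
      (fundField_chartAct_self F.submersion_fst a U)
      (fundField_chartAct_self F.submersion_fst a X)).trans ?_
    rw [projForm_symm ep, projForm_symm en, g.coeff_self]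
    exact F.at_orbitMap hp hn hg a U X
  constructor
  · exact hg.1.isKillingAlgebra F.submersion_fst a
  · exact fun X Y => fundField_add _ _ _ _ _
  · exact fun c X => fundField_smul _ _ _ _ _
  · intro v
    obtain ⟨X, hX⟩ := orbitMap_surjective F.submersion_fst a v
    exact ⟨X, (fundField_chartAct_self F.submersion_fst a X).trans hX⟩
  · intro U X hX
    rw [hmet, hp.projForm_of_orthogonal (S.orth_lp _ hX), hn.projForm_of_orthogonal (S.orth_ln _ hX)]
    simp
  · intro U X hX
    rw [hmet, hp.projForm_of_mem hX, hn.projForm_of_orthogonal (S.orth_pn _ hX), negForm_symm X]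
    simp
  · intro U X hX
    rw [hmet, hn.projForm_of_mem hX, hp.projForm_of_orthogonal fun Z hZ => by
      rw [negForm_symm, S.orth_pn _ hZ _ hX], negForm_symm X]
    simp

omit [IsManifold 𝓘(ℝ, W) ∞ (G ⧸ K)] in
/-- The Ricci curvature of binormal metrics. -/
theorem ricci_eq [FiniteDimensional ℝ V] {g : SmoothMetric V (G ⧸ L)} {s t : ℝ} (hs : s ≠ 0)
    (ht : t ≠ 0) (hg : IsBinormalMetric E K g s t) {γ : ℝ}
    (hγ : CasimirIsScalarOn (lieAlgebraOf E K) (verticalSpace E K L) γ) (a : G)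
    {X Y Z X' Y' Z' : 𝔤} (hX : X ∈ lieAlgebraOf E L) (hX' : X' ∈ lieAlgebraOf E L)
    (hY : Y ∈ verticalSpace E K L) (hY' : Y' ∈ verticalSpace E K L)
    (hZ : Z ∈ horizontalSpace E K) (hZ' : Z' ∈ horizontalSpace E K) :
    g.ricci ((a : G) : G ⧸ L) (orbitMap E L V a (X + Y + Z)) (orbitMap E L V a (X' + Y' + Z')) =
      (γ / 2 + (1 - γ) * s ^ 2 / (4 * t ^ 2)) * negForm 𝔤 Y Y'
      + ((1 / 2 : ℝ) * negForm 𝔤 Z Z' - s / (2 * t) * casimirForm ep Z Z') := by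
  obtain ⟨el, hl⟩ := exists_isFrame F.pos (lieAlgebraOf E L)
  have h := (F.isBinormalKillingAlgebra hp hn hg a).ricci_eq F.isSymmetricSplitting hs ht hl hp hn
    ((casimirIsScalarOn_iff F.pos (F.isFrame_sum hl hp) (fun X hX => F.casimir_mem_vertical hX)
      γ).mp hγ) hY hY' hZ hZ'
  rw [← h]
  have h4 : ∀ X ∈ lieAlgebraOf E L, orbitMap E L V a X = 0 := fun X hX =>
    (orbitMap_eq_zero_iff F.submersion_fst a X).mpr
      ((mem_lieAlgebraOf_iff F.submersion_fst X).mp hX)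
  rw [add_assoc, add_assoc, orbitMap_add a X, orbitMap_add a X', h4 X hX, h4 X' hX', zero_add,
    zero_add]
  exact (congrArg₂ (fun u w : V => g.ricci ((a : G) : G ⧸ L) u w)
      (fundField_chartAct_self F.submersion_fst a (Y + Z))
      (fundField_chartAct_self F.submersion_fst a (Y' + Z'))).symm

omit [IsManifold 𝓘(ℝ, W) ∞ (G ⧸ K)] in
/-- The Einstein equation for binormal metrics. -/
theorem isEinstein_iff [FiniteDimensional ℝ V] {g : SmoothMetric V (G ⧸ L)} {s t : ℝ} (hs : s ≠ 0)
    (ht : t ≠ 0) (hg : IsBinormalMetric E K g s t) {γ : ℝ}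
    (hγ : CasimirIsScalarOn (lieAlgebraOf E K) (verticalSpace E K L) γ) :
    g.IsEinstein ↔ ∃ b, CasimirIsScalarOn (verticalSpace E K L) (horizontalSpace E K) b ∧
      2 * γ * (t / s) ^ 2 - 2 * (t / s) + (1 - γ + 2 * b) = 0 := by
  have hcas := fun b => casimirIsScalarOn_iff F.pos hp (U' := horizontalSpace E K)
    (fun X hX => F.casimir_mem_horizontal hX) b
  constructor
  · rintro ⟨c, hc⟩
    have key : ∀ Y ∈ verticalSpace E K L, ∀ Y' ∈ verticalSpace E K L,
        ∀ Z ∈ horizontalSpace E K, ∀ Z' ∈ horizontalSpace E K,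
        (γ / 2 + (1 - γ) * s ^ 2 / (4 * t ^ 2)) * negForm 𝔤 Y Y'
        + ((1 / 2 : ℝ) * negForm 𝔤 Z Z' - s / (2 * t) * casimirForm ep Z Z') =
        c * (s * negForm 𝔤 Y Y' + t * negForm 𝔤 Z Z') := by
      intro Y hY Y' hY' Z hZ Z' hZ'
      have h0 := Submodule.zero_mem (lieAlgebraOf E L)
      obtain ⟨e1, e2⟩ := F.projForm_add hp hn h0 h0 hY hY' hZ hZ'
      have e3 := F.at_orbitMap hp hn hg 1 (0 + Y + Z) (0 + Y' + Z')
      rw [e1, e2] at e3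
      rw [← F.ricci_eq hp hn hs ht hg hγ 1 h0 h0 hY hY' hZ hZ', ← e3]
      exact hc _ _ _
    have h0p := Submodule.zero_mem (verticalSpace E K L)
    have h0n := Submodule.zero_mem (horizontalSpace E K)
    -- The value of b solves 1/2 - (s/(2t)) b = c t, the Einstein equation on 𝔫.
    refine ⟨2 * t / s * (1 / 2 - c * t), (hcas _).mpr fun Z hZ Z' hZ' => ?_, ?_⟩
    · have h1 := key 0 h0p 0 h0p Z hZ Z' hZ'
      simp only [map_zero, mul_zero, zero_add] at h1
      have h2 : s / (2 * t) * casimirForm ep Z Z' = (1 / 2 - c * t) * negForm 𝔤 Z Z' := by linarith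
      field_simp at h2 ⊢
      linarith
    · obtain ⟨Y, hY, hY0⟩ := Submodule.exists_mem_ne_zero_of_ne_bot F.irreducible_vertical.2.1
      have h1 := key Y hY Y hY 0 h0n 0 h0n
      have h2 : casimirForm ep (0 : 𝔤) 0 = 0 := by simp [casimirForm]
      simp only [map_zero, mul_zero, add_zero, h2, sub_zero] at h1
      -- The Einstein equation on 𝔭 determines c; substituting it into the formula for b gives the
      -- quadratic equation.
      have h3 : γ / 2 + (1 - γ) * s ^ 2 / (4 * t ^ 2) = c * s :=
        mul_right_cancel₀ (F.pos Y hY0).ne' (by linarith)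
      field_simp at h3 ⊢
      linarith
  · rintro ⟨b, hb, hquad⟩
    rw [hcas] at hb
    -- The Einstein constant is read off from 𝔭; the quadratic equation is then the equation on 𝔫.
    refine ⟨(γ / 2 + (1 - γ) * s ^ 2 / (4 * t ^ 2)) / s, fun x v w => ?_⟩
    obtain ⟨a, rfl⟩ := QuotientGroup.mk_surjective x
    obtain ⟨U, rfl⟩ := orbitMap_surjective F.submersion_fst a v
    obtain ⟨U', rfl⟩ := orbitMap_surjective F.submersion_fst a w
    obtain ⟨X, hX, Y, hY, Z, hZ, rfl⟩ := F.exists_add_add (U : 𝔤)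
    obtain ⟨X', hX', Y', hY', Z', hZ', rfl⟩ := F.exists_add_add (U' : 𝔤)
    obtain ⟨e1, e2⟩ := F.projForm_add hp hn hX hX' hY hY' hZ hZ'
    have e3 := F.at_orbitMap hp hn hg a (X + Y + Z) (X' + Y' + Z')
    rw [e1, e2] at e3
    rw [F.ricci_eq hp hn hs ht hg hγ a hX hX' hY hY' hZ hZ', hb Z hZ Z' hZ']
    refine Eq.trans ?_ (congrArg _ e3).symm
    have h4 : (1 / 2 : ℝ) - s / (2 * t) * b =
        (γ / 2 + (1 - γ) * s ^ 2 / (4 * t ^ 2)) / s * t := by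
      field_simp at hquad ⊢
      linarith
    have h5 := div_mul_cancel₀ (γ / 2 + (1 - γ) * s ^ 2 / (4 * t ^ 2)) hs
    linear_combination (negForm 𝔤 Z Z') * h4 - (negForm 𝔤 Y Y') * h5

end IsSymmetricFibration

end BinormalMetrics

/-! ### Adapted metrics are binormal -/

section AdaptedMetrics

variable {E : Type*} [NormedAddCommGroup E] [NormedSpace ℝ E]
  {G : Type*} [TopologicalSpace G] [ChartedSpace E G] [Group G] [LieGroup 𝓘(ℝ, E) ∞ G]
  {K L : Subgroup G}
  {V : Type*} [NormedAddCommGroup V] [NormedSpace ℝ V] [ChartedSpace V (G ⧸ L)]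
  {W : Type*} [NormedAddCommGroup W] [NormedSpace ℝ W] [ChartedSpace W (G ⧸ K)]

local notation "𝔤" => GroupLieAlgebra 𝓘(ℝ, E) G

omit [LieGroup 𝓘(ℝ, E) ∞ G] in
lemma contMDiff_quotientMapOfLE (h : L ≤ K)
    (hM : Manifold.IsSubmersion 𝓘(ℝ, E) 𝓘(ℝ, V) ∞ (QuotientGroup.mk : G → G ⧸ L))
    (hN : Manifold.IsSubmersion 𝓘(ℝ, E) 𝓘(ℝ, W) ∞ (QuotientGroup.mk : G → G ⧸ K)) :
    ContMDiff 𝓘(ℝ, V) 𝓘(ℝ, W) ∞ (Subgroup.quotientMapOfLE h : G ⧸ L → G ⧸ K) := by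
  intro x
  obtain ⟨a, rfl⟩ := QuotientGroup.mk_surjective x
  exact contMDiffAt_of_comp_submersion (E := E) (V := V) (U := W) hM
    (g := Subgroup.quotientMapOfLE h) (a := a) (contMDiffAt_mk hN a)

lemma differential_quotientMapOfLE (h : L ≤ K)
    (hM : Manifold.IsSubmersion 𝓘(ℝ, E) 𝓘(ℝ, V) ∞ (QuotientGroup.mk : G → G ⧸ L))
    (hN : Manifold.IsSubmersion 𝓘(ℝ, E) 𝓘(ℝ, W) ∞ (QuotientGroup.mk : G → G ⧸ K)) (a : G) (X : E) :
    differential (V := V) (W := W) (Subgroup.quotientMapOfLE h : G ⧸ L → G ⧸ K) ((a : G) : G ⧸ L)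
      (orbitMap E L V a X) = orbitMap E K W a X := by
  have h1 := differential_comp_apply (V := E) (W := V) (U := W)
    (g := (Subgroup.quotientMapOfLE h : G ⧸ L → G ⧸ K))
    (f := fun b : G => ((a * b : G) : G ⧸ L)) (x := 1)
    (contMDiff_quotientMapOfLE h hM hN).contMDiffAt.mdiff (contMDiffAt_orbit hM a 1).mdiff X
  simp only [mul_one] at h1
  exact h1.symm

variable [FiniteDimensional ℝ E]

namespace IsSymmetricFibration

variable (F : IsSymmetricFibration E K L V W)
include F

lemma orbitMap_eq_zero_of_mem {X : 𝔤} (hX : X ∈ lieAlgebraOf E L) (a : G) :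
    orbitMap E L V a X = 0 :=
  (orbitMap_eq_zero_iff F.submersion_fst a X).mpr ((mem_lieAlgebraOf_iff F.submersion_fst X).mp hX)

/-- The vertical spaces of the fibration. -/
lemma differential_orbitMap_eq_zero_iff (a : G) (X : 𝔤) :
    differential (V := V) (W := W) (Subgroup.quotientMapOfLE F.le : G ⧸ L → G ⧸ K)
      ((a : G) : G ⧸ L) (orbitMap E L V a X) = 0 ↔ X ∈ lieAlgebraOf E K := by
  rw [mem_lieAlgebraOf_iff F.submersion_snd X]
  have h := differential_quotientMapOfLE F.le F.submersion_fst F.submersion_snd a X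
  exact (Eq.congr_left h).trans (orbitMap_eq_zero_iff F.submersion_snd a X)

lemma orbitMap_ne_zero {X : 𝔤} (hX : X ∈ verticalSpace E K L ∨ X ∈ horizontalSpace E K)
    (hX0 : X ≠ 0) (a : G) : orbitMap E L V a X ≠ 0 := by
  intro h
  have h1 : X ∈ lieAlgebraOf E L := (mem_lieAlgebraOf_iff F.submersion_fst X).mpr
    ((orbitMap_eq_zero_iff F.submersion_fst a X).mp h)
  refine (F.pos X hX0).ne' ?_
  rcases hX with hX | hX
  · exact F.isSymmetricSplitting.orth_lp X h1 X hX
  · exact F.isSymmetricSplitting.orth_ln X h1 X hX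

lemma exists_vertical_add {U : 𝔤} (hU : U ∈ lieAlgebraOf E K) :
    ∃ X ∈ lieAlgebraOf E L, ∃ Y ∈ verticalSpace E K L, U = X + Y := by
  rw [← F.sup_eq] at hU
  obtain ⟨X, hX, Y, hY, rfl⟩ := Submodule.mem_sup.mp hU
  exact ⟨X, hX, Y, hY, rfl⟩

/-- `Ad L`-invariant forms do not mix `𝔭` and `𝔫`. -/
lemma form_eq_zero (ψ : LinearMap.BilinForm ℝ 𝔤)
    (hψ : ∀ k ∈ L, ∀ X Y, ψ (adjointRep E k X) (adjointRep E k Y) = ψ X Y)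
    {X Y : 𝔤} (hX : X ∈ verticalSpace E K L) (hY : Y ∈ horizontalSpace E K) : ψ X Y = 0 := by
  obtain ⟨e, he⟩ := exists_isFrame F.pos (horizontalSpace E K)
  -- The map into 𝔫 which represents ψ with respect to B. It commutes with `Ad L`, because ψ and B
  -- are invariant.
  let T : 𝔤 →ₗ[ℝ] 𝔤 := ∑ i, (ψ.flip (e i)).smulRight (e i)
  have hT : ∀ X, T X = ∑ i, ψ X (e i) • e i := fun X => by simp [T]
  have hTmem : ∀ X, T X ∈ horizontalSpace E K := fun X => by
    rw [hT]; exact Submodule.sum_mem _ fun i _ => Submodule.smul_mem _ _ (he.mem i)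
  have hTB : ∀ X, ∀ Y ∈ horizontalSpace E K, negForm 𝔤 (T X) Y = ψ X Y := by
    intro X Y hY
    rw [hT, map_sum, LinearMap.sum_apply]
    conv_rhs => rw [he.expand Y hY, map_sum]
    refine Finset.sum_congr rfl fun i _ => ?_
    rw [map_smul, LinearMap.smul_apply, map_smul, smul_eq_mul, smul_eq_mul, negForm_symm, mul_comm]
  have hinv : IsAdInvariant L (horizontalSpace E K) :=
    fun a ha => F.irreducible_horizontal.1 a (F.le ha)
  have hTeq : ∀ a ∈ L, ∀ X, T (adjointRep E a X) = adjointRep E a (T X) := by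
    intro a ha X
    have hmem := Submodule.sub_mem _ (hTmem (adjointRep E a X)) (hinv a ha _ (hTmem X))
    rw [← sub_eq_zero]
    by_contra hne
    refine (F.pos _ hne).ne' ?_
    have h1 : ∀ Z ∈ horizontalSpace E K,
        negForm 𝔤 (T (adjointRep E a X) - adjointRep E a (T X)) Z = 0 := by
      intro Z hZ
      have hZ' := hinv a⁻¹ (L.inv_mem ha) Z hZ
      rw [map_sub, LinearMap.sub_apply, hTB _ _ hZ, negForm_adjointRep_left, hTB _ _ hZ',
        ← hψ a ha X, adjointRep_apply_inv, sub_self]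
    exact h1 _ hmem
  -- By irreducibility T is injective or zero on 𝔭. In the first case it would be an equivalence of
  -- 𝔭 with a submodule of 𝔫, which is excluded.
  let S : Submodule ℝ 𝔤 := verticalSpace E K L ⊓ LinearMap.ker T
  have hS : IsAdInvariant L S := fun a ha X hX => ⟨F.irreducible_vertical.1 a ha X hX.1, by
    have h0 : T X = 0 := hX.2
    rw [SetLike.mem_coe, LinearMap.mem_ker, hTeq a ha, h0]
    exact (adEquiv a).map_zero⟩
  rcases F.irreducible_vertical.2.2 S inf_le_left hS with h | h
  · refine absurd ⟨T, rfl, ?_, fun a ha X _ => hTeq a ha X⟩ (F.noCommon (verticalSpace E K L) le_rfl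
      ((verticalSpace E K L).map T) ?_ F.irreducible_vertical.1 ?_ F.irreducible_vertical.2.1)
    · rintro _ ⟨X, _, rfl⟩
      exact hTmem X
    · rintro a ha _ ⟨X, hX, rfl⟩
      exact ⟨adjointRep E a X, F.irreducible_vertical.1 a ha X hX, hTeq a ha X⟩
    · intro X hX Y hY hXY
      have hmem : X - Y ∈ S := ⟨Submodule.sub_mem _ hX hY, by
        rw [SetLike.mem_coe, LinearMap.mem_ker, map_sub, sub_eq_zero]; exact hXY⟩
      rw [h, Submodule.mem_bot, sub_eq_zero] at hmem
      exact hmem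
  · have hXS : X ∈ S := h.symm ▸ hX
    have h0 : T X = 0 := hXS.2
    rw [← hTB X Y hY, h0, map_zero, LinearMap.zero_apply]

variable [IsManifold 𝓘(ℝ, V) ∞ (G ⧸ L)] [IsManifold 𝓘(ℝ, W) ∞ (G ⧸ K)]

/-- Adapted metrics are binormal. -/
theorem exists_isBinormalMetric_of_isAdapted {g : SmoothMetric V (G ⧸ L)}
    (hg : IsAdaptedMetric W F.le g) :
    ∃ s t : ℝ, 0 < s ∧ 0 < t ∧ IsBinormalMetric E K g s t := by
  obtain ⟨hinv, ⟨g', -, -, hiso⟩, -⟩ := hg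
  let ψ : LinearMap.BilinForm ℝ 𝔤 := LinearMap.mk₂ ℝ (fun X Y : 𝔤 =>
      g.at ((1 : G) : G ⧸ L) (orbitMap E L V (1 : G) X) (orbitMap E L V (1 : G) Y))
    (fun X X' Y => by rw [orbitMap_add, map_add, add_apply])
    (fun c X Y => by
      have h := (orbitMap E L V (1 : G)).map_smul c X
      refine (congrArg (fun v => g.at ((1 : G) : G ⧸ L) v _) h).trans ?_
      rw [map_smul, smul_apply])
    (fun X Y Y' => by rw [orbitMap_add, map_add])
    (fun c X Y => by
      have h := (orbitMap E L V (1 : G)).map_smul c Y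
      refine (congrArg (fun v => g.at ((1 : G) : G ⧸ L) _ v) h).trans ?_
      rw [map_smul])
  have hψa : ∀ (a : G) (X Y : 𝔤), g.at ((a : G) : G ⧸ L) (orbitMap E L V a X)
      (orbitMap E L V a Y) = ψ X Y := fun a X Y => hinv.at_orbitMap F.submersion_fst a X Y
  have hψ : ∀ k ∈ L, ∀ X Y : 𝔤, ψ (adjointRep E k X) (adjointRep E k Y) = ψ X Y := by
    intro k hk X Y
    rw [← hψa k X Y]
    have h1 : ((k : G) : G ⧸ L) = ((1 : G) : G ⧸ L) := by
      rw [QuotientGroup.eq]; simpa using hk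
    have h2 : ∀ X : 𝔤, orbitMap E L V k X = orbitMap E L V (1 : G) (adjointRep E k X) := fun X => by
      have h := orbitMap_mul_mem F.submersion_fst 1 hk X
      rw [one_mul] at h
      exact h
    rw [h1, h2 X, h2 Y]
    rfl
  have hsymm : ∀ X Y : 𝔤, ψ X Y = ψ Y X := fun X Y => g.at_symm _ _ _
  have h0 : ∀ X ∈ verticalSpace E K L, ∀ Y ∈ horizontalSpace E K, ψ X Y = 0 :=
    fun X hX Y hY => F.form_eq_zero ψ hψ hX hY
  obtain ⟨s, hs⟩ := F.irreducible_vertical.exists_form_eq F.pos ψ hsymm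
    (fun a ha X _ Y _ => hψ a ha X Y)
  -- The orbit map carries 𝔫 to horizontal vectors at every point, so the isometry condition of the
  -- submersion applies to them.
  have hhor : ∀ (k : G), ∀ Y ∈ horizontalSpace E K, ∀ z : V,
      differential (V := V) (W := W) (Subgroup.quotientMapOfLE F.le : G ⧸ L → G ⧸ K)
        ((k : G) : G ⧸ L) z = 0 → g.at ((k : G) : G ⧸ L) (orbitMap E L V k Y) z = 0 := by
    intro k Y hY z hz
    obtain ⟨U, rfl⟩ := orbitMap_surjective F.submersion_fst k z
    obtain ⟨X, hX, P, hP, hU⟩ := F.exists_vertical_add ((F.differential_orbitMap_eq_zero_iff k U).mp hz)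
    have h1 : orbitMap E L V k U = orbitMap E L V k P := by
      refine (congrArg (orbitMap E L V k) hU).trans ((orbitMap_add k X P).trans ?_)
      rw [F.orbitMap_eq_zero_of_mem hX, zero_add]
    rw [h1]
    exact (hψa k Y P).trans ((hsymm Y P).trans (h0 P hP Y hY))
  -- ψ is so far only `Ad L`-invariant. All points k L with k in K lie over the base point of `G ⧸
  -- K`, and the projection at k L sends the frame of 𝔫 to its image under Ad k. Comparing with the
  -- one metric on the base shows that ψ is `Ad K`-invariant on 𝔫.
  have hψK : ∀ k ∈ K, ∀ Y ∈ horizontalSpace E K, ∀ Y' ∈ horizontalSpace E K,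
      ψ Y Y' = g'.at ((1 : G) : G ⧸ K) (orbitMap E K W (1 : G) (adjointRep E k Y))
        (orbitMap E K W (1 : G) (adjointRep E k Y')) := by
    intro k hk Y hY Y' hY'
    have h := hiso ((k : G) : G ⧸ L) _ _ (hhor k Y hY) (hhor k Y' hY')
    have h1 : (Subgroup.quotientMapOfLE F.le ((k : G) : G ⧸ L) : G ⧸ K) = ((1 : G) : G ⧸ K) := by
      rw [Subgroup.quotientMapOfLE_apply_mk, QuotientGroup.eq]; simpa using hk
    have h2 : ∀ X : 𝔤, differential (V := V) (W := W)
        (Subgroup.quotientMapOfLE F.le : G ⧸ L → G ⧸ K) ((k : G) : G ⧸ L) (orbitMap E L V k X) =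
        orbitMap E K W (1 : G) (adjointRep E k X) := fun X => by
      refine (differential_quotientMapOfLE F.le F.submersion_fst F.submersion_snd k X).trans ?_
      have h := orbitMap_mul_mem F.submersion_snd 1 hk X
      rw [one_mul] at h
      exact h
    rw [h1, h2 Y, h2 Y'] at h
    rw [← hψa k Y Y', ← h]
  have hone : ∀ X : 𝔤, adjointRep E (1 : G) X = X := fun X => adMap_one_apply (E := E) (G := G) X
  obtain ⟨t, ht⟩ := F.irreducible_horizontal.exists_form_eq F.pos ψ hsymm
    (fun k hk Y hY Y' hY' => by
      rw [hψK k hk Y hY Y' hY', hψK 1 K.one_mem _ (F.irreducible_horizontal.1 k hk Y hY) _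
        (F.irreducible_horizontal.1 k hk Y' hY'), hone, hone])
  refine ⟨s, t, ?_, ?_, hinv, ?_⟩
  · obtain ⟨X, hX, hX0⟩ := Submodule.exists_mem_ne_zero_of_ne_bot F.irreducible_vertical.2.1
    have h1 : 0 < ψ X X := g.at_pos _ _ (F.orbitMap_ne_zero (Or.inl hX) hX0 1)
    rw [hs X hX X hX] at h1
    exact pos_of_mul_pos_left h1 (F.pos X hX0).le
  · obtain ⟨X, hX, hX0⟩ := Submodule.exists_mem_ne_zero_of_ne_bot F.irreducible_horizontal.2.1
    have h1 : 0 < ψ X X := g.at_pos _ _ (F.orbitMap_ne_zero (Or.inr hX) hX0 1)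
    rw [ht X hX X hX] at h1
    exact pos_of_mul_pos_left h1 (F.pos X hX0).le
  · intro X hX X' hX' Y hY Y' hY'
    rw [← orbitMap_one]
    refine Eq.trans (b := ψ (X + Y) (X' + Y')) rfl ?_
    rw [map_add ψ X Y, LinearMap.add_apply, map_add, map_add, h0 X hX Y' hY', hsymm Y X', h0 X' hX' Y hY,
      hs X hX X' hX', ht Y hY Y' hY']
    simp only [negKilling_eq]
    ring

end IsSymmetricFibration

end AdaptedMetrics

/-! ### Binormal metrics are adapted -/

section TotallyGeodesicFibers

variable {E : Type*} [NormedAddCommGroup E] [NormedSpace ℝ E] [FiniteDimensional ℝ E]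
  {G : Type*} [TopologicalSpace G] [ChartedSpace E G] [Group G] [LieGroup 𝓘(ℝ, E) ∞ G]
  {K L : Subgroup G}
  {V : Type*} [NormedAddCommGroup V] [NormedSpace ℝ V] [ChartedSpace V (G ⧸ L)]
  {W : Type*} [NormedAddCommGroup W] [NormedSpace ℝ W] [ChartedSpace W (G ⧸ K)]

local notation "𝔤" => GroupLieAlgebra 𝓘(ℝ, E) G

namespace IsSymmetricFibration

variable [IsManifold 𝓘(ℝ, V) ∞ (G ⧸ L)] [IsManifold 𝓘(ℝ, W) ∞ (G ⧸ K)]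
  (F : IsSymmetricFibration E K L V W)
include F

omit [IsManifold 𝓘(ℝ, V) ∞ (G ⧸ L)] [IsManifold 𝓘(ℝ, W) ∞ (G ⧸ K)] in
lemma exists_orbitMap_eq (a : G) (v : V) : ∃ X : 𝔤, orbitMap E L V a X = v :=
  orbitMap_surjective F.submersion_fst a v

omit [IsManifold 𝓘(ℝ, V) ∞ (G ⧸ L)] [IsManifold 𝓘(ℝ, W) ∞ (G ⧸ K)] in
lemma projForm_vertical_of_mem_horizontal {ι : Type*} [Fintype ι] [DecidableEq ι] {ep : ι → 𝔤}
    (hp : IsFrame (verticalSpace E K L) ep) {Z : 𝔤} (hZ : Z ∈ horizontalSpace E K) (U : 𝔤) :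
    projForm ep Z U = 0 :=
  hp.projForm_of_orthogonal (fun T hT => by
    rw [negForm_symm, F.isSymmetricSplitting.orth_pn T hT Z hZ]) U

omit F [IsManifold 𝓘(ℝ, V) ∞ (G ⧸ L)] [IsManifold 𝓘(ℝ, W) ∞ (G ⧸ K)]
  [ChartedSpace V (G ⧸ L)] [ChartedSpace W (G ⧸ K)] in
lemma _root_.IsFrame.projForm_horizontal_of_mem {κ : Type*} [Fintype κ] [DecidableEq κ] {en : κ → 𝔤}
    (hn : IsFrame (horizontalSpace E K) en) {X : 𝔤} (hX : X ∈ lieAlgebraOf E K) (U : 𝔤) :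
    projForm en X U = 0 :=
  hn.projForm_of_orthogonal (fun _ hT => mem_horizontalSpace_iff.mp hT X hX) U

omit [IsManifold 𝓘(ℝ, V) ∞ (G ⧸ L)] in
/-- The metric on the base defined by the form `t B_𝔫`. -/
lemma exists_base_metric [FiniteDimensional ℝ W] {t : ℝ} (ht : 0 < t) {κ : Type*} [Fintype κ]
    [DecidableEq κ] {en : κ → 𝔤} (hn : IsFrame (horizontalSpace E K) en) :
    ∃ g' : SmoothMetric W (G ⧸ K), ∀ (a : G) (X Y : 𝔤),
      g'.at ((a : G) : G ⧸ K) (orbitMap E K W a X) (orbitMap E K W a Y) =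
        t * projForm en X Y := by
  have hq : ∀ X Y : 𝔤, (t • projForm en) X Y = t * projForm en X Y := fun X Y => rfl
  obtain ⟨ep, hp⟩ := exists_isFrame F.pos (verticalSpace E K L)
  obtain ⟨g', hg'⟩ := exists_metric_of_bilinForm F.submersion_snd (t • projForm en)
    (fun X Y => by rw [hq, hq, projForm_symm])
    (fun X hX Y => by rw [hq, hn.projForm_horizontal_of_mem hX, mul_zero])
    (fun X hX => by
      refine mul_pos ht (lt_of_le_of_ne (projForm_self_nonneg en X) fun h => hX ?_)
      obtain ⟨X₁, hX₁, Y, hY, Z, hZ, rfl⟩ := F.exists_add_add X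
      rw [(F.projForm_add hp hn hX₁ hX₁ hY hY hZ hZ).2] at h
      have hZ0 : Z = 0 := by
        by_contra hne; exact (F.pos Z hne).ne' h.symm
      rw [hZ0, add_zero]
      exact Submodule.add_mem _ (lieAlgebraOf_mono F.le hX₁) (verticalSpace_le hY))
    (fun k hk X Y => by
      rw [hq, hq, hn.projForm_adjointRep F.irreducible_horizontal.1 hk])
  exact ⟨g', hg'⟩

/-- For binormal metrics the projection is a Riemannian submersion. -/
lemma exists_isRiemannianSubmersion [FiniteDimensional ℝ W] {g : SmoothMetric V (G ⧸ L)} {s t : ℝ}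
    (hs : s ≠ 0) (ht : 0 < t) (hg : IsBinormalMetric E K g s t) :
    ∃ g' : SmoothMetric W (G ⧸ K),
      IsRiemannianSubmersion g g' (Subgroup.quotientMapOfLE F.le) := by
  obtain ⟨ep, hp⟩ := exists_isFrame F.pos (verticalSpace E K L)
  obtain ⟨en, hn⟩ := exists_isFrame F.pos (horizontalSpace E K)
  obtain ⟨g', hg'⟩ := F.exists_base_metric ht hn
  have hdiff := differential_quotientMapOfLE F.le F.submersion_fst F.submersion_snd
  refine ⟨g', contMDiff_quotientMapOfLE F.le F.submersion_fst F.submersion_snd, fun x w => ?_,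
    fun x u v hu hv => ?_⟩
  · obtain ⟨a, rfl⟩ := QuotientGroup.mk_surjective x
    obtain ⟨X, rfl⟩ := orbitMap_surjective F.submersion_snd a w
    exact ⟨orbitMap E L V a X, hdiff a X⟩
  · obtain ⟨a, rfl⟩ := QuotientGroup.mk_surjective x
    obtain ⟨U, rfl⟩ := F.exists_orbitMap_eq a u
    obtain ⟨U', rfl⟩ := F.exists_orbitMap_eq a v
    have h1 : projForm ep (U : 𝔤) U' = 0 := by
      refine hp.projForm_of_orthogonal (fun Z hZ => ?_) _
      have h := hu (orbitMap E L V a Z)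
        ((F.differential_orbitMap_eq_zero_iff a Z).mpr (verticalSpace_le hZ))
      have h' := F.at_orbitMap hp hn hg a U Z
      rw [projForm_symm, hp.projForm_of_mem hZ, projForm_symm en,
        hn.projForm_horizontal_of_mem (verticalSpace_le hZ), mul_zero, add_zero] at h'
      rw [negForm_symm]
      exact (mul_eq_zero.mp (h'.symm.trans h)).resolve_left hs
    refine (congrArg₂ (fun u v : W => g'.at ((a : G) : G ⧸ K) u v)
      (hdiff a U) (hdiff a U')).trans ((hg' a U U').trans ?_)
    refine Eq.trans ?_ (F.at_orbitMap hp hn hg a U U').symm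
    rw [h1, mul_zero, zero_add]

omit [IsManifold 𝓘(ℝ, W) ∞ (G ⧸ K)] in
/-- Vertical vectors are orthogonal to the fundamental fields of `𝔫`, near `a L` in the fibre. -/
lemma coeff_fundField_eq_zero {g : SmoothMetric V (G ⧸ L)} {s t : ℝ}
    (hg : IsBinormalMetric E K g s t) {a b : G}
    (hb : (b : G ⧸ L) ∈ (extChartAt 𝓘(ℝ, V) ((a : G) : G ⧸ L)).source) (hab : b⁻¹ * a ∈ K)
    {U Z : 𝔤} (hU : U ∈ lieAlgebraOf E K) (hZ : Z ∈ horizontalSpace E K) :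
    g.coeff ((a : G) : G ⧸ L) (extChartAt 𝓘(ℝ, V) ((a : G) : G ⧸ L) b)
      (differential (V := V) (W := V) (extChartAt 𝓘(ℝ, V) ((a : G) : G ⧸ L)) b
        (orbitMap E L V b U))
      (fundField (chartAct E L V a) (extChartAt 𝓘(ℝ, E) (1 : G) 1) Z
        (extChartAt 𝓘(ℝ, V) ((a : G) : G ⧸ L) b)) = 0 := by
  obtain ⟨ep, hp⟩ := exists_isFrame F.pos (verticalSpace E K L)
  obtain ⟨en, hn⟩ := exists_isFrame F.pos (horizontalSpace E K)
  set φ := extChartAt 𝓘(ℝ, V) ((a : G) : G ⧸ L) with hφ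
  have hsymm : ∀ v : V, differential (V := V) (W := V) φ.symm (φ b)
      (differential (V := V) (W := V) φ (b : G ⧸ L) v) = v := fun v => by
    have h := differential_symm_comp_extChartAt (V := V) ((a : G) : G ⧸ L) (φ.map_source hb) v
    rwa [← hφ, φ.left_inv hb] at h
  refine (congrArg (fun w : V => g.coeff ((a : G) : G ⧸ L) (φ b) _ w)
    (fundField_chartAct F.submersion_fst a b hb Z)).trans ?_
  rw [g.coeff_apply, ← hφ, hsymm, hsymm, φ.left_inv hb]
  -- At b L the fundamental field of Z is the orbit vector of Ad (b⁻¹ a) Z, which is still in 𝔫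
  -- because b⁻¹ a lies in K.
  refine (F.at_orbitMap hp hn hg b U (adjointRep E (b⁻¹ * a) Z)).trans ?_
  rw [hn.projForm_horizontal_of_mem hU, projForm_symm, F.projForm_vertical_of_mem_horizontal hp
    (F.irreducible_horizontal.1 _ hab Z hZ), mul_zero, mul_zero, add_zero]

omit [IsManifold 𝓘(ℝ, W) ∞ (G ⧸ K)] in
/-- The fibres are totally geodesic for binormal metrics. -/
lemma hasTotallyGeodesicFibers [FiniteDimensional ℝ V] {g : SmoothMetric V (G ⧸ L)} {s t : ℝ}
    (ht : t ≠ 0) (hg : IsBinormalMetric E K g s t) :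
    HasTotallyGeodesicFibers W g (Subgroup.quotientMapOfLE F.le : G ⧸ L → G ⧸ K) := by
  obtain ⟨ep, hp⟩ := exists_isFrame F.pos (verticalSpace E K L)
  obtain ⟨en, hn⟩ := exists_isFrame F.pos (horizontalSpace E K)
  intro c hc hfib r
  obtain ⟨a, ha⟩ := QuotientGroup.mk_surjective (c r)
  obtain ⟨U, hU⟩ := F.exists_orbitMap_eq a (g.acceleration c r)
  rw [← hU, ← ha]
  refine (F.differential_orbitMap_eq_zero_iff a U).mpr ?_
  set φ := extChartAt 𝓘(ℝ, V) ((a : G) : G ⧸ L) with hφ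
  have hsrc : c r ∈ φ.source := by rw [← ha]; exact mem_extChartAt_source _
  have hsmooth : ContDiffAt ℝ ∞ (fun q => φ (c q)) r :=
    contMDiffAt_iff_contDiffAt.mp ((contMDiffAt_extChart _ hsrc).comp r hc.contMDiffAt)
  have hd1 : DifferentiableAt ℝ (fun q => φ (c q)) r := hsmooth.differentiableAt (by simp)
  have hd2 : DifferentiableAt ℝ (deriv fun q => φ (c q)) r := by
    have h := (hsmooth.fderiv_right (m := ∞) (by simp)).differentiableAt (by simp)
    exact h.clm_apply (differentiableAt_const (1 : ℝ))
  -- The product of the velocity with the Killing field of Z is zero along the curve, and its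
  -- derivative is the product with the acceleration.
  have hvert : ∀ Z ∈ horizontalSpace E K,
      g.at ((a : G) : G ⧸ L) (orbitMap E L V a U) (orbitMap E L V a Z) = 0 := by
    intro Z hZ
    have key := (hg.1.isKillingAlgebra F.submersion_fst a).hasDerivAt_metric_velocity
      (c := fun q => φ (c q)) (t := r) (by simp only [← ha, hφ]) hd1 hd2 Z
    have hzero : (fun q => g.coeff ((a : G) : G ⧸ L) (φ (c q)) (deriv (fun q => φ (c q)) q)
        (fundField (chartAct E L V a) (extChartAt 𝓘(ℝ, E) (1 : G) 1) Z (φ (c q)))) =ᶠ[𝓝 r]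
        fun _ => 0 := by
      filter_upwards [hc.continuous.continuousAt.preimage_mem_nhds
        ((isOpen_extChartAt_source _).mem_nhds hsrc)] with q hq
      obtain ⟨b, hb⟩ := QuotientGroup.mk_surjective (c q)
      obtain ⟨Y, hY⟩ := F.exists_orbitMap_eq b
        (differential (V := ℝ) (W := V) c q 1)
      have hab : b⁻¹ * a ∈ K := by
        have h := hfib q r
        rw [← hb, ← ha, Subgroup.quotientMapOfLE_apply_mk, Subgroup.quotientMapOfLE_apply_mk,
          QuotientGroup.eq] at h
        exact h
      have hYK : (Y : 𝔤) ∈ lieAlgebraOf E K := by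
        rw [← F.differential_orbitMap_eq_zero_iff b Y]
        refine (congrArg _ hY).trans ?_
        have h := differential_comp_apply (V := ℝ) (W := V) (U := W) (M := ℝ)
          (g := (Subgroup.quotientMapOfLE F.le : G ⧸ L → G ⧸ K)) (f := c) (x := q)
          (contMDiff_quotientMapOfLE F.le F.submersion_fst F.submersion_snd).contMDiffAt.mdiff
          hc.contMDiffAt.mdiff 1
        rw [hb, ← h, show (fun y => Subgroup.quotientMapOfLE F.le (c y)) =
          fun _ => Subgroup.quotientMapOfLE F.le (c q) from funext fun y => hfib y q,
          differential_const]
        rfl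
      have hder : deriv (fun q => φ (c q)) q =
          differential (V := V) (W := V) φ (b : G ⧸ L) (orbitMap E L V b Y) := by
        have h := differential_comp_apply (V := ℝ) (W := V) (U := V) (M := ℝ)
          (g := φ) (f := c) (x := q) (contMDiffAt_extChart _ hq).mdiff hc.contMDiffAt.mdiff 1
        rw [differential_eq_fderiv] at h
        rw [hY, hb, ← h]
        rfl
      rw [hder, ← hb]
      exact F.coeff_fundField_eq_zero hg (by rw [hb]; exact hq) hab hYK hZ
    have h := (key.congr_of_eventuallyEq hzero.symm).unique (hasDerivAt_const r (0 : ℝ))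
    have hacc : deriv (deriv fun q => φ (c q)) r + christoffel (g.coeff ((a : G) : G ⧸ L))
        (φ ((a : G) : G ⧸ L)) (deriv (fun q => φ (c q)) r) (deriv (fun q => φ (c q)) r) =
        orbitMap E L V a U := by
      rw [hU, SmoothMetric.acceleration, ← ha]
    rw [hacc, g.coeff_self] at h
    refine Eq.trans ?_ h
    exact congrArg _ (fundField_chartAct_self F.submersion_fst a Z).symm
  -- A lift of the acceleration has no component in 𝔫, so it lies in 𝔨 and the acceleration is
  -- vertical.
  have horth : ∀ Z ∈ horizontalSpace E K, projForm en U Z = 0 := by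
    intro Z hZ
    have h := (F.at_orbitMap hp hn hg a U Z).symm.trans (hvert Z hZ)
    rw [projForm_symm, F.projForm_vertical_of_mem_horizontal hp hZ, mul_zero, zero_add] at h
    exact (mul_eq_zero.mp h).resolve_left ht
  obtain ⟨X, hX, Y, hY, Z, hZ, hXYZ⟩ := F.exists_add_add (U : 𝔤)
  have h0 : projForm en (U : 𝔤) (0 + 0 + Z) = negForm 𝔤 Z Z := by
    rw [hXYZ]
    exact (F.projForm_add hp hn hX (Submodule.zero_mem _) hY (Submodule.zero_mem _) hZ hZ).2
  rw [zero_add, zero_add, horth Z hZ] at h0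
  have hZ0 : Z = 0 := by
    by_contra hne; exact (F.pos Z hne).ne' h0.symm
  rw [hXYZ, hZ0, add_zero]
  exact Submodule.add_mem _ (lieAlgebraOf_mono F.le hX) (verticalSpace_le hY)

/-- Binormal metrics are adapted. -/
theorem isAdapted_of_isBinormalMetric [FiniteDimensional ℝ V] [FiniteDimensional ℝ W]
    {g : SmoothMetric V (G ⧸ L)} {s t : ℝ} (hs : s ≠ 0) (ht : 0 < t)
    (hg : IsBinormalMetric E K g s t) : IsAdaptedMetric W F.le g :=
  ⟨hg.1, F.exists_isRiemannianSubmersion hs ht hg, F.hasTotallyGeodesicFibers ht.ne' hg⟩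

end IsSymmetricFibration

end TotallyGeodesicFibers

/-! ### The quadratic equation for the ratio of the two scales -/

section QuadraticEquation

lemma quadratic_iff {γ b Δ : ℝ} (hγ : 0 < γ) (hΔ : Δ = 1 - 2 * γ * (1 - γ + 2 * b)) (h0 : 0 ≤ Δ)
    (X : ℝ) : 2 * γ * X ^ 2 - 2 * X + (1 - γ + 2 * b) = 0 ↔
      X = (1 + √Δ) / (2 * γ) ∨ X = (1 - √Δ) / (2 * γ) := by
  have h2 : 2 * γ ≠ 0 := by positivity
  have hsq := Real.mul_self_sqrt h0
  rw [eq_div_iff h2, eq_div_iff h2, ← sub_eq_zero (a := X * (2 * γ)),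
    ← sub_eq_zero (a := X * (2 * γ)), ← mul_eq_zero]
  have h3 : (X * (2 * γ) - (1 + √Δ)) * (X * (2 * γ) - (1 - √Δ)) =
      2 * γ * (2 * γ * X ^ 2 - 2 * X + (1 - γ + 2 * b)) := by
    linear_combination (-1 : ℝ) * hsq - hΔ
  rw [h3, mul_eq_zero]
  exact (or_iff_right h2).symm

/-- At a root X the quantity Δ is the square of 2γX - 1. -/
lemma discriminant_nonneg {γ b X : ℝ} (hX : 2 * γ * X ^ 2 - 2 * X + (1 - γ + 2 * b) = 0) :
    0 ≤ 1 - 2 * γ * (1 - γ + 2 * b) := by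
  have h : 1 - 2 * γ * (1 - γ + 2 * b) = (2 * γ * X - 1) ^ 2 := by
    linear_combination (-(2 * γ)) * hX
  rw [h]
  positivity

end QuadraticEquation

/-! ### Einstein adapted metrics -/

section EinsteinAdapted

variable {E : Type*} [NormedAddCommGroup E] [NormedSpace ℝ E] [FiniteDimensional ℝ E]
  {G : Type*} [TopologicalSpace G] [ChartedSpace E G] [Group G] [LieGroup 𝓘(ℝ, E) ∞ G]
  {K L : Subgroup G}
  {V : Type*} [NormedAddCommGroup V] [NormedSpace ℝ V] [FiniteDimensional ℝ V]
  [ChartedSpace V (G ⧸ L)] [IsManifold 𝓘(ℝ, V) ∞ (G ⧸ L)]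
  {W : Type*} [NormedAddCommGroup W] [NormedSpace ℝ W] [FiniteDimensional ℝ W]
  [ChartedSpace W (G ⧸ K)] [IsManifold 𝓘(ℝ, W) ∞ (G ⧸ K)]

omit [LieGroup 𝓘(ℝ, E) ∞ G] [FiniteDimensional ℝ E] in
lemma casimirIsScalarOn_unique [FiniteDimensional ℝ E] [LieGroup 𝓘(ℝ, E) ∞ G]
    {U U' : Submodule ℝ (GroupLieAlgebra 𝓘(ℝ, E) G)} (hU' : U' ≠ ⊥) {b b' : ℝ}
    (h : CasimirIsScalarOn U U' b) (h' : CasimirIsScalarOn U U' b') : b = b' := by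
  obtain ⟨X, hX, hX0⟩ := Submodule.exists_mem_ne_zero_of_ne_bot hU'
  exact smul_left_injective ℝ hX0 ((h X hX).symm.trans (h' X hX))

namespace IsSymmetricFibration

variable (F : IsSymmetricFibration E K L V W) {γ : ℝ}
  (hγ : CasimirIsScalarOn (lieAlgebraOf E K) (verticalSpace E K L) γ)
include F hγ

/-- The Einstein adapted metrics, in terms of the Casimir operator of `𝔭` on `𝔫`. -/
theorem isAdapted_and_isEinstein_iff (g : SmoothMetric V (G ⧸ L)) :
    IsAdaptedMetric W F.le g ∧ g.IsEinstein ↔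
      ∃ s t b : ℝ, 0 < s ∧ 0 < t ∧ IsBinormalMetric E K g s t ∧
        CasimirIsScalarOn (verticalSpace E K L) (horizontalSpace E K) b ∧
        2 * γ * (t / s) ^ 2 - 2 * (t / s) + (1 - γ + 2 * b) = 0 := by
  obtain ⟨ep, hp⟩ := exists_isFrame F.pos (verticalSpace E K L)
  obtain ⟨en, hn⟩ := exists_isFrame F.pos (horizontalSpace E K)
  constructor
  · rintro ⟨hg, hE⟩
    obtain ⟨s, t, hs, ht, hst⟩ := F.exists_isBinormalMetric_of_isAdapted hg
    obtain ⟨b, hb, hq⟩ := (F.isEinstein_iff hp hn hs.ne' ht.ne' hst hγ).mp hE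
    exact ⟨s, t, b, hs, ht, hst, hb, hq⟩
  · rintro ⟨s, t, b, hs, ht, hst, hb, hq⟩
    exact ⟨F.isAdapted_of_isBinormalMetric hs.ne' ht hst,
      (F.isEinstein_iff hp hn hs.ne' ht.ne' hst hγ).mpr ⟨b, hb, hq⟩⟩

end IsSymmetricFibration

end EinsteinAdapted

end

theorem corollary2p4
    {E : Type*} [NormedAddCommGroup E] [NormedSpace ℝ E] [FiniteDimensional ℝ E]
    {G : Type*} [TopologicalSpace G] [ChartedSpace E G] [Group G] [LieGroup 𝓘(ℝ, E) ∞ G]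
    [T2Space G] [CompactSpace G] [ConnectedSpace G]
    [LieAlgebra.IsSemisimple ℝ (GroupLieAlgebra 𝓘(ℝ, E) G)]
    (K L : Subgroup G) (hLK : L < K) (hKG : K < ⊤) (hL : L ≠ ⊥)
    (hKclosed : IsClosed (K : Set G)) (hLclosed : IsClosed (L : Set G))
    (hKconn : IsConnected (K : Set G)) (hLconn : IsConnected (L : Set G))
    -- the smooth structures of `G ⧸ L` and `G ⧸ K`, for which the projections are submersions
    {V : Type*} [NormedAddCommGroup V] [NormedSpace ℝ V] [FiniteDimensional ℝ V]
    [ChartedSpace V (G ⧸ L)] [IsManifold 𝓘(ℝ, V) ∞ (G ⧸ L)]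
    (hM : Manifold.IsSubmersion 𝓘(ℝ, E) 𝓘(ℝ, V) ∞ (QuotientGroup.mk : G → G ⧸ L))
    {W : Type*} [NormedAddCommGroup W] [NormedSpace ℝ W] [FiniteDimensional ℝ W]
    [ChartedSpace W (G ⧸ K)] [IsManifold 𝓘(ℝ, W) ∞ (G ⧸ K)]
    (hN : Manifold.IsSubmersion 𝓘(ℝ, E) 𝓘(ℝ, W) ∞ (QuotientGroup.mk : G → G ⧸ K))
    -- the base `G ⧸ K` is an irreducible symmetric space
    (hNsymm : ∀ X ∈ horizontalSpace E K, ∀ Y ∈ horizontalSpace E K, ⁅X, Y⁆ ∈ lieAlgebraOf E K)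
    (hNirr : IsAdIrreducible K (horizontalSpace E K))
    -- the fibre `K ⧸ L` is a simply connected irreducible symmetric space of dimension `> 1`
    (hFsc : SimplyConnectedSpace (K ⧸ L.subgroupOf K))
    (hFsymm : ∀ X ∈ verticalSpace E K L, ∀ Y ∈ verticalSpace E K L, ⁅X, Y⁆ ∈ lieAlgebraOf E L)
    (hFirr : IsAdIrreducible L (verticalSpace E K L))
    (hFdim : 1 < Module.finrank ℝ (verticalSpace E K L))
    -- `𝔭` and `𝔫` do not contain equivalent `Ad L`-submodules
    (hineq : NoCommonAdSubmodule L (verticalSpace E K L) (horizontalSpace E K)) :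
    ∃ γ : ℝ, 0 < γ ∧ CasimirIsScalarOn (lieAlgebraOf E K) (verticalSpace E K L) γ ∧
      ((∃ g : SmoothMetric V (G ⧸ L), IsAdaptedMetric W hLK.le g ∧ g.IsEinstein) ↔
        ∃ b : ℝ, CasimirIsScalarOn (verticalSpace E K L) (horizontalSpace E K) b ∧
          0 ≤ 1 - 2 * γ * (1 - γ + 2 * b)) ∧
      ∀ b Δ : ℝ, CasimirIsScalarOn (verticalSpace E K L) (horizontalSpace E K) b →
        Δ = 1 - 2 * γ * (1 - γ + 2 * b) → 0 ≤ Δ →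
        (∀ g : SmoothMetric V (G ⧸ L), IsAdaptedMetric W hLK.le g ∧ g.IsEinstein ↔
          ∃ s X : ℝ, 0 < s ∧ 0 < X ∧
            (X = (1 + √Δ) / (2 * γ) ∨ X = (1 - √Δ) / (2 * γ)) ∧
            IsBinormalMetric E K g s (s * X)) ∧
        ∀ X : ℝ, 0 < X → (X = (1 + √Δ) / (2 * γ) ∨ X = (1 - √Δ) / (2 * γ)) →
          ∃ g : SmoothMetric V (G ⧸ L), IsBinormalMetric E K g 1 X := by
  have F : IsSymmetricFibration E K L V W :=
    { le := hLK.le, submersion_fst := hM, submersion_snd := hN, pos := negForm_pos_of_compact,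
      connected := hLconn, lie_horizontal := hNsymm, irreducible_horizontal := hNirr,
      lie_vertical := hFsymm, irreducible_vertical := hFirr, one_lt_finrank := hFdim,
      noCommon := hineq }
  obtain ⟨ep, hp⟩ := exists_isFrame F.pos (verticalSpace E K L)
  obtain ⟨en, hn⟩ := exists_isFrame F.pos (horizontalSpace E K)
  obtain ⟨γ, hγ0, hγ⟩ := F.exists_casimir_vertical
  have key := F.isAdapted_and_isEinstein_iff hγ
  refine ⟨γ, hγ0, hγ, ⟨?_, ?_⟩, fun b Δ hb hΔ hΔ0 => ⟨fun g => ⟨?_, ?_⟩, fun X hX _ =>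
    F.exists_isBinormalMetric hp hn one_pos hX⟩⟩
  · rintro ⟨g, hg⟩
    obtain ⟨s, t, b, -, -, -, hb, hq⟩ := (key g).mp hg
    exact ⟨b, hb, discriminant_nonneg hq⟩
  · rintro ⟨b, hb, hΔ0⟩
    set Δ := 1 - 2 * γ * (1 - γ + 2 * b) with hΔ
    -- The root with the plus sign is positive whatever the sign of 1 - γ + 2b, so Δ ≥ 0 suffices
    -- for existence.
    have hX : 0 < (1 + √Δ) / (2 * γ) := by positivity
    obtain ⟨g, hg⟩ := F.exists_isBinormalMetric hp hn one_pos hX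
    refine ⟨g, (key g).mpr ⟨1, _, b, one_pos, hX, hg, hb, ?_⟩⟩
    rw [div_one, quadratic_iff hγ0 hΔ hΔ0]
    exact Or.inl rfl
  · intro hg
    obtain ⟨s, t, b', hs, ht, hst, hb', hq⟩ := (key g).mp hg
    -- The scalar is unique because 𝔫 is nonzero, so the equation holds with the given b.
    rw [casimirIsScalarOn_unique hNirr.2.1 hb' hb, quadratic_iff hγ0 hΔ hΔ0] at hq
    refine ⟨s, t / s, hs, div_pos ht hs, hq, ?_⟩
    rwa [mul_div_cancel₀ _ hs.ne']
  · rintro ⟨s, X, hs, hX, hroot, hg⟩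
    refine (key g).mpr ⟨s, s * X, b, hs, mul_pos hs hX, hg, hb, ?_⟩
    rwa [mul_div_cancel_left₀ _ hs.ne', quadratic_iff hγ0 hΔ hΔ0]
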